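/- **Theorem.** Let $G$ be a finitely generated nilpotent group with a generating $k$-tuple $(s_1,\dots,s_k)$. For $1\le i\le k$ let $\alpha_i\in(0,2)$, $\kappa_i>0$, and let $\ell_i:[0,\infty)\to(0,\infty)$ be a (measurable) slowly varying function such that $\ell_i(t^b)\simeq\ell_i(t)$ for every $b>0$, where $\simeq$ means that the ratio of the two sides is bounded away from $0$ and $\infty$ for all large $t$. Let $\mu$ be a probability measure on $G$ of the form $$\mu(g)=\frac1k\sum_{i=1}^k\sum_{n\in\mathbb Z}\frac{\kappa_i\,\ell_i(|n|)}{(1+|n|)^{1+\alpha_i}}\,\mathbf 1_{\{s_i^n\}}(g).$$ Let $F_i$ be an (asymptotic) inverse function of $f_i(t)=t^{\alpha_i}/\ell_i(t)$, that is, $F_i(t)\to\infty$, $f_i(F_i(t))\sim t$ and $F_i(f_i(t))\sim t$ as $t\to\infty$. Assume that for all $1\le i,j\le k$ there is a constant $C$ such that either $F_i\le CF_j$ or $F_j\le CF_i$ for all large arguments. Fix $\alpha_0\in(0,2)$ with $\alpha_0>\max_i\alpha_i$ and $\alpha_0/\alpha_i\notin\mathbb N$ for every $i$, and let $K_i:[0,\infty)\to[0,\infty)$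 be convex functions with $K_i(0)=0$ for which there are constants $0<c_i,C_i<\infty$ with $$c_iF_i(t^{\alpha_0})\le K_i(t)\le C_iF_i(t^{\alpha_0})\qquad\text{for all } t\ge1 .$$ For $g\in G$ let $\|g\|=\|g\|_{\mathfrak K}$ be the least $r\ge0$ such that $g=\prod_{j=1}^m s_{i_j}^{\epsilon_j}$ for some $m\geq 0$ and $\epsilon_j=\pm1$ with $\#\{j:i_j=i\}\le K_i(r)$ for every $1\le i\le k$. Put $V(r)=\#\{g:\|g\|\le r\}$. Then $\mu$ is strongly $(\|\cdot\|,\,t\mapsto t^{1/\alpha_0})$-controlled. That is: $\mu$ is symmetric; $\|\cdot\|$ is a norm ($\|g\|\ge 0$, $\|g\|=0$ if and only if $g=e$, and $\|gh\|\le\|g\|+\|h\|$) with finite balls; and, with $r(t)=t^{1/\alpha_0}$, with inverse $\rho(t)=t^{\alpha_0}$, and with $(X_n)_{n\ge0}$ the random walk on $G$ driven by $\mu$ (under $\mathbf P_x$, $X_n=x\xi_1\cdots\xi_n$ with $\xi_1,\xi_2,\dots$ i.i.d. of law $\mu$, and $\mu^{(n)}$ is the law of $X_n$ under $\mathbf P_e$):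 1. There is $C\in(0,\infty)$ and, for every $\kappa>0$, there are $c(\kappa)>0$ and $n(\kappa)\in\mathbb N$ such that for all $n\ge1$ and all $g$ with $\|g\|\le\kappa r(n)$ we have $\mu^{(2n)}(g)\le C\,V(r(n))^{-1}$ and, if moreover $n\ge n(\kappa)$, also $\mu^{(2n)}(g)\ge c(\kappa)\,V(r(n))^{-1}$. 2. There are $\epsilon,\gamma_1\in(0,\infty)$ and $\gamma_2\in[1,\infty)$ such that for all $\tau>0$ and all integers $n$ with $\tfrac12\rho(\tau/\gamma_1)\le n\le\rho(\tau/\gamma_1)$, $$\inf_{x:\|x\|\le\tau}\mathbf P_x\Bigl(\sup_{0\le j\le n}\|X_j\|\le\gamma_2\tau;\ \|X_n\|\le\tau\Bigr)\ge\epsilon .$$ -/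

import Mathlib

open Filter Topology Asymptotics MeasureTheory
open scoped ENNReal

noncomputable section

/-! ### Slow variation and asymptotic inverses -/

/-- A positive slowly varying function on `[0, ∞)` (values at negative reals are irrelevant). -/
structure IsSlowlyVarying (l : ℝ → ℝ) : Prop where
  measurable : Measurable fun t : Set.Ici (0 : ℝ) => l t
  pos : ∀ t, 0 ≤ t → 0 < l t
  tendsto : ∀ c : ℝ, 0 < c → Tendsto (fun t => l (c * t) / l t) atTop (𝓝 1)

/-- `F` is an inverse function of `f` near infinity, in the sense customary for regularly varying
functions (which need not be continuous or monotone): `f (F t) ~ t` and `F (f t) ~ t`. An exact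
inverse, and also the generalized inverse of a regularly varying `f` of positive index, is of
this kind. -/
structure IsAsymptoticInverse (f F : ℝ → ℝ) : Prop where
  tendsto : Tendsto F atTop atTop
  right : (fun t => f (F t)) ~[atTop] fun t => t
  left : (fun t => F (f t)) ~[atTop] fun t => t

section Group

variable {G : Type*} [Group G]

/-! ### Norms on groups -/

/-- `N` is a norm on the group `G`. -/
structure IsNorm (N : G → ℝ) : Prop where
  nonneg : ∀ g, 0 ≤ N g
  eq_zero_iff : ∀ g, N g = 0 ↔ g = 1
  mul_le : ∀ g h, N (g * h) ≤ N g + N h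

/-- The volume function `V(r) = #{g : N g ≤ r}`. -/
def volumeFun (N : G → ℝ) (r : ℝ) : ℕ := Nat.card {g : G // N g ≤ r}

/-- The least `r ≥ 0` such that `g` is a word in the letters `s i ^ (±1)` in which, for each `i`,
at most `K i r` letters are `s i` or its inverse. -/
def wordNorm {k : ℕ} (s : Fin k → G) (K : Fin k → ℝ → ℝ) (g : G) : ℝ :=
  sInf {r : ℝ | 0 ≤ r ∧ ∃ w : List (Fin k × ℤˣ),
    (w.map fun p => s p.1 ^ (p.2 : ℤ)).prod = g ∧
    ∀ i, ((w.countP fun p => p.1 = i : ℕ) : ℝ) ≤ K i r}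

/-! ### Random walks -/

/-- The convolution powers `μ^(n)`. -/
def convPow (μ : PMF G) : ℕ → PMF G
  | 0 => PMF.pure 1
  | n + 1 => (convPow μ n).bind fun x => μ.map fun y => x * y

/-- The walk started at `x` with increments `ξ 0, ξ 1, …`, so `X_n = x ξ_0 ⋯ ξ_{n-1}`. -/
def walk (x : G) (ξ : ℕ → G) : ℕ → G
  | 0 => x
  | n + 1 => walk x ξ n * ξ n

/-- The probability of an event about the increments `ξ`, when these are independent with
law `μ`. -/
def incrProb (μ : PMF G) (A : Set (ℕ → G)) : ℝ :=
  letI : MeasurableSpace G := ⊤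
  (Measure.infinitePi fun _ : ℕ => μ.toMeasure).real A

/-- The symmetric probability measure `μ` is strongly `(N, r)`-controlled.
The first six fields are what the notion presupposes of `μ`, `N` and `r`. In `path`, the
equation `r T = τ / γ₁` says that `T = ρ (τ / γ₁)`, where `ρ` is the inverse function of `r`. -/
structure StronglyControlled (μ : PMF G) (N : G → ℝ) (r : ℝ → ℝ) : Prop where
  symm : ∀ g, μ g⁻¹ = μ g
  norm : IsNorm N
  finite_ball : ∀ R, {g : G | N g ≤ R}.Finite
  pos : ∀ t, 0 < t → 0 < r t
  strictMono : StrictMonoOn r (Set.Ioi 0)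
  continuous : ContinuousOn r (Set.Ioi 0)
  pointwise : ∃ C : ℝ, 0 < C ∧ ∀ κ : ℝ, 0 < κ → ∃ c : ℝ, 0 < c ∧ ∃ n₀ : ℕ,
    ∀ n : ℕ, 1 ≤ n → ∀ g : G, N g ≤ κ * r n →
      (n₀ ≤ n → c * (volumeFun N (r n) : ℝ)⁻¹ ≤ (convPow μ (2 * n) g).toReal) ∧
      (convPow μ (2 * n) g).toReal ≤ C * (volumeFun N (r n) : ℝ)⁻¹
  path : ∃ ε γ₁ γ₂ : ℝ, 0 < ε ∧ 0 < γ₁ ∧ 1 ≤ γ₂ ∧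
    ∀ (n : ℕ) (τ T : ℝ), 0 < τ → 0 < T → r T = τ / γ₁ → T / 2 ≤ n → n ≤ T →
      ∀ x : G, N x ≤ τ →
        ε ≤ incrProb μ {ξ | (∀ j ≤ n, N (walk x ξ j) ≤ γ₂ * τ) ∧ N (walk x ξ n) ≤ τ}

/-- The mass at `g` of the measure
`(1/k) ∑_i ∑_{n ∈ ℤ} κ_i ℓ_i(|n|) (1+|n|)^{-(1+α_i)} 1_{s_i^n}`. -/
def powerMass {k : ℕ} (s : Fin k → G) (κ α : Fin k → ℝ) (l : Fin k → ℝ → ℝ) (g : G) : ℝ≥0∞ :=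
  (k : ℝ≥0∞)⁻¹ * ∑ i, ∑' n : ℤ,
    ENNReal.ofReal (κ i * l i |(n : ℝ)| / (1 + |(n : ℝ)|) ^ (1 + α i)) *
      Set.indicator {s i ^ n} 1 g

end Group

end

/-! The proof has an algebraic half, describing the balls of the norm, and an analytic half, valid
for lazy symmetric walks on groups with a doubling norm.

Algebra. An element of norm at most `a * r` is a product of boundedly many powers `s i ^ m` with
`|m|` at most a constant times `K i r` (`exists_mem_powProd`), and conjugating an element of norm `δ
* r` by one of norm `a * r` gives norm at most `η * r` when `δ` is small (`exists_conj_le`). Both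
rest on a weighted collection process. A formal commutator weighs the product of the weights of its
letters, and each occurrence of it costs the inverse weight. Conjugation by `a ^ m` with `|m|` at
most `M` times the weight of `a` multiplies the cost by at most `exp (D * M)`, uniformly in the
weights. A large power of `[b₁, b₂]` is traded for a single commutator `[b₁ ^ X, b₂ ^ Y]` and longer
brackets; modulo the centre its two entries are handled by induction on the class, and central
factors do not affect a commutator. Volume doubling follows.

Input on the measure. Potter bounds show that `K i` inverts `t ^ α i / l i t` at scale `r ^ α₀`, up
to constants. Hence a step `s i ^ m` with `|m|` of order at most `K i r` has mass at least `c / (r ^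
α₀ * K i r)` (`HasJumps`), while a step leaves the ball of radius `r` with probability at most `C /
r ^ α₀`. Averaging over the long jumps gives the pseudo-Poincaré inequality; these facts make up
`IsStableLike`.

Analysis. Let `u` be the density of `μ^(n)`. The squared distance from `u` to its right translate by
`y` is `2 * (μ^(2n)(1) - μ^(2n)(y))`, and the Poincaré inequality together with laziness bounds it
by a multiple of `r ^ α₀` times the decrement of the return probability. Averaging over a ball gives
a Nash type inequality and the upper bound (`exists_returnProb_le`). The Dirichlet form of a tent
function bounds the probability of escaping distance `r` in `n` steps by `C * n / r ^ α₀`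
(`exists_escape_le`); Cauchy–Schwarz then bounds the return probability from below, and the
near-diagonal estimate follows. To go further, `g` is written as a bounded product of powers: with
positive probability the walk makes these jumps one after the other with small excursions in
between, the resulting errors staying small after conjugation, and the near-diagonal bound finishes
(`HasJumps.hasLowerBound`). The path estimate subtracts from the probability of ending in the ball
that of returning from far away (`exists_path`). -/

/-! ### Formal commutators, weighted spellings and the cost of conjugation. -/

section Spelling

variable {G : Type*} [Group G] {k : ℕ}

/-- The value of a formal commutator, where `x * y` stands for `x⁻¹ y⁻¹ x y`. -/
def commVal (s : Fin k → G) : FreeMagma (Fin k) → G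
  | .of i => s i
  | .mul x y => (commVal s x)⁻¹ * (commVal s y)⁻¹ * commVal s x * commVal s y

/-- The multiplicative weight of a formal commutator. -/
def commWt (N : Fin k → ℕ) : FreeMagma (Fin k) → ℕ
  | .of i => N i
  | .mul x y => commWt N x * commWt N y

@[simp] lemma commVal_of (s : Fin k → G) (i : Fin k) : commVal s (.of i) = s i := rfl

lemma commVal_mul (s : Fin k → G) (x y : FreeMagma (Fin k)) :
    commVal s (x * y) = (commVal s x)⁻¹ * (commVal s y)⁻¹ * commVal s x * commVal s y := rfl

@[simp] lemma commWt_of (N : Fin k → ℕ) (i : Fin k) : commWt N (.of i) = N i := rfl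

@[simp] lemma commWt_mul (N : Fin k → ℕ) (x y : FreeMagma (Fin k)) :
    commWt N (x * y) = commWt N x * commWt N y := rfl

lemma freeMagma_length_mul (x y : FreeMagma (Fin k)) : (x * y).length = x.length + y.length := rfl

lemma one_le_commWt {N : Fin k → ℕ} (hN : ∀ i, 1 ≤ N i) (x : FreeMagma (Fin k)) :
    1 ≤ commWt N x := by
  induction x with
  | ih1 i => exact hN i
  | ih2 x y hx hy => exact Nat.mul_pos hx hy

lemma commWt_pos {N : Fin k → ℕ} (hN : ∀ i, 1 ≤ N i) (x : FreeMagma (Fin k)) :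
    (0 : ℝ) < commWt N x := by exact_mod_cast one_le_commWt hN x

lemma commWt_le_mul_pow {N N' : Fin k → ℕ} {c : ℝ} (hc : 0 ≤ c) (h : ∀ i, (N i : ℝ) ≤ c * N' i)
    (x : FreeMagma (Fin k)) : (commWt N x : ℝ) ≤ c ^ x.length * commWt N' x := by
  induction x with
  | ih1 i => simpa using h i
  | ih2 x y hx hy =>
    rw [commWt_mul, commWt_mul, freeMagma_length_mul, pow_add]
    push_cast
    calc (commWt N x : ℝ) * commWt N y
        ≤ (c ^ x.length * commWt N' x) * (c ^ y.length * commWt N' y) := by gcongr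
      _ = _ := by ring

lemma commVal_map {H : Type*} [Group H] (f : G →* H) (s : Fin k → G) (x : FreeMagma (Fin k)) :
    commVal (fun i => f (s i)) x = f (commVal s x) := by
  induction x with
  | ih1 i => rfl
  | ih2 x y hx hy => simp [commVal_mul, hx, hy]

/-- One entry of a bracket contains at least half of its letters, and one deep entry suffices to
push the bracket one term further down the series. The bound `2 ^ n` is crude, but only the
triviality of long brackets is needed. -/
lemma commVal_mem_lowerCentralSeries (s : Fin k → G) (n : ℕ) :
    ∀ x : FreeMagma (Fin k), 2 ^ n ≤ x.length →
      commVal s x ∈ (⊤ : Subgroup G).lowerCentralSeries n := by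
  induction n with
  | zero => intro x _; simp
  | succ n ih =>
    intro x hx
    cases x with
    | of i =>
      have h1 : FreeMagma.length (FreeMagma.of i) = 1 := rfl
      have := Nat.one_lt_two_pow (n := n + 1) (by omega)
      omega
    | mul x y =>
      have hlen : FreeMagma.length (x.mul y) = x.length + y.length := rfl
      have hv : commVal s (x.mul y) =
          (commVal s x)⁻¹ * (commVal s y)⁻¹ * commVal s x * commVal s y := rfl
      rw [hlen, pow_succ] at hx
      rw [hv, Subgroup.lowerCentralSeries_succ]
      rcases le_total (2 ^ n) x.length with h | h
      · have := Subgroup.commutator_mem_commutator (inv_mem (ih x h))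
          (Subgroup.mem_top (commVal s y)⁻¹)
        simpa [commutatorElement_def] using this
      · have := Subgroup.commutator_mem_commutator (inv_mem (ih y (by omega)))
          (Subgroup.mem_top (commVal s x)⁻¹)
        simpa [commutatorElement_def, mul_assoc] using inv_mem this

lemma exists_commVal_eq_one [Group.IsNilpotent G] (s : Fin k → G) :
    ∃ D : ℕ, 1 ≤ D ∧ ∀ x : FreeMagma (Fin k), D < x.length → commVal s x = 1 := by
  obtain ⟨n, hn⟩ := Subgroup.nilpotent_iff_lowerCentralSeries.1 ‹Group.IsNilpotent G›
  refine ⟨2 ^ n, Nat.one_le_two_pow, fun x hx => ?_⟩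
  have h := commVal_mem_lowerCentralSeries s n x hx.le
  rw [hn] at h
  simpa using h

/-- `Spell s N A r g` says that `g` is a product of values of formal commutators from `A` and
their inverses, where a commutator of weight `w` costs `w⁻¹` and the total cost is at most `r`. -/
inductive Spell (s : Fin k → G) (N : Fin k → ℕ) (A : Set (FreeMagma (Fin k))) : ℝ → G → Prop
  | one {r : ℝ} : 0 ≤ r → Spell s N A r 1
  | pos {r : ℝ} {x : FreeMagma (Fin k)} : x ∈ A → (commWt N x : ℝ)⁻¹ ≤ r →
      Spell s N A r (commVal s x)
  | neg {r : ℝ} {x : FreeMagma (Fin k)} : x ∈ A → (commWt N x : ℝ)⁻¹ ≤ r →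
      Spell s N A r (commVal s x)⁻¹
  | mul {r r' : ℝ} {g h : G} : Spell s N A r g → Spell s N A r' h → Spell s N A (r + r') (g * h)

namespace Spell

variable {s : Fin k → G} {N : Fin k → ℕ} {A B : Set (FreeMagma (Fin k))} {r r' : ℝ} {g h : G}

lemma nonneg (hg : Spell s N A r g) : 0 ≤ r := by
  induction hg with
  | one h => exact h
  | pos _ h => exact le_trans (by positivity) h
  | neg _ h => exact le_trans (by positivity) h
  | mul _ _ h1 h2 => exact add_nonneg h1 h2

lemma mono (hg : Spell s N A r g) (hr : r ≤ r') : Spell s N A r' g := by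
  have := hg.mul (Spell.one (sub_nonneg.2 hr))
  simpa using this

lemma mono_set (hg : Spell s N A r g) (hAB : A ⊆ B) : Spell s N B r g := by
  induction hg with
  | one h => exact .one h
  | pos hx h => exact .pos (hAB hx) h
  | neg hx h => exact .neg (hAB hx) h
  | mul _ _ h1 h2 => exact h1.mul h2

lemma inv (hg : Spell s N A r g) : Spell s N A r g⁻¹ := by
  induction hg with
  | one h => simpa using Spell.one h
  | pos hx h => exact .neg hx h
  | neg hx h => simpa using Spell.pos hx h
  | mul _ _ h1 h2 => simpa [add_comm] using h2.mul h1

lemma pow (hg : Spell s N A r g) (n : ℕ) : Spell s N A (n * r) (g ^ n) := by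
  induction n with
  | zero => simpa using Spell.one le_rfl
  | succ n ih =>
    rw [pow_succ]
    exact (ih.mul hg).mono (by push_cast; linarith)

lemma map {H : Type*} [Group H] (f : G →* H) (hg : Spell s N A r g) :
    Spell (fun i => f (s i)) N A r (f g) := by
  induction hg with
  | one h => simpa using Spell.one h
  | pos hx h => rw [← commVal_map]; exact .pos hx h
  | neg hx h => rw [map_inv, ← commVal_map]; exact .neg hx h
  | mul _ _ h1 h2 => rw [map_mul]; exact h1.mul h2

/-- Long brackets have trivial value and can be deleted. A bound on the length is what `rescale`
needs, since changing the weights by a factor loses that factor once per letter of a bracket. -/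
lemma restrict_length {D : ℕ} (hD : ∀ x : FreeMagma (Fin k), D < x.length → commVal s x = 1)
    (hg : Spell s N A r g) : Spell s N (A ∩ {x | x.length ≤ D}) r g := by
  induction hg with
  | one h => exact .one h
  | @pos r x hx h =>
    by_cases hl : x.length ≤ D
    · exact .pos ⟨hx, hl⟩ h
    · rw [hD x (not_le.1 hl)]; exact .one (le_trans (by positivity) h)
  | @neg r x hx h =>
    by_cases hl : x.length ≤ D
    · exact .neg ⟨hx, hl⟩ h
    · rw [hD x (not_le.1 hl), inv_one]; exact .one (le_trans (by positivity) h)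
  | mul _ _ h1 h2 => exact h1.mul h2

lemma rescale {D : ℕ} {c : ℝ} {N' : Fin k → ℕ} (hc : 1 ≤ c) (hN : ∀ i, 1 ≤ N i)
    (hN' : ∀ i, 1 ≤ N' i)
    (hNN : ∀ i, (N i : ℝ) ≤ c * N' i) (hA : ∀ x ∈ A, x.length ≤ D) (hg : Spell s N A r g) :
    Spell s N' A (c ^ D * r) g := by
  have key : ∀ {x : FreeMagma (Fin k)} {r : ℝ}, x ∈ A → (commWt N x : ℝ)⁻¹ ≤ r →
      (commWt N' x : ℝ)⁻¹ ≤ c ^ D * r := by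
    intro x r hx hr
    have h1 := commWt_pos hN x
    have h2 := commWt_pos hN' x
    have h3 : (commWt N x : ℝ) ≤ c ^ D * commWt N' x :=
      (commWt_le_mul_pow (by linarith) hNN x).trans
        (by gcongr; exact hA x hx)
    calc (commWt N' x : ℝ)⁻¹ ≤ c ^ D * (commWt N x : ℝ)⁻¹ := by
          rw [← div_eq_mul_inv, le_div_iff₀ h1, inv_mul_le_iff₀ h2]; linarith
      _ ≤ _ := by gcongr
  induction hg with
  | one h => exact .one (by positivity)
  | pos hx h => exact .pos hx (key hx h)
  | neg hx h => exact .neg hx (key hx h)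
  | mul _ _ h1 h2 => rw [mul_add]; exact h1.mul h2

variable {D : ℕ} (hD1 : 1 ≤ D) (hD : ∀ x : FreeMagma (Fin k), D < x.length → commVal s x = 1)
  (hN : ∀ i, 1 ≤ N i) {a : FreeMagma (Fin k)}

include hD hN in
-- The commutator of `x` with `a⁻¹` is the inverse of `[x, a]` times the commutator of `[x, a]` with
-- `a⁻¹`. Iterating lengthens the bracket, so the expansion stops by nilpotency; `d` bounds the
-- number of steps left, each costing at most the inverse weight of `[x, a]`.
lemma conj_neg_letter (hA : ∀ x ∈ A, x * a ∈ A) (d : ℕ) : ∀ x, x * a ∈ A → D ≤ d + x.length →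
    Spell s N A (d / (commWt N x * commWt N a))
      ((commVal s x)⁻¹ * (commVal s a * commVal s x * (commVal s a)⁻¹)) := by
  induction d with
  | zero =>
    intro x hx hd
    have h1 := commVal_mul s x a
    rw [hD (x * a) (by have := a.length_pos; rw [freeMagma_length_mul]; omega)] at h1
    have h2 : (commVal s x)⁻¹ * (commVal s a * commVal s x * (commVal s a)⁻¹) = 1 := by
      have h3 : commVal s a * commVal s x = commVal s x * commVal s a := by
        have := congrArg (fun t => commVal s a * commVal s x * t) h1
        simpa [mul_assoc] using this
      rw [h3]; group
    rw [h2]; exact .one (by simp)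
  | succ d ih =>
    intro x hx hd
    have h1 := (ih (x * a) (hA _ hx) (by have := a.length_pos; rw [freeMagma_length_mul]; omega))
    have h2 := (Spell.pos (s := s) (N := N) hx le_rfl).mul h1
    have h3 := h2.inv
    have e : (commVal s (x * a) * ((commVal s (x * a))⁻¹ * (commVal s a * commVal s (x * a) *
        (commVal s a)⁻¹)))⁻¹ = (commVal s x)⁻¹ * (commVal s a * commVal s x * (commVal s a)⁻¹) := by
      rw [commVal_mul]; group
    rw [e] at h3
    refine h3.mono ?_
    have p1 := commWt_pos hN x
    have p2 := commWt_pos hN a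
    have p3 : (1 : ℝ) ≤ commWt N a := by exact_mod_cast one_le_commWt hN a
    rw [commWt_mul]
    push_cast
    rw [← one_div, add_comm (d : ℝ) 1, add_div]
    gcongr
    exact le_mul_of_one_le_right (by positivity) p3

include hD1 in
lemma conj_pos_letter {x} (hx : x * a ∈ A) :
    Spell s N A (D / (commWt N x * commWt N a))
      ((commVal s x)⁻¹ * ((commVal s a)⁻¹ * commVal s x * commVal s a)) := by
  have h := Spell.pos (s := s) (N := N) hx le_rfl
  rw [commVal_mul] at h
  have e : (commVal s x)⁻¹ * (commVal s a)⁻¹ * commVal s x * commVal s a =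
    (commVal s x)⁻¹ * ((commVal s a)⁻¹ * commVal s x * commVal s a) := by group
  rw [e] at h
  refine h.mono ?_
  rw [commWt_mul, ← one_div]
  push_cast
  have : (1 : ℝ) ≤ D := by exact_mod_cast hD1
  gcongr

include hD1 hD hN in
-- Each letter `x` acquires a correction whose cost is that of `x` times at most `D` over the weight
-- of `a`. The relative increase is thus inversely proportional to the weight of `a`, and as many
-- conjugations as that weight still multiply the cost only by a constant.
lemma conj_step (hA : ∀ x ∈ A, x * a ∈ A) (hg : Spell s N A r g) :
    Spell s N A ((1 + (D : ℝ) / commWt N a) * r) ((commVal s a)⁻¹ * g * commVal s a) ∧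
    Spell s N A ((1 + (D : ℝ) / commWt N a) * r) (commVal s a * g * (commVal s a)⁻¹) := by
  have hletter : ∀ {x : FreeMagma (Fin k)} {r : ℝ}, x ∈ A → (commWt N x : ℝ)⁻¹ ≤ r →
      Spell s N A ((1 + (D : ℝ) / commWt N a) * r) ((commVal s a)⁻¹ * commVal s x * commVal s a) ∧
      Spell s N A ((1 + (D : ℝ) / commWt N a) * r) (commVal s a * commVal s x * (commVal s a)⁻¹) := by
    intro x r hx hr
    have hle : (commWt N x : ℝ)⁻¹ + D / (commWt N x * commWt N a) ≤ (1 + (D : ℝ) / commWt N a) * r := by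
      have : (commWt N x : ℝ)⁻¹ + D / (commWt N x * commWt N a) =
        (1 + (D : ℝ) / commWt N a) * (commWt N x : ℝ)⁻¹ := by
          have := commWt_pos hN x
          have := commWt_pos hN a
          field_simp
      rw [this]; gcongr
    constructor
    · have := ((Spell.pos (s := s) (N := N) hx le_rfl).mul
        (conj_pos_letter hD1 (hA x hx))).mono hle
      rwa [mul_inv_cancel_left] at this
    · have := ((Spell.pos (s := s) (N := N) hx le_rfl).mul
        (conj_neg_letter hD hN hA D x (hA x hx) (by omega))).mono hle
      rwa [mul_inv_cancel_left] at this
  induction hg with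
  | one h =>
    constructor <;> simpa using Spell.one (by positivity)
  | pos hx h => exact hletter hx h
  | @neg r x hx h =>
    have := hletter hx h
    refine ⟨?_, ?_⟩
    · simpa [mul_assoc] using this.1.inv
    · simpa [mul_assoc] using this.2.inv
  | mul _ _ h1 h2 =>
    rw [mul_add]
    refine ⟨?_, ?_⟩
    · simpa [mul_assoc] using h1.1.mul h2.1
    · simpa [mul_assoc] using h1.2.mul h2.2

include hD1 hD hN in
lemma conj_zpow (hA : ∀ x ∈ A, x * a ∈ A) (hg : Spell s N A r g) (m : ℤ) :
    Spell s N A ((1 + (D : ℝ) / commWt N a) ^ m.natAbs * r) (commVal s a ^ (-m) * g * commVal s a ^ m) := by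
  have hp : ∀ n : ℕ,
      Spell s N A ((1 + (D : ℝ) / commWt N a) ^ n * r) ((commVal s a ^ n)⁻¹ * g * commVal s a ^ n) ∧
      Spell s N A ((1 + (D : ℝ) / commWt N a) ^ n * r) (commVal s a ^ n * g * (commVal s a ^ n)⁻¹) := by
    intro n
    induction n with
    | zero => simpa using hg
    | succ n ih =>
      have h1 := (conj_step hD1 hD hN hA ih.1).1
      have h2 := (conj_step hD1 hD hN hA ih.2).2
      rw [← mul_assoc, ← pow_succ'] at h1 h2
      refine ⟨?_, ?_⟩
      · convert h1 using 1
        rw [pow_succ]; group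
      · convert h2 using 1
        rw [pow_succ']; group
  obtain ⟨n, rfl | rfl⟩ := m.eq_nat_or_neg
  · simpa using (hp n).1
  · simpa using (hp n).2

lemma rho_pow_le (hN : ∀ i, 1 ≤ N i) {M : ℝ} {n : ℕ} (hn : (n : ℝ) ≤ M * commWt N a) :
    (1 + (D : ℝ) / commWt N a) ^ n ≤ Real.exp (D * M) := by
  have ha := commWt_pos hN a
  calc (1 + (D : ℝ) / commWt N a) ^ n ≤ (Real.exp (D / commWt N a)) ^ n := by
        gcongr
        rw [add_comm]; exact Real.add_one_le_exp _
    _ = Real.exp (D * (n / commWt N a)) := by rw [← Real.exp_nat_mul]; congr 1; ring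
    _ ≤ _ := by
        gcongr
        rwa [div_le_iff₀ ha]

include hD1 hD hN in
lemma conj_zpow_exp (hA : ∀ x ∈ A, x * a ∈ A) (hg : Spell s N A r g) {M : ℝ} {m : ℤ}
    (hm : |(m : ℝ)| ≤ M * commWt N a) :
    Spell s N A (Real.exp (D * M) * r) (commVal s a ^ (-m) * g * commVal s a ^ m) := by
  refine (conj_zpow hD1 hD hN hA hg m).mono ?_
  have := hg.nonneg
  gcongr
  apply rho_pow_le hN
  simpa using hm

include hD1 hD hN in
-- Only the deviation of the conjugate from `x` is spelled. The letter `x` itself need not belong to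
-- `A`, which is how `A` can later consist of strictly longer brackets; the `-1` in the cost
-- accounts for its removal.
lemma conj_letter_pow (hA : ∀ x ∈ A, x * a ∈ A) {x : FreeMagma (Fin k)} (hx : x * a ∈ A) (n : ℕ) :
    Spell s N A (((1 + (D : ℝ) / commWt N a) ^ n - 1) / commWt N x)
      ((commVal s x)⁻¹ * ((commVal s a ^ n)⁻¹ * commVal s x * commVal s a ^ n)) := by
  induction n with
  | zero => simpa using Spell.one le_rfl
  | succ n ih =>
    have h1 := (conj_pos_letter hD1 hx).mul (conj_step hD1 hD hN hA ih).1
    convert h1 using 1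
    · rw [pow_succ]
      generalize (1 + (D : ℝ) / commWt N a) ^ n = t
      have := commWt_pos hN x
      have := commWt_pos hN a
      field_simp
      ring
    · rw [pow_succ]; group

include hD1 hD hN in
/-- Collecting all occurrences of one letter on the left. -/
lemma collect_letter (hAB : ∀ x ∈ A, x ≠ a → x ∈ B) (hB : ∀ x ∈ B, x * a ∈ B)
    (hg : Spell s N A r g) : ∃ e : ℤ, |(e : ℝ)| ≤ r * commWt N a ∧
      Spell s N B (Real.exp (D * r) * r) (commVal s a ^ (-e) * g) := by
  have ha := commWt_pos hN a
  have hle : ∀ {r : ℝ}, 0 ≤ r → r ≤ Real.exp (D * r) * r := fun h =>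
    le_mul_of_one_le_left h (Real.one_le_exp (by positivity))
  induction hg with
  | one h => exact ⟨0, by simpa using by positivity, by simpa using Spell.one (by positivity)⟩
  | @pos r x hx h =>
    have hr : 0 ≤ r := le_trans (by positivity) h
    by_cases hxa : x = a
    · subst hxa
      refine ⟨1, ?_, ?_⟩
      · rw [inv_le_iff_one_le_mul₀ ha] at h; simpa using h
      · simpa using Spell.one (by positivity)
    · exact ⟨0, by simpa using by positivity,
        by simpa using (Spell.pos (hAB x hx hxa) h).mono (hle hr)⟩
  | @neg r x hx h =>
    have hr : 0 ≤ r := le_trans (by positivity) h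
    by_cases hxa : x = a
    · subst hxa
      refine ⟨-1, ?_, ?_⟩
      · rw [inv_le_iff_one_le_mul₀ ha] at h; simpa using h
      · simpa using Spell.one (by positivity)
    · exact ⟨0, by simpa using by positivity,
        by simpa using (Spell.neg (hAB x hx hxa) h).mono (hle hr)⟩
  | @mul r r' g h hg hh ih1 ih2 =>
    obtain ⟨e, he, h1⟩ := ih1
    obtain ⟨e', he', h2⟩ := ih2
    refine ⟨e + e', ?_, ?_⟩
    · push_cast
      exact (abs_add_le _ _).trans (by linarith)
    -- The power of `a` collected from `h` passes to the left over the remainder of `g`, which gets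
    -- conjugated by it.
    · have h3 := (conj_zpow_exp hD1 hD hN hB h1 he').mul h2
      have e1 : commVal s a ^ (-e') * (commVal s a ^ (-e) * g) * commVal s a ^ e' *
          (commVal s a ^ (-e') * h) = commVal s a ^ (-(e + e')) * (g * h) := by
        group
      rw [e1] at h3
      refine h3.mono ?_
      have := hg.nonneg
      have := hh.nonneg
      have e2 : Real.exp (D * r') * (Real.exp (D * r) * r) = Real.exp (D * (r + r')) * r := by
        rw [← mul_assoc, ← Real.exp_add]; ring_nf
      rw [e2]
      have e3 : Real.exp (D * r') ≤ Real.exp (D * (r + r')) := by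
        gcongr; linarith
      linarith [mul_le_mul_of_nonneg_right e3 hh.nonneg]

end Spell
end Spelling

/-! ### Collection: bounded cost implies a bounded product of powers of generators. -/

section Collect

variable {G : Type*} [Group G] {k : ℕ}

namespace Spell

variable {s : Fin k → G} {N : Fin k → ℕ} {A : Set (FreeMagma (Fin k))}
  {D : ℕ} (hD1 : 1 ≤ D) (hD : ∀ x : FreeMagma (Fin k), D < x.length → commVal s x = 1)
  (hN : ∀ i, 1 ≤ N i)

include hD1 hD hN in
-- The errors of two approximations by powers of `b` combine after the first is conjugated by the
-- second power. With the cost in the form of a growth factor to the power `T`, times `r`, both `T`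
-- and `r` are additive, so long products can be treated by induction.
lemma pow_inv_mul_mul {b : FreeMagma (Fin k)} (hA : ∀ x ∈ A, x * b ∈ A) {T₁ T₂ : ℕ} {r₁ r₂ : ℝ}
    {g₁ g₂ : G}
    (h₁ : Spell s N A ((1 + (D : ℝ) / commWt N b) ^ T₁ * r₁) ((commVal s b ^ T₁)⁻¹ * g₁))
    (h₂ : Spell s N A ((1 + (D : ℝ) / commWt N b) ^ T₂ * r₂) ((commVal s b ^ T₂)⁻¹ * g₂)) :
    Spell s N A ((1 + (D : ℝ) / commWt N b) ^ (T₁ + T₂) * (r₁ + r₂))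
      ((commVal s b ^ (T₁ + T₂))⁻¹ * (g₁ * g₂)) := by
  have h3 := (conj_zpow hD1 hD hN hA h₁ T₂).mul h₂
  have hr2 : 0 ≤ r₂ := nonneg_of_mul_nonneg_right h₂.nonneg (by positivity)
  have hb := commWt_pos hN b
  have e : commVal s b ^ (-(T₂ : ℤ)) * ((commVal s b ^ T₁)⁻¹ * g₁) * commVal s b ^ (T₂ : ℤ) *
      ((commVal s b ^ T₂)⁻¹ * g₂) = (commVal s b ^ (T₁ + T₂))⁻¹ * (g₁ * g₂) := by
    rw [pow_add]; group
  rw [e] at h3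
  refine h3.mono ?_
  rw [mul_add, Int.natAbs_natCast, ← mul_assoc, ← pow_add, add_comm T₂ T₁]
  gcongr
  · rw [le_add_iff_nonneg_right]; positivity
  · omega

include hD1 hD hN in
-- The commutator of `b₁ ^ X` and `b₂ ^ Y` is a product of `X * Y` conjugates of `[b₁, b₂]` by
-- powers of the two entries. Each conjugate differs from `[b₁, b₂]` by longer brackets, at a cost
-- of the order of the inverse weight of `[b₁, b₂]`, and the number of factors is at most `M₁ * M₂`
-- times that weight.
lemma commutator_pow {b₁ b₂ : FreeMagma (Fin k)} {M₁ M₂ : ℝ} (hM₁ : 0 ≤ M₁) (hM₂ : 0 ≤ M₂)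
    {X Y : ℕ} (hX : (X : ℝ) ≤ M₁ * commWt N b₁) (hY : (Y : ℝ) ≤ M₂ * commWt N b₂) :
    Spell s N {x | (b₁ * b₂).length < x.length}
      (Real.exp (D * (M₁ * M₂)) * (M₁ * M₂ * (2 * Real.exp (D * (M₁ + M₂)))))
      ((commVal s (b₁ * b₂) ^ (X * Y))⁻¹ *
        ((commVal s b₁ ^ X)⁻¹ * (commVal s b₂ ^ Y)⁻¹ * commVal s b₁ ^ X * commVal s b₂ ^ Y)) := by
  set b := b₁ * b₂ with hb
  set A : Set (FreeMagma (Fin k)) := {x | b.length < x.length} with hAdef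
  have hA : ∀ a, ∀ x ∈ A, x * a ∈ A := by
    intro a x hx
    simp only [hAdef, Set.mem_ofPred_eq, freeMagma_length_mul] at hx ⊢
    omega
  have hbA : ∀ a, b * a ∈ A := by
    intro a
    have := a.length_pos
    simp only [hAdef, Set.mem_ofPred_eq, freeMagma_length_mul b a]
    omega
  have hwb := commWt_pos hN b
  have hw1 := commWt_pos hN b₁
  have hw2 := commWt_pos hN b₂
  set q : ℝ := 2 * Real.exp (D * (M₁ + M₂)) / commWt N b with hq
  have hone : 1 ≤ 1 + (D : ℝ) / commWt N b := by
    rw [le_add_iff_nonneg_right]; positivity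
  -- A single conjugate of `b`; `q` bounds its deviation from `b`. The exponents `1` put the
  -- estimate in the form required by `pow_inv_mul_mul`.
  have key : ∀ i j : ℕ, i ≤ X → j ≤ Y → Spell s N A ((1 + (D : ℝ) / commWt N b) ^ 1 * q)
      ((commVal s b ^ 1)⁻¹ * ((commVal s b₁ ^ i)⁻¹ *
        ((commVal s b₂ ^ j)⁻¹ * commVal s b * commVal s b₂ ^ j) * commVal s b₁ ^ i)) := by
    intro i j hi hj
    have hi' : (i : ℝ) ≤ M₁ * commWt N b₁ := le_trans (by exact_mod_cast hi) hX
    have hj' : (j : ℝ) ≤ M₂ * commWt N b₂ := le_trans (by exact_mod_cast hj) hY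
    have h1 := conj_letter_pow hD1 hD hN (hA b₁) (hbA b₁) i
    have h2 := conj_letter_pow hD1 hD hN (hA b₂) (hbA b₂) j
    have h3 := h1.mul (conj_zpow_exp (M := M₁) (m := i) hD1 hD hN (hA b₁) h2 (by simpa using hi'))
    convert h3.mono (r' := (1 + (D : ℝ) / commWt N b) ^ 1 * q) ?_ using 1
    · simp only [pow_one, zpow_neg, zpow_natCast]; group
    · have l1 := rho_pow_le (D := D) hN hi'
      have l2 := rho_pow_le (D := D) hN hj'
      have l3 : Real.exp (D * M₁) ≤ Real.exp (D * (M₁ + M₂)) := by gcongr; linarith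
      calc ((1 + (D : ℝ) / commWt N b₁) ^ i - 1) / commWt N b +
            Real.exp (D * M₁) * (((1 + (D : ℝ) / commWt N b₂) ^ j - 1) / commWt N b)
          ≤ Real.exp (D * (M₁ + M₂)) / commWt N b +
            Real.exp (D * M₁) * (Real.exp (D * M₂) / commWt N b) := by
            gcongr <;> linarith
        _ = q := by rw [hq, ← mul_div_assoc, ← Real.exp_add]; ring_nf
        _ ≤ _ := le_mul_of_one_le_left (by positivity) (by simpa using hone)
  -- Here `[b₁, b₂ ^ (j+1)]` is `[b₁, b₂ ^ j]` times the conjugate of `b` by `b₂ ^ j`; everything is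
  -- conjugated by `b₁ ^ i` for use in the expansion in the first entry.
  have key2 : ∀ i : ℕ, i ≤ X → ∀ j ≤ Y,
      Spell s N A ((1 + (D : ℝ) / commWt N b) ^ j * (j * q))
      ((commVal s b ^ j)⁻¹ * ((commVal s b₁ ^ i)⁻¹ *
        ((commVal s b₁)⁻¹ * (commVal s b₂ ^ j)⁻¹ * commVal s b₁ * commVal s b₂ ^ j) *
          commVal s b₁ ^ i)) := by
    intro i hi j
    induction j with
    | zero => intro _; simpa using Spell.one le_rfl
    | succ j ih =>
      intro hj
      have h := pow_inv_mul_mul hD1 hD hN (hA b) (ih (by omega)) (key i j hi (by omega))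
      convert h using 1
      · push_cast; ring
      · rw [hb, commVal_mul, pow_succ (commVal s b₂)]; group
  have key3 : ∀ i ≤ X,
      Spell s N A ((1 + (D : ℝ) / commWt N b) ^ (i * Y) * (i * (Y * q)))
      ((commVal s b ^ (i * Y))⁻¹ *
        ((commVal s b₁ ^ i)⁻¹ * (commVal s b₂ ^ Y)⁻¹ * commVal s b₁ ^ i * commVal s b₂ ^ Y)) := by
    intro i
    induction i with
    | zero => intro _; simpa using Spell.one le_rfl
    | succ i ih =>
      intro hi
      have h := pow_inv_mul_mul hD1 hD hN (hA b) (key2 i (by omega) Y le_rfl) (ih (by omega))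
      have e : Y + i * Y = (i + 1) * Y := by ring
      rw [e] at h
      convert h using 1
      · push_cast; ring
      · rw [pow_succ' (commVal s b₁) i]; group
  refine (key3 X le_rfl).mono ?_
  have hXY : ((X * Y : ℕ) : ℝ) ≤ M₁ * M₂ * commWt N b := by
    rw [hb, commWt_mul]; push_cast
    calc (X : ℝ) * Y ≤ (M₁ * commWt N b₁) * (M₂ * commWt N b₂) := by gcongr
      _ = _ := by ring
  calc (1 + (D : ℝ) / commWt N b) ^ (X * Y) * (X * (Y * q))
      ≤ Real.exp (D * (M₁ * M₂)) * (M₁ * M₂ * commWt N b * q) := by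
        rw [← mul_assoc (X : ℝ)]
        push_cast at hXY
        gcongr
        exact rho_pow_le hN (by exact_mod_cast hXY)
    _ = _ := by rw [hq]; field_simp

end Spell

/-- Products of at most `p` powers `s i ^ m` with `|m| ≤ C * N i`. -/
def PowProd (s : Fin k → G) (N : Fin k → ℕ) (p : ℕ) (C : ℝ) : Set G :=
  {g | ∃ w : List (Fin k × ℤ), w.length ≤ p ∧ (∀ q ∈ w, |(q.2 : ℝ)| ≤ C * N q.1) ∧
    (w.map fun q => s q.1 ^ q.2).prod = g}

namespace PowProd

variable {s : Fin k → G} {N : Fin k → ℕ} {p p' : ℕ} {C C' : ℝ} {g h : G}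

lemma mono (hg : g ∈ PowProd s N p C) (hp : p ≤ p') (hC : C ≤ C') : g ∈ PowProd s N p' C' := by
  obtain ⟨w, h1, h2, h3⟩ := hg
  exact ⟨w, h1.trans hp, fun q hq => (h2 q hq).trans (by gcongr), h3⟩

lemma one_mem : (1 : G) ∈ PowProd s N p C := ⟨[], by simp, by simp, by simp⟩

lemma zpow_mem {i : Fin k} {m : ℤ} (hp : 1 ≤ p) (hm : |(m : ℝ)| ≤ C * N i) :
    s i ^ m ∈ PowProd s N p C := ⟨[(i, m)], by simpa using hp, by simpa using hm, by simp⟩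

lemma mul_mem (hg : g ∈ PowProd s N p C) (hh : h ∈ PowProd s N p' C) :
    g * h ∈ PowProd s N (p + p') C := by
  obtain ⟨w, h1, h2, h3⟩ := hg
  obtain ⟨w', h1', h2', h3'⟩ := hh
  refine ⟨w ++ w', by simp; omega, ?_, by simp [h3, h3']⟩
  intro q hq
  rcases List.mem_append.1 hq with hq | hq
  exacts [h2 q hq, h2' q hq]

lemma inv_mem (hg : g ∈ PowProd s N p C) : g⁻¹ ∈ PowProd s N p C := by
  obtain ⟨w, h1, h2, h3⟩ := hg
  refine ⟨(w.map fun q => (q.1, -q.2)).reverse, by simpa using h1, ?_, ?_⟩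
  · intro q hq
    simp only [List.mem_reverse, List.mem_map] at hq
    obtain ⟨q', hq', rfl⟩ := hq
    simpa using h2 q' hq'
  · rw [← h3, List.prod_inv_reverse, List.map_reverse]
    simp [Function.comp_def]

end PowProd

/-- Elements spelled at bounded cost are products of boundedly many powers of bounded size,
uniformly in the sizes `N`. -/
def Collectable (s : Fin k → G) (A : Set (FreeMagma (Fin k))) : Prop :=
  ∀ M : ℝ, ∃ (p : ℕ) (C : ℝ), ∀ N : Fin k → ℕ, (∀ i, 1 ≤ N i) → ∀ g, Spell s N A M g →
    g ∈ PowProd s N p C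

/-- A power `X * Y` of `[b₁, b₂]` is the commutator of `b₁ ^ X` and `b₂ ^ Y` up to longer brackets,
which `hb` handles. The entries are known by `hQ` up to central factors, and these cancel in the
commutator, so four bounded products of powers represent it. -/
lemma commVal_zpow_mem_powProd (s : Fin k → G) {D : ℕ} (hD1 : 1 ≤ D)
    (hD : ∀ x : FreeMagma (Fin k), D < x.length → commVal s x = 1)
    (hQ : Collectable (fun i => (s i : G ⧸ Subgroup.center G)) Set.univ) (b : FreeMagma (Fin k))
    (hb : Collectable s {x | b.length < x.length}) (M : ℝ) :
    ∃ (p : ℕ) (C : ℝ), ∀ N : Fin k → ℕ, (∀ i, 1 ≤ N i) → ∀ m : ℤ, |(m : ℝ)| ≤ M * commWt N b →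
      commVal s b ^ m ∈ PowProd s N p C := by
  cases b with
  | of i => exact ⟨1, M, fun N _ m hm => PowProd.zpow_mem le_rfl hm⟩
  | mul b₁ b₂ =>
    change Collectable s {x | (b₁ * b₂).length < x.length} at hb
    set M' := max M 1 with hM'
    have hM0 : 0 ≤ M' := le_trans zero_le_one (le_max_right _ _)
    obtain ⟨p₁, C₁, h₁⟩ := hQ 1
    obtain ⟨p₂, C₂, h₂⟩ := hQ M'
    obtain ⟨p₃, C₃, h₃⟩ := hb
      (Real.exp (D * (1 * M')) * (1 * M' * (2 * Real.exp (D * (1 + M')))))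
    set C := max (max C₁ C₂) C₃
    have lift : ∀ {N : Fin k → ℕ} {p : ℕ} {C' : ℝ} {g : G}, C' ≤ C →
        (g : G ⧸ Subgroup.center G) ∈ PowProd (fun i => (s i : G ⧸ Subgroup.center G)) N p C' →
        ∃ u ∈ PowProd s N p C, ∃ z ∈ Subgroup.center G, g = u * z := by
      intro N p C' g hC ⟨w, e1, e2, e3⟩
      refine ⟨(w.map fun q => s q.1 ^ q.2).prod,
        PowProd.mono ⟨w, e1, e2, rfl⟩ le_rfl hC,
        ((w.map fun q => s q.1 ^ q.2).prod)⁻¹ * g, ?_, by group⟩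
      rw [← QuotientGroup.eq, ← e3]
      have := map_list_prod (QuotientGroup.mk' (Subgroup.center G))
        (w.map fun q => s q.1 ^ q.2)
      simpa [Function.comp_def] using this
    have core : ∀ N : Fin k → ℕ, (∀ i, 1 ≤ N i) → ∀ X Y : ℕ, (X : ℝ) ≤ 1 * commWt N b₁ →
        (Y : ℝ) ≤ M' * commWt N b₂ →
        commVal s (b₁ * b₂) ^ (X * Y) ∈ PowProd s N (p₁ + p₂ + p₁ + p₂ + p₃) C := by
      intro N hN X Y hX hY
      have hw1 := commWt_pos hN b₁
      have hw2 := commWt_pos hN b₂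
      have hsp : ∀ (b : FreeMagma (Fin k)) (n : ℕ) (M : ℝ), (n : ℝ) ≤ M * commWt N b →
          Spell (fun i => (s i : G ⧸ Subgroup.center G)) N Set.univ M
            ((commVal s b ^ n : G) : G ⧸ Subgroup.center G) := by
        intro b n M hn
        have hw := commWt_pos hN b
        have h := (Spell.pos (s := s) (N := N) (Set.mem_univ b) le_rfl).pow n
        have h' := h.map (QuotientGroup.mk' (Subgroup.center G))
        refine Spell.mono h' ?_
        rwa [← div_eq_mul_inv, div_le_iff₀ hw]
      obtain ⟨u, hu, z, hz, e1⟩ := lift ((le_max_left _ _).trans (le_max_left _ _))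
        (h₁ N hN _ (hsp b₁ X 1 hX))
      obtain ⟨v, hv, t, ht, e2⟩ := lift ((le_max_right _ _).trans (le_max_left _ _))
        (h₂ N hN _ (hsp b₂ Y M' hY))
      have h4 := (h₃ N hN _ (Spell.commutator_pow hD1 hD hN zero_le_one hM0 hX hY))
      have h5 := PowProd.mul_mem (PowProd.mul_mem (PowProd.mul_mem
        (PowProd.mul_mem (PowProd.inv_mem hu) (PowProd.inv_mem hv)) hu) hv)
        (PowProd.mono (PowProd.inv_mem h4) le_rfl (le_max_right _ _))
      convert h5 using 1
      rw [e1, e2]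
      have hz' := Subgroup.mem_center_iff.1 hz
      have ht' := Subgroup.mem_center_iff.1 ht
      -- The central factors `z` and `t` drop out of the commutator.
      have e3 : (u * z)⁻¹ * (v * t)⁻¹ * (u * z) * (v * t) = u⁻¹ * v⁻¹ * u * v := by
        have a1 : (u * z)⁻¹ = u⁻¹ * z⁻¹ := by rw [hz' u]; group
        have a2 : (v * t)⁻¹ = v⁻¹ * t⁻¹ := by rw [ht' v]; group
        calc (u * z)⁻¹ * (v * t)⁻¹ * (u * z) * (v * t)
            = u⁻¹ * (z⁻¹ * (v⁻¹ * t⁻¹ * u) * z) * (v * t) := by rw [a1, a2]; group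
          _ = u⁻¹ * (v⁻¹ * t⁻¹ * u) * (v * t) := by
              rw [mul_assoc z⁻¹, hz' (v⁻¹ * t⁻¹ * u), inv_mul_cancel_left]
          _ = u⁻¹ * v⁻¹ * (t⁻¹ * (u * v) * t) := by group
          _ = _ := by rw [mul_assoc t⁻¹, ht' (u * v), inv_mul_cancel_left]; group
      rw [e3]; group
    refine ⟨(p₁ + p₂ + p₁ + p₂ + p₃) + (p₁ + p₂ + p₁ + p₂ + p₃), C, ?_⟩
    intro N hN m hm
    have hnat : ∀ n : ℕ, (n : ℝ) ≤ M * commWt N (b₁ * b₂) → commVal s (b₁ * b₂) ^ n ∈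
        PowProd s N ((p₁ + p₂ + p₁ + p₂ + p₃) + (p₁ + p₂ + p₁ + p₂ + p₃)) C := by
      intro n hn
      have hw1 := one_le_commWt hN b₁
      have hw1' := commWt_pos hN b₁
      have hw2 : (1 : ℝ) ≤ commWt N b₂ := by exact_mod_cast one_le_commWt hN b₂
      have hdiv : ((n / commWt N b₁ : ℕ) : ℝ) ≤ M' * commWt N b₂ := by
        calc ((n / commWt N b₁ : ℕ) : ℝ) ≤ (n : ℝ) / commWt N b₁ := Nat.cast_div_le
          _ ≤ M * commWt N b₂ := by
            rw [div_le_iff₀ hw1']; rw [commWt_mul] at hn; push_cast at hn; linarith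
          _ ≤ _ := by gcongr; exact le_max_left _ _
      -- Division with remainder by the weight of `b₁`: the multiple is one commutator, and the
      -- remainder is a second one with exponent `1` on `b₂`. The latter is why `M'` is at least
      -- `1`.
      have h1 := core N hN (commWt N b₁) (n / commWt N b₁) (by simp) hdiv
      have h2 := core N hN (n % commWt N b₁) 1
        (by simpa using (Nat.mod_lt n hw1).le)
        (by
          have := le_max_right M 1
          push_cast; nlinarith)
      have h3 := PowProd.mul_mem h1 h2
      rwa [← pow_add, mul_one, Nat.div_add_mod] at h3
    obtain ⟨n, rfl | rfl⟩ := m.eq_nat_or_neg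
    · simpa using hnat n (by simpa using hm)
    · simpa using PowProd.inv_mem (hnat n (by simpa using hm))

lemma finite_length_eq (n : ℕ) : {x : FreeMagma (Fin k) | x.length ≤ n}.Finite := by
  induction n with
  | zero =>
    convert Set.finite_empty
    ext x
    have := x.length_pos
    simp; omega
  | succ n ih =>
    refine ((Set.finite_range (FreeMagma.of : Fin k → _)).union
      (Set.Finite.image2 (fun x y : FreeMagma (Fin k) => x * y) ih ih)).subset ?_
    intro x hx
    cases x with
    | of i => exact Or.inl ⟨i, rfl⟩
    | mul x y =>
      right
      have h1 : x.length + y.length ≤ n + 1 := hx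
      have := x.length_pos
      have := y.length_pos
      exact ⟨x, show x.length ≤ n by omega, y, show y.length ≤ n by omega, rfl⟩

/-- Descending induction on the length of the brackets allowed, starting from those longer than `D`,
whose values are trivial. -/
lemma Collectable.of_center_quotient (s : Fin k → G) {D : ℕ} (hD1 : 1 ≤ D)
    (hD : ∀ x : FreeMagma (Fin k), D < x.length → commVal s x = 1)
    (hQ : Collectable (fun i => (s i : G ⧸ Subgroup.center G)) Set.univ) :
    Collectable s Set.univ := by
  have main : ∀ d : ℕ, Collectable s {x | D < d + x.length} := by
    intro d
    induction d with
    | zero =>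
      intro M
      refine ⟨0, 0, fun N _ g hg => ?_⟩
      have : g = 1 := by
        induction hg with
        | one => rfl
        | pos hx => exact hD _ (by simpa using hx)
        | neg hx => rw [hD _ (by simpa using hx), inv_one]
        | mul _ _ h1 h2 => rw [h1, h2, one_mul]
      rw [this]; exact PowProd.one_mem
    | succ d ih =>
      -- The finitely many brackets of the new length are admitted one at a time. Collecting one of
      -- them on the left creates only longer brackets, which are already allowed.
      have step : ∀ S : Finset (FreeMagma (Fin k)), (∀ b ∈ S, D = d + b.length) →
          Collectable s ({x | D < d + x.length} ∪ S) := by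
        intro S
        induction S using Finset.induction_on with
        | empty => intro _; simpa using ih
        | insert a S haS ihS =>
          intro hS M
          have ha : D = d + a.length := hS a (Finset.mem_insert_self _ _)
          have hset : {x : FreeMagma (Fin k) | D < d + x.length} =
              {x | a.length < x.length} := by
            ext x; simp only [Set.mem_ofPred_eq]; omega
          obtain ⟨p₁, C₁, h₁⟩ := commVal_zpow_mem_powProd s hD1 hD hQ a (hset ▸ ih) M
          obtain ⟨p₂, C₂, h₂⟩ := ihS (fun b hb => hS b (Finset.mem_insert_of_mem hb))
            (Real.exp (D * M) * M)
          refine ⟨p₁ + p₂, max C₁ C₂, fun N hN g hg => ?_⟩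
          have hAB : ∀ x ∈ {x | D < d + x.length} ∪ (↑(insert a S) : Set (FreeMagma (Fin k))),
              x ≠ a → x ∈ {x | D < d + x.length} ∪ (S : Set (FreeMagma (Fin k))) := by
            rintro x (hx | hx) hxa
            · exact Or.inl hx
            · rw [Finset.coe_insert] at hx
              exact Or.inr (hx.resolve_left hxa)
          have hB : ∀ x ∈ {x | D < d + x.length} ∪ (S : Set (FreeMagma (Fin k))),
              x * a ∈ {x | D < d + x.length} ∪ (S : Set (FreeMagma (Fin k))) := by
            rintro x hx
            left
            have hl := a.length_pos
            simp only [Set.mem_ofPred_eq, freeMagma_length_mul]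
            rcases hx with hx | hx
            · simp only [Set.mem_ofPred_eq] at hx; omega
            · have := hS x (Finset.mem_insert_of_mem hx); omega
          obtain ⟨e, he, hsp⟩ := Spell.collect_letter hD1 hD hN hAB hB hg
          have h3 := PowProd.mul_mem (PowProd.mono (h₁ N hN e he) le_rfl (le_max_left C₁ C₂))
            (PowProd.mono (h₂ N hN _ hsp) le_rfl (le_max_right C₁ C₂))
          simpa using h3
      have hfin : {x : FreeMagma (Fin k) | D = d + x.length}.Finite :=
        (finite_length_eq D).subset fun x hx => by
          simp only [Set.mem_ofPred_eq] at hx ⊢; omega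
      have := step hfin.toFinset (by simp)
      intro M
      obtain ⟨p, C, h⟩ := this M
      refine ⟨p, C, fun N hN g hg => h N hN g (hg.mono_set ?_)⟩
      intro x hx
      simp only [Set.mem_ofPred_eq, Set.Finite.coe_toFinset, Set.mem_union] at hx ⊢
      omega
  intro M
  obtain ⟨p, C, h⟩ := main D M
  exact ⟨p, C, fun N hN g hg => h N hN g (hg.mono_set fun x _ => by
    have := x.length_pos
    simp only [Set.mem_ofPred_eq]; omega)⟩

theorem collectable_univ [Group.IsNilpotent G] (s : Fin k → G) : Collectable s Set.univ := by
  refine Group.nilpotent_center_quotient_ind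
    (P := fun G _ _ => ∀ s : Fin k → G, Collectable s Set.univ) G ?_ ?_ s
  · intro G _ _ s M
    exact ⟨0, 0, fun N _ g _ => Subsingleton.elim 1 g ▸ PowProd.one_mem⟩
  · intro G _ _ ih s
    obtain ⟨D, hD1, hD⟩ := exists_commVal_eq_one s
    exact Collectable.of_center_quotient s hD1 hD (ih _)

end Collect

/-! ### Words with prescribed letter counts, and conjugation of small elements by large ones. -/

section WordBall

variable {G : Type*} [Group G] {k : ℕ}

/-- Values of words with at most `b i` letters `s i ^ (±1)` for each `i`. -/
def WordBall (s : Fin k → G) (b : Fin k → ℝ) : Set G :=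
  {g | ∃ w : List (Fin k × ℤˣ), (w.map fun p => s p.1 ^ (p.2 : ℤ)).prod = g ∧
    ∀ i, ((w.countP fun p => p.1 = i : ℕ) : ℝ) ≤ b i}

namespace WordBall

variable {s : Fin k → G} {b b' : Fin k → ℝ} {g h : G}

lemma mono (hg : g ∈ WordBall s b) (hb : ∀ i, b i ≤ b' i) : g ∈ WordBall s b' := by
  obtain ⟨w, h1, h2⟩ := hg
  exact ⟨w, h1, fun i => (h2 i).trans (hb i)⟩

lemma one_mem (hb : ∀ i, 0 ≤ b i) : (1 : G) ∈ WordBall s b := ⟨[], by simp, by simpa using hb⟩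

lemma mul_mem (hg : g ∈ WordBall s b) (hh : h ∈ WordBall s b') :
    g * h ∈ WordBall s (fun i => b i + b' i) := by
  obtain ⟨w, h1, h2⟩ := hg
  obtain ⟨w', h1', h2'⟩ := hh
  refine ⟨w ++ w', by simp [h1, h1'], fun i => ?_⟩
  rw [List.countP_append]
  push_cast
  exact add_le_add (h2 i) (h2' i)

lemma inv_mem (hg : g ∈ WordBall s b) : g⁻¹ ∈ WordBall s b := by
  obtain ⟨w, h1, h2⟩ := hg
  refine ⟨(w.map fun q => (q.1, -q.2)).reverse, ?_, fun i => ?_⟩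
  · rw [← h1, List.prod_inv_reverse, List.map_reverse]
    simp [Function.comp_def]
  · rw [List.countP_reverse, List.countP_map]
    exact h2 i

lemma gen_mem (i : Fin k) (u : ℤˣ) (hb : ∀ j, 0 ≤ b j) (hi : 1 ≤ b i) :
    s i ^ (u : ℤ) ∈ WordBall s b := by
  refine ⟨[(i, u)], by simp, fun j => ?_⟩
  rw [List.countP_singleton]
  split_ifs with h
  · have : i = j := by simpa using h
    subst this; simpa using hi
  · simpa using hb j

lemma zpow_mem (i : Fin k) (m : ℤ) (hb : ∀ j, 0 ≤ b j) (hi : |(m : ℝ)| ≤ b i) :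
    s i ^ m ∈ WordBall s b := by
  have hnat : ∀ n : ℕ, (n : ℝ) ≤ b i → s i ^ n ∈ WordBall s b := by
    intro n hn
    refine ⟨List.replicate n (i, 1), by simp, fun j => ?_⟩
    rw [List.countP_replicate]
    split_ifs with h
    · have : i = j := by simpa using h
      subst this; simpa using hn
    · simpa using hb j
  obtain ⟨n, rfl | rfl⟩ := m.eq_nat_or_neg
  · simpa using hnat n (by simpa using hi)
  · simpa using inv_mem (hnat n (by simpa using hi))

lemma spell {N : Fin k → ℕ} {M : ℝ} (hN : ∀ i, 1 ≤ N i) (hg : g ∈ WordBall s b)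
    (hb : ∀ i, b i ≤ M * N i) : Spell s N Set.univ (k * M) g := by
  obtain ⟨w, rfl, h2⟩ := hg
  have key : Spell s N Set.univ
      (∑ i, ((w.countP fun p => p.1 = i : ℕ) : ℝ) * (N i : ℝ)⁻¹)
      (w.map fun p => s p.1 ^ (p.2 : ℤ)).prod := by
    clear h2
    induction w with
    | nil => simpa using Spell.one le_rfl
    | cons p w ih =>
      have hp : Spell s N Set.univ (N p.1 : ℝ)⁻¹ (s p.1 ^ (p.2 : ℤ)) := by
        rcases Int.units_eq_one_or p.2 with h | h
        · rw [h]; simpa using Spell.pos (s := s) (N := N) (Set.mem_univ (FreeMagma.of p.1)) le_rfl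
        · rw [h]; simpa using Spell.neg (s := s) (N := N) (Set.mem_univ (FreeMagma.of p.1)) le_rfl
      rw [List.map_cons, List.prod_cons]
      refine (hp.mul ih).mono (le_of_eq ?_)
      simp only [List.countP_cons, Nat.cast_add, add_mul, Finset.sum_add_distrib]
      rw [add_comm]
      congr 1
      rw [Finset.sum_eq_single p.1]
      · simp
      · intro j _ hj; simp [hj.symm]
      · simp
  refine key.mono ?_
  calc ∑ i, ((w.countP fun p => p.1 = i : ℕ) : ℝ) * (N i : ℝ)⁻¹ ≤ ∑ _i : Fin k, M := by
        apply Finset.sum_le_sum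
        intro i _
        have : (0 : ℝ) < N i := by exact_mod_cast hN i
        rw [← div_eq_mul_inv, div_le_iff₀ this]
        exact (h2 i).trans (hb i)
    _ = _ := by simp

end WordBall

lemma PowProd.mem_wordBall {s : Fin k → G} {N : Fin k → ℕ} {p : ℕ} {C : ℝ} {g : G} (hC : 0 ≤ C)
    (hg : g ∈ PowProd s N p C) : g ∈ WordBall s (fun i => p * (C * N i)) := by
  obtain ⟨w, h1, h2, rfl⟩ := hg
  have : (w.map fun q => s q.1 ^ q.2).prod ∈ WordBall s (fun i => w.length * (C * N i)) := by
    clear h1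
    induction w with
    | nil => simpa using WordBall.one_mem (s := s) (b := fun _ => 0) (by simp)
    | cons q w ih =>
      rw [List.map_cons, List.prod_cons]
      refine WordBall.mono (WordBall.mul_mem (WordBall.zpow_mem (b := fun i => C * N i) q.1 q.2
        (fun j => by positivity) (h2 q (by simp)))
        (ih fun q hq => h2 q (by simp [hq]))) fun i => ?_
      simp only [List.length_cons]; push_cast; linarith
  exact WordBall.mono this fun i => by gcongr

theorem wordBall_subset_powProd [Group.IsNilpotent G] (s : Fin k → G) (M : ℝ) :
    ∃ (p : ℕ) (C : ℝ), 0 ≤ C ∧ ∀ N : Fin k → ℕ, (∀ i, 1 ≤ N i) → ∀ g,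
      g ∈ WordBall s (fun i => M * N i) → g ∈ PowProd s N p C := by
  obtain ⟨p, C, h⟩ := collectable_univ s (k * M)
  exact ⟨p, max C 0, le_max_right _ _, fun N hN g hg =>
    PowProd.mono (h N hN g (WordBall.spell hN hg fun _ => le_rfl)) le_rfl (le_max_left _ _)⟩

/-- Conjugating a small element by a large one gives a small element. -/
theorem conj_mem_wordBall [Group.IsNilpotent G] (s : Fin k → G) (p : ℕ) {C ε : ℝ} (hC : 0 ≤ C)
    (hε : 0 < ε) : ∃ δ : ℝ, 0 < δ ∧ ∃ N₀ : ℕ, ∀ N : Fin k → ℕ, (∀ i, N₀ ≤ N i) →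
      ∀ x ∈ PowProd s N p C, ∀ y ∈ WordBall s (fun i => δ * N i),
        x⁻¹ * y * x ∈ WordBall s (fun i => ε * N i) := by
  obtain ⟨D, hD1, hD⟩ := exists_commVal_eq_one s
  obtain ⟨p₁, C₁, h₁⟩ := collectable_univ s 1
  set C₂ := max C₁ 0
  have hC₂ : 0 ≤ C₂ := le_max_right _ _
  -- The conjugate is collected with respect to the reduced weights `N i / q` at cost `1`; the gain
  -- `q` compensates the constants `p₁` and `C₂` of the collection and leaves a factor `ε`. Taking
  -- `N₀ = q` keeps the reduced weights positive.
  obtain ⟨q, hq⟩ := exists_nat_ge (max 1 (p₁ * C₂ / ε))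
  have hq1 : (1 : ℝ) ≤ q := (le_max_left _ _).trans hq
  have hq1' : 1 ≤ q := by exact_mod_cast hq1
  have hq2 : p₁ * C₂ / ε ≤ q := (le_max_right _ _).trans hq
  -- `E` gathers all losses: `(2 * q) ^ D` from reducing the weights of brackets with at most `D`
  -- letters, `exp (D * C)` for each of the `p` conjugating powers, and the number of generators.
  -- With `δ = 1 / E` the final cost is at most `1`.
  set E : ℝ := (2 * q) ^ D * (Real.exp (D * C) ^ p * (k + 1)) with hE
  have hEpos : 0 < E := by positivity
  refine ⟨1 / E, by positivity, q, fun N hN x hx y hy => ?_⟩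
  have hN1 : ∀ i, 1 ≤ N i := fun i => hq1'.trans (hN i)
  have hy' := WordBall.spell hN1 hy fun _ => le_rfl
  have hconj : ∀ w : List (Fin k × ℤ), (∀ q ∈ w, |(q.2 : ℝ)| ≤ C * N q.1) → ∀ r z,
      Spell s N Set.univ r z → Spell s N Set.univ (Real.exp (D * C) ^ w.length * r)
        ((w.map fun q => s q.1 ^ q.2).prod⁻¹ * z * (w.map fun q => s q.1 ^ q.2).prod) := by
    intro w
    induction w with
    | nil => intro _ r z hz; simpa using hz
    | cons a w ih =>
      intro hw r z hz
      have h1 := Spell.conj_zpow_exp (a := FreeMagma.of a.1) (m := a.2) (M := C) hD1 hD hN1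
        (by simp) hz (hw a (by simp))
      have h2 := ih (fun q hq => hw q (by simp [hq])) _ _ h1
      convert h2 using 1
      · rw [List.length_cons, pow_succ]; ring
      · simp only [List.map_cons, List.prod_cons, commVal_of]; group
  obtain ⟨w, hw1, hw2, rfl⟩ := hx
  have hz := (hconj w hw2 _ _ hy').restrict_length hD
  set N' : Fin k → ℕ := fun i => N i / q with hN'
  have hN'1 : ∀ i, 1 ≤ N' i := fun i => (Nat.one_le_div_iff (by omega)).2 (hN i)
  have hNN' : ∀ i, (N i : ℝ) ≤ 2 * q * N' i := by
    intro i
    have h1 : N i < q * N' i + q := by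
      have := Nat.lt_mul_div_succ (N i) (show 0 < q by omega)
      simp only [hN']; linarith
    have h2 : q * 1 ≤ q * N' i := Nat.mul_le_mul_left _ (hN'1 i)
    have h3 : N i ≤ 2 * q * N' i := by nlinarith
    exact_mod_cast h3
  have hz' := Spell.rescale (D := D) (c := 2 * q) (N' := N') (by linarith) hN1 hN'1 hNN'
    (fun x hx => hx.2) hz
  have hcost : (2 * (q : ℝ)) ^ D * (Real.exp (D * C) ^ w.length * (k * (1 / E))) ≤ 1 := by
    have h1 : Real.exp (D * C) ^ w.length ≤ Real.exp (D * C) ^ p := by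
      gcongr
      exact Real.one_le_exp (by positivity)
    calc (2 * (q : ℝ)) ^ D * (Real.exp (D * C) ^ w.length * (k * (1 / E)))
        ≤ (2 * (q : ℝ)) ^ D * (Real.exp (D * C) ^ p * ((k + 1) * (1 / E))) := by
          gcongr; linarith
      _ = E * (1 / E) := by rw [hE]; ring
      _ = 1 := by field_simp
  have hmem := h₁ N' hN'1 _ ((hz'.mono hcost).mono_set (Set.subset_univ _))
  refine WordBall.mono (PowProd.mem_wordBall hC₂
    (PowProd.mono hmem le_rfl (le_max_left _ _))) fun i => ?_
  have h5 : (N' i : ℝ) ≤ N i / q := Nat.cast_div_le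
  calc (p₁ : ℝ) * (C₂ * N' i) ≤ p₁ * (C₂ * (N i / q)) := by gcongr
    _ = (p₁ * C₂ / ε) * (ε * N i / q) := by field_simp
    _ ≤ q * (ε * N i / q) := by gcongr
    _ = _ := by field_simp

end WordBall

/-! ### The norm: triangle inequality, finite balls, conjugation and volume doubling. -/

section Norm

variable {G : Type*} [Group G] {k : ℕ}

/-- The small second factors are moved to the far right. Each is conjugated by a tail product of
first factors, of norm at most `b`, and hence becomes an element of norm at most `c`. -/
lemma IsNorm.prod_mul_eq {N : G → ℝ} (hN : IsNorm N) {a b δ c : ℝ} (ha : 0 ≤ a)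
    (hconj : ∀ x y, N x ≤ b → N y ≤ δ → N (x⁻¹ * y * x) ≤ c) (L : List (G × G))
    (hL : ∀ q ∈ L, N q.1 ≤ a ∧ N q.2 ≤ δ) (hlen : L.length * a ≤ b) :
    N (L.map Prod.fst).prod ≤ L.length * a ∧
    ∃ B, N B ≤ L.length * c ∧
      (L.map fun q => q.1 * q.2).prod = (L.map Prod.fst).prod * B := by
  induction L with
  | nil =>
    have h1 := (hN.eq_zero_iff 1).2 rfl
    exact ⟨by simp [h1], 1, by simp [h1], by simp⟩
  | cons q L ih =>
    have hlen' : (L.length : ℝ) * a ≤ b := by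
      refine le_trans ?_ hlen
      simp only [List.length_cons]; push_cast; nlinarith
    obtain ⟨h1, B, h2, h3⟩ := ih (fun q hq => hL q (by simp [hq])) hlen'
    refine ⟨?_, ((L.map Prod.fst).prod)⁻¹ * q.2 * (L.map Prod.fst).prod * B, ?_, ?_⟩
    · simp only [List.map_cons, List.prod_cons, List.length_cons]
      push_cast
      linarith [hN.mul_le q.1 (L.map Prod.fst).prod, (hL q (by simp)).1]
    · have h4 := hconj _ q.2 (h1.trans hlen') (hL q (by simp)).2
      have h5 := hN.mul_le (((L.map Prod.fst).prod)⁻¹ * q.2 * (L.map Prod.fst).prod) B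
      simp only [List.length_cons]; push_cast; linarith
    · simp only [List.map_cons, List.prod_cons, h3]; group

lemma wordNorm_nonneg (s : Fin k → G) (K : Fin k → ℝ → ℝ) (g : G) : 0 ≤ wordNorm s K g :=
  Real.sInf_nonneg fun _ hr => hr.1

lemma le_two_mul_floor {x : ℝ} (h : 1 ≤ ⌊x⌋₊) : x ≤ 2 * ⌊x⌋₊ := by
  have h1 := Nat.lt_floor_add_one x
  have h2 : (1 : ℝ) ≤ ⌊x⌋₊ := by exact_mod_cast h
  linarith

/-- The properties of the functions `K i` that make `wordNorm` a well-behaved norm. -/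
structure IsScale (K : Fin k → ℝ → ℝ) : Prop where
  convex : ∀ i, ConvexOn ℝ (Set.Ici 0) (K i)
  nonneg : ∀ i, ∀ t, 0 ≤ t → 0 ≤ K i t
  zero : ∀ i, K i 0 = 0
  tendsto : ∀ i, Tendsto (K i) atTop atTop
  doubling : ∀ a : ℝ, 1 ≤ a → ∃ C : ℝ, 0 < C ∧ ∀ᶠ r in atTop, ∀ i, K i (a * r) ≤ C * K i r

namespace IsScale

variable {K : Fin k → ℝ → ℝ} (hK : IsScale K)
include hK

lemma mul_le {i : Fin k} {t r : ℝ} (ht : 0 ≤ t) (ht1 : t ≤ 1) (hr : 0 ≤ r) :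
    K i (t * r) ≤ t * K i r := by
  have := (hK.convex i).2 (show (0 : ℝ) ∈ Set.Ici 0 by simp) (show r ∈ Set.Ici 0 from hr)
    (sub_nonneg.2 ht1) ht (by ring)
  simpa [hK.zero i] using this

lemma mono {i : Fin k} {a b : ℝ} (ha : 0 ≤ a) (hab : a ≤ b) : K i a ≤ K i b := by
  rcases eq_or_lt_of_le (ha.trans hab) with h | h
  · have : a = b := by linarith
    rw [this]
  · have := hK.mul_le (i := i) (t := a / b) (by positivity) (by rw [div_le_one h]; exact hab) h.le
    rw [div_mul_cancel₀ _ h.ne'] at this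
    refine this.trans (mul_le_of_le_one_left (hK.nonneg i b h.le) (by rw [div_le_one h]; exact hab))

lemma le_mul {i : Fin k} {t r : ℝ} (ht : 1 ≤ t) (hr : 0 ≤ r) : t * K i r ≤ K i (t * r) := by
  have h0 : 0 < t := by linarith
  have := hK.mul_le (i := i) (t := 1 / t) (r := t * r) (by positivity)
    (by rw [div_le_one h0]; exact ht) (by positivity)
  rw [← mul_assoc, one_div_mul_cancel h0.ne', one_mul, div_mul_eq_mul_div, one_mul,
    le_div_iff₀ h0] at this
  linarith

/-- Superadditivity of a convex function vanishing at `0`. It is exactly what the triangle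
inequality for `wordNorm` requires. -/
lemma add_le {i : Fin k} {a b : ℝ} (ha : 0 ≤ a) (hb : 0 ≤ b) : K i a + K i b ≤ K i (a + b) := by
  rcases eq_or_lt_of_le (add_nonneg ha hb) with h | h
  · have h1 : a = 0 := by linarith
    have h2 : b = 0 := by linarith
    simp [h1, h2, hK.zero i]
  · have h1 := hK.mul_le (i := i) (t := a / (a + b)) (r := a + b) (by positivity)
      (by rw [div_le_one h]; linarith) h.le
    have h2 := hK.mul_le (i := i) (t := b / (a + b)) (r := a + b) (by positivity)
      (by rw [div_le_one h]; linarith) h.le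
    rw [div_mul_cancel₀ _ h.ne'] at h1 h2
    have h3 : a / (a + b) * K i (a + b) + b / (a + b) * K i (a + b) = K i (a + b) := by
      field_simp
    linarith

lemma exists_mem_wordBall {s : Fin k → G} (hs : Subgroup.closure (Set.range s) = ⊤) (g : G) :
    ∃ r, 0 ≤ r ∧ g ∈ WordBall s (fun i => K i r) := by
  have hw : ∃ b, g ∈ WordBall s b := by
    have hg : g ∈ Subgroup.closure (Set.range s) := hs ▸ Subgroup.mem_top g
    induction hg using Subgroup.closure_induction with
    | mem x hx =>
      obtain ⟨i, rfl⟩ := hx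
      exact ⟨fun _ => 1, by simpa using WordBall.gen_mem (b := fun _ => 1) i 1 (by simp) le_rfl⟩
    | one => exact ⟨0, WordBall.one_mem (by simp)⟩
    | mul x y _ _ hx hy =>
      obtain ⟨b, hb⟩ := hx
      obtain ⟨b', hb'⟩ := hy
      exact ⟨_, WordBall.mul_mem hb hb'⟩
    | inv x _ hx =>
      obtain ⟨b, hb⟩ := hx
      exact ⟨b, WordBall.inv_mem hb⟩
  obtain ⟨b, hb⟩ := hw
  have h1 : ∀ᶠ r in atTop, ∀ i, b i ≤ K i r :=
    eventually_all.2 fun i => (hK.tendsto i).eventually_ge_atTop (b i)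
  obtain ⟨r, hr, hr0⟩ := (h1.and (eventually_ge_atTop 0)).exists
  exact ⟨r, hr0, WordBall.mono hb hr⟩

/-- The infimum is attained: letter counts are integers, and a convex function does not jump upwards
immediately to the right of an interior point or of `0`, so a word admissible slightly above the
infimum is admissible there. -/
lemma wordNorm_le_iff {s : Fin k → G} (hs : Subgroup.closure (Set.range s) = ⊤) {g : G} {r : ℝ}
    (hr : 0 ≤ r) : wordNorm s K g ≤ r ↔ g ∈ WordBall s (fun i => K i r) := by
  set S := {r : ℝ | 0 ≤ r ∧ g ∈ WordBall s (fun i => K i r)} with hS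
  have hdef : wordNorm s K g = sInf S := rfl
  have hbdd : BddBelow S := ⟨0, fun r hr => hr.1⟩
  constructor
  · intro h
    have hne : S.Nonempty := hK.exists_mem_wordBall hs g
    set r₀ := sInf S with hr₀
    have hr₀0 : 0 ≤ r₀ := le_csInf hne fun r hr => hr.1
    -- The chord from `r₀` to `r₀ + 1` bounds `K i` from above and tends to `K i r₀`, which lies
    -- strictly below the next integer.
    have hev : ∀ᶠ t in 𝓝[>] (0 : ℝ), ∀ i, K i (r₀ + t) < ⌊K i r₀⌋₊ + 1 := by
      refine eventually_all.2 fun i => ?_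
      have hlim : Tendsto (fun t : ℝ => (1 - t) * K i r₀ + t * K i (r₀ + 1)) (𝓝[>] 0)
          (𝓝 (K i r₀)) := by
        have : ContinuousAt (fun t : ℝ => (1 - t) * K i r₀ + t * K i (r₀ + 1)) 0 := by fun_prop
        have h2 := this.tendsto.mono_left (nhdsWithin_le_nhds (s := Set.Ioi 0))
        simpa using h2
      have h1 := hlim.eventually_lt_const (Nat.lt_floor_add_one (K i r₀))
      filter_upwards [h1, Ioo_mem_nhdsGT (zero_lt_one' ℝ)] with t ht ht1
      refine lt_of_le_of_lt ?_ ht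
      have := (hK.convex i).2 (show r₀ ∈ Set.Ici 0 from hr₀0)
        (show r₀ + 1 ∈ Set.Ici (0 : ℝ) by simp only [Set.mem_Ici]; linarith)
        (show 0 ≤ 1 - t by linarith [ht1.2]) ht1.1.le (by ring)
      simp only [smul_eq_mul] at this
      convert this using 2
      ring
    rw [eventually_nhdsWithin_iff, Metric.eventually_nhds_iff] at hev
    obtain ⟨ε, hε, hev⟩ := hev
    obtain ⟨r', hr', hlt⟩ := exists_lt_of_csInf_lt hne (show sInf S < r₀ + ε by linarith)
    have hge : r₀ ≤ r' := csInf_le hbdd hr'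
    obtain ⟨w, hw1, hw2⟩ := hr'.2
    refine ⟨w, hw1, fun i => ?_⟩
    have h3 : ((w.countP fun p => p.1 = i : ℕ) : ℝ) ≤ K i r₀ := by
      rcases eq_or_lt_of_le hge with h4 | h4
      · rw [h4]; exact hw2 i
      · have h5 := hev (y := r' - r₀) (by
          rw [Real.dist_eq, sub_zero, abs_of_pos (by linarith)]; linarith)
          (by simp only [Set.mem_Ioi]; linarith) i
        rw [add_sub_cancel] at h5
        have h6 := lt_of_le_of_lt (hw2 i) h5
        have h7 : (w.countP fun p => p.1 = i) ≤ ⌊K i r₀⌋₊ := by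
          have : (w.countP fun p => p.1 = i) < ⌊K i r₀⌋₊ + 1 := by exact_mod_cast h6
          omega
        exact (Nat.cast_le.2 h7).trans (Nat.floor_le (hK.nonneg i _ hr₀0))
    exact h3.trans (hK.mono hr₀0 h)
  · intro h
    exact csInf_le hbdd ⟨hr, h⟩

variable {s : Fin k → G} (hs : Subgroup.closure (Set.range s) = ⊤)

include hs

lemma mem_wordBall (g : G) : g ∈ WordBall s (fun i => K i (wordNorm s K g)) :=
  (hK.wordNorm_le_iff hs (wordNorm_nonneg s K g)).1 le_rfl

lemma wordNorm_inv (g : G) : wordNorm s K g⁻¹ = wordNorm s K g := by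
  have : ∀ g, wordNorm s K g⁻¹ ≤ wordNorm s K g := fun g =>
    (hK.wordNorm_le_iff hs (wordNorm_nonneg s K g)).2 (WordBall.inv_mem (hK.mem_wordBall hs g))
  exact le_antisymm (this g) (by simpa using this g⁻¹)

lemma isNorm : IsNorm (wordNorm s K) where
  nonneg := wordNorm_nonneg s K
  eq_zero_iff g := by
    constructor
    · intro h
      obtain ⟨w, h1, h2⟩ := hK.mem_wordBall hs g
      rw [h] at h2
      rcases w with _ | ⟨p, w⟩
      · simpa using h1.symm
      · have := h2 p.1
        simp only [hK.zero, List.countP_cons] at this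
        simp at this
        linarith [(Nat.cast_nonneg (w.countP fun q => q.1 = p.1) : (0 : ℝ) ≤ _)]
    · rintro rfl
      exact le_antisymm ((hK.wordNorm_le_iff hs le_rfl).2
        (WordBall.one_mem fun i => (hK.zero i).ge)) (wordNorm_nonneg s K 1)
  mul_le g h := by
    rw [hK.wordNorm_le_iff hs (add_nonneg (wordNorm_nonneg s K g) (wordNorm_nonneg s K h))]
    exact WordBall.mono (WordBall.mul_mem (hK.mem_wordBall hs g) (hK.mem_wordBall hs h)) fun i =>
      hK.add_le (wordNorm_nonneg s K g) (wordNorm_nonneg s K h)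

lemma finite_ball (R : ℝ) : {g : G | wordNorm s K g ≤ R}.Finite := by
  rcases lt_or_ge R 0 with hR | hR
  · convert Set.finite_empty
    ext g
    have := wordNorm_nonneg s K g
    simp; linarith
  · have hfin : {w : List (Fin k × ℤˣ) | w.length ≤ ∑ i, ⌊K i R⌋₊}.Finite :=
      List.finite_length_le _ _
    refine (hfin.image fun w => (w.map fun p => s p.1 ^ (p.2 : ℤ)).prod).subset ?_
    intro g hg
    obtain ⟨w, h1, h2⟩ := (hK.wordNorm_le_iff hs hR).1 hg
    refine ⟨w, ?_, h1⟩
    have hlen : w.length = ∑ i, w.countP fun p => p.1 = i := by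
      clear h1 h2
      induction w with
      | nil => simp
      | cons p w ih =>
        simp only [List.countP_cons, Finset.sum_add_distrib, List.length_cons, ← ih]
        simp
    change w.length ≤ _
    rw [hlen]
    exact Finset.sum_le_sum fun i _ => Nat.le_floor (h2 i)

lemma wordNorm_zpow_le {i : Fin k} {m : ℤ} {r : ℝ} (hr : 0 ≤ r) (hm : |(m : ℝ)| ≤ K i r) :
    wordNorm s K (s i ^ m) ≤ r :=
  (hK.wordNorm_le_iff hs hr).2 (WordBall.zpow_mem i m (fun j => hK.nonneg j r hr) hm)

omit hs in
lemma eventually_le_floor (n : ℕ) : ∀ᶠ r in atTop, ∀ i, n ≤ ⌊K i r⌋₊ :=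
  eventually_all.2 fun i =>
    ((hK.tendsto i).eventually_ge_atTop (n : ℝ)).mono fun _ hr => Nat.le_floor hr

/-- Large elements are products of boundedly many powers of controlled size. -/
lemma exists_mem_powProd [Group.IsNilpotent G] (a : ℝ) : ∃ (p : ℕ) (C : ℝ), 0 ≤ C ∧
    ∀ᶠ r in atTop, ∀ g, wordNorm s K g ≤ a * r → g ∈ PowProd s (fun i => ⌊K i r⌋₊) p C := by
  obtain ⟨M, hM, hdoub⟩ := hK.doubling (max a 1) (le_max_right _ _)
  obtain ⟨p, C, hC, h⟩ := wordBall_subset_powProd s (M * 2)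
  refine ⟨p, C, hC, ?_⟩
  filter_upwards [hdoub, hK.eventually_le_floor 1, eventually_gt_atTop 0] with r h1 h2 h3 g hg
  have hg' : wordNorm s K g ≤ max a 1 * r := hg.trans (by gcongr; exact le_max_left _ _)
  have h0 : 0 ≤ max a 1 * r := (wordNorm_nonneg s K g).trans hg'
  refine h _ h2 g (WordBall.mono ((hK.wordNorm_le_iff hs h0).1 hg') fun i => (h1 i).trans ?_)
  rw [mul_assoc]
  gcongr
  exact le_two_mul_floor (h2 i)

/-- Conjugates of small elements by large ones are small. -/
lemma exists_conj_le [Group.IsNilpotent G] (a : ℝ) {η : ℝ} (hη : 0 < η) : ∃ δ : ℝ, 0 < δ ∧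
    ∀ᶠ r in atTop, ∀ x y, wordNorm s K x ≤ a * r → wordNorm s K y ≤ δ * r →
      wordNorm s K (x⁻¹ * y * x) ≤ η * r := by
  obtain ⟨p, C, hC, hp⟩ := hK.exists_mem_powProd hs a
  set η' := min η 1
  have hη' : 0 < η' := lt_min hη one_pos
  obtain ⟨M, hM, hdoub⟩ := hK.doubling (1 / η') (by
    rw [le_div_iff₀ hη', one_mul]; exact min_le_right _ _)
  obtain ⟨δ, hδ, N₀, h⟩ := conj_mem_wordBall s p hC (show 0 < 1 / M by positivity)
  have hlim : Tendsto (fun r : ℝ => η' * r) atTop atTop :=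
    tendsto_id.const_mul_atTop hη'
  refine ⟨min 1 (δ / 2), by positivity, ?_⟩
  filter_upwards [hp, hlim.eventually hdoub, hK.eventually_le_floor (max N₀ 1),
    eventually_gt_atTop 0] with r h1 h2 h3 h4 x y hx hy
  have hb := h _ (fun i => (le_max_left N₀ 1).trans (h3 i)) x (h1 x hx) y ?_
  · refine le_trans ?_ (show η' * r ≤ η * r by gcongr; exact min_le_left _ _)
    rw [hK.wordNorm_le_iff hs (by positivity)]
    refine WordBall.mono hb fun i => ?_
    have h5 := h2 i
    rw [← mul_assoc, one_div_mul_cancel hη'.ne', one_mul] at h5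
    have h6 := Nat.floor_le (hK.nonneg i r h4.le)
    rw [one_div, inv_mul_le_iff₀ hM]
    linarith
  · refine WordBall.mono ((hK.wordNorm_le_iff hs (by positivity)).1 hy) fun i => ?_
    have h5 := hK.mul_le (i := i) (t := min 1 (δ / 2)) (by positivity) (min_le_left _ _) h4.le
    have h6 := le_two_mul_floor ((le_max_right N₀ 1).trans (h3 i))
    calc K i (min 1 (δ / 2) * r) ≤ min 1 (δ / 2) * K i r := h5
      _ ≤ δ / 2 * (2 * ⌊K i r⌋₊) := by
        gcongr
        · exact hK.nonneg i r h4.le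
        · exact min_le_right _ _
      _ = _ := by ring

lemma volumeFun_mono {a b : ℝ} (hab : a ≤ b) :
    volumeFun (wordNorm s K) a ≤ volumeFun (wordNorm s K) b := by
  have := (hK.finite_ball hs b).to_subtype
  exact Nat.card_mono (hK.finite_ball hs b) fun g (hg : _ ≤ a) => hg.trans hab

lemma one_le_volumeFun {a : ℝ} (ha : 0 ≤ a) : 1 ≤ volumeFun (wordNorm s K) a := by
  have : Finite {g : G // wordNorm s K g ≤ a} := hK.finite_ball hs a
  have h1 : wordNorm s K (1 : G) ≤ a := by rw [((hK.isNorm hs).eq_zero_iff 1).2 rfl]; exact ha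
  have : Nonempty {g : G // wordNorm s K g ≤ a} := ⟨⟨1, h1⟩⟩
  exact Nat.card_pos

/-- Volume doubling. -/
lemma exists_volumeFun_le [Group.IsNilpotent G] (a : ℝ) : ∃ D : ℝ, 0 < D ∧ ∀ r : ℝ, 0 < r →
    (volumeFun (wordNorm s K) (a * r) : ℝ) ≤ D * volumeFun (wordNorm s K) r := by
  suffices h : ∃ D : ℝ, ∀ᶠ r in atTop,
      (volumeFun (wordNorm s K) (a * r) : ℝ) ≤ D * volumeFun (wordNorm s K) r by
    obtain ⟨D, hD⟩ := h
    obtain ⟨r₀, hr₀⟩ := eventually_atTop.1 hD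
    -- For radii below the threshold the dilated ball has bounded volume and the original one
    -- contains the identity.
    refine ⟨max D (volumeFun (wordNorm s K) (max 0 a * r₀)) + 1, by positivity, fun r hr => ?_⟩
    have h1 : (1 : ℝ) ≤ volumeFun (wordNorm s K) r := by
      exact_mod_cast hK.one_le_volumeFun hs hr.le
    rcases le_total r₀ r with h | h
    · refine (hr₀ r h).trans ?_
      gcongr
      linarith [le_max_left D (volumeFun (wordNorm s K) (max 0 a * r₀) : ℝ)]
    · have h2 : (volumeFun (wordNorm s K) (a * r) : ℝ) ≤
          volumeFun (wordNorm s K) (max 0 a * r₀) := by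
        exact_mod_cast hK.volumeFun_mono hs (by
          calc a * r ≤ max 0 a * r := by gcongr; exact le_max_right _ _
            _ ≤ _ := by gcongr)
      have h3 := le_max_right D (volumeFun (wordNorm s K) (max 0 a * r₀) : ℝ)
      nlinarith
  obtain ⟨p, C, hC, hp⟩ := hK.exists_mem_powProd hs a
  -- At most `p` remainders, each of norm at most `r / (p + 1)` after conjugation, make up an
  -- element of the ball of radius `r`.
  obtain ⟨δ₀, hδ₀, hconj⟩ := hK.exists_conj_le hs (p * (C + 1)) (show (0 : ℝ) < 1 / (p + 1) by
    positivity)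
  set δ := min δ₀ 1
  have hδ : 0 < δ := lt_min hδ₀ one_pos
  obtain ⟨M, hM, hdoub⟩ := hK.doubling (1 / δ) (by
    rw [le_div_iff₀ hδ, one_mul]; exact min_le_right _ _)
  have hlim : Tendsto (fun r : ℝ => δ * r) atTop atTop := tendsto_id.const_mul_atTop hδ
  set Q : ℤ := ⌈C * (2 * M) + 1⌉ with hQ
  have hfin : {w : List (Fin k × Finset.Icc (-Q) Q) | w.length ≤ p}.Finite :=
    List.finite_length_le _ _
  refine ⟨{w : List (Fin k × Finset.Icc (-Q) Q) | w.length ≤ p}.ncard, ?_⟩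
  filter_upwards [hp, hconj, hlim.eventually hdoub, hlim.eventually (hK.eventually_le_floor 1),
    hK.eventually_le_floor 1, eventually_gt_atTop 0] with r h1 h2 h3 h4 h5 h6
  set n : Fin k → ℕ := fun i => ⌊K i (δ * r)⌋₊ with hn
  have hnle : ∀ i, (n i : ℝ) ≤ K i (δ * r) := fun i =>
    Nat.floor_le (hK.nonneg i _ (by positivity))
  have hKδ : ∀ i, K i (δ * r) ≤ K i r := fun i => hK.mono (by positivity) (by
    exact mul_le_of_le_one_left h6.le (min_le_right _ _))
  have hKn : ∀ i, K i r ≤ 2 * M * n i := by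
    intro i
    have e1 := h3 i
    rw [← mul_assoc, one_div_mul_cancel hδ.ne', one_mul] at e1
    have e2 := le_two_mul_floor (h4 i)
    calc K i r ≤ M * K i (δ * r) := e1
      _ ≤ M * (2 * n i) := by gcongr
      _ = _ := by ring
  -- Exponents are divided by `n i`, the integer part of `K i (δ * r)`. The quotients are bounded by
  -- `Q`, so the main parts take a number of values independent of `r`; the remainder powers have
  -- norm at most `δ * r` and are moved to the right.
  have hsub : {g : G | wordNorm s K g ≤ a * r} ⊆ Set.image2 (fun w b => w * b)
      ((fun w : List (Fin k × Finset.Icc (-Q) Q) =>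
        (w.map fun q => s q.1 ^ ((q.2 : ℤ) * n q.1)).prod) '' {w | w.length ≤ p})
      {g : G | wordNorm s K g ≤ r} := by
    intro g hg
    obtain ⟨w, hw1, hw2, rfl⟩ := h1 g hg
    have hbound : ∀ q ∈ w, q.2 / (n q.1 : ℤ) ∈ Finset.Icc (-Q) Q := by
      intro q hq
      have hn1 : (0 : ℝ) < n q.1 := by exact_mod_cast h4 q.1
      have e1 : |((q.2 / (n q.1 : ℤ) : ℤ) : ℝ)| ≤ C * (2 * M) + 1 := by
        have e2 : |(q.2 : ℝ) / n q.1| ≤ C * (2 * M) := by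
          rw [abs_div, abs_of_pos hn1, div_le_iff₀ hn1]
          calc |(q.2 : ℝ)| ≤ C * ⌊K q.1 r⌋₊ := hw2 q hq
            _ ≤ C * K q.1 r := by gcongr; exact Nat.floor_le (hK.nonneg _ _ h6.le)
            _ ≤ C * (2 * M * n q.1) := by gcongr; exact hKn _
            _ = _ := by ring
        have e3 : ((q.2 / (n q.1 : ℤ) : ℤ) : ℝ) = ⌊(q.2 : ℝ) / n q.1⌋ := by
          rw [Int.floor_div_natCast]; simp
        rw [e3]
        have e4 := Int.floor_le ((q.2 : ℝ) / n q.1)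
        have e5 := Int.lt_floor_add_one ((q.2 : ℝ) / n q.1)
        rw [abs_le] at e2 ⊢
        constructor <;> linarith
      have e6 := Int.le_ceil (C * (2 * M) + 1)
      rw [Finset.mem_Icc, ← abs_le]
      have : ((|q.2 / (n q.1 : ℤ)| : ℤ) : ℝ) ≤ (Q : ℝ) := by
        push_cast; linarith
      exact_mod_cast this
    set L : List (G × G) := w.map fun q =>
      (s q.1 ^ ((q.2 / (n q.1 : ℤ)) * (n q.1 : ℤ)), s q.1 ^ (q.2 % (n q.1 : ℤ))) with hL
    have hLlen : L.length = w.length := by simp [hL]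
    have hmod : ∀ q : Fin k × ℤ, 0 ≤ q.2 % (n q.1 : ℤ) ∧ q.2 % (n q.1 : ℤ) < n q.1 := fun q =>
      ⟨Int.emod_nonneg _ (by have := h4 q.1; simp only [hn]; omega),
        Int.emod_lt_of_pos _ (by have := h4 q.1; simp only [hn]; omega)⟩
    obtain ⟨-, B, hB1, hB2⟩ := (hK.isNorm hs).prod_mul_eq (a := (C + 1) * r)
      (b := p * (C + 1) * r) (δ := δ₀ * r) (c := 1 / (p + 1) * r) (by positivity) h2 L (by
        intro q hq
        simp only [hL, List.mem_map] at hq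
        obtain ⟨q', hq', rfl⟩ := hq
        have m1 : (0 : ℝ) ≤ (q'.2 % (n q'.1 : ℤ) : ℤ) := by exact_mod_cast (hmod q').1
        have m2 : ((q'.2 % (n q'.1 : ℤ) : ℤ) : ℝ) ≤ n q'.1 := by exact_mod_cast (hmod q').2.le
        constructor
        · refine hK.wordNorm_zpow_le hs (by positivity) ?_
          refine le_trans ?_ (hK.le_mul (by linarith) h6.le)
          have e1 : q'.2 / (n q'.1 : ℤ) * (n q'.1 : ℤ) = q'.2 - q'.2 % (n q'.1 : ℤ) := by
            have := Int.mul_ediv_add_emod q'.2 (n q'.1 : ℤ); linarith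
          rw [e1]; push_cast
          refine (abs_sub _ _).trans ?_
          have e2 := hw2 q' hq'
          have e3 : C * (⌊K q'.1 r⌋₊ : ℝ) ≤ C * K q'.1 r := by
            gcongr; exact Nat.floor_le (hK.nonneg _ _ h6.le)
          rw [abs_of_nonneg m1]
          linarith [hnle q'.1, hKδ q'.1]
        · refine hK.wordNorm_zpow_le hs (by positivity) ?_
          rw [abs_of_nonneg m1]
          refine (m2.trans (hnle _)).trans (hK.mono (by positivity) ?_)
          gcongr; exact min_le_left _ _)
      (by
        rw [hLlen, mul_assoc]
        have : (w.length : ℝ) ≤ p := by exact_mod_cast hw1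
        gcongr)
    refine ⟨(L.map Prod.fst).prod, ?_, B, ?_, ?_⟩
    · refine ⟨w.attach.map fun q => (q.1.1, ⟨q.1.2 / (n q.1.1 : ℤ), hbound q.1 q.2⟩),
        by simpa using hw1, ?_⟩
      simp only [hL, List.map_map]
      congr 1
      conv_rhs => rw [← List.attach_map_subtype_val w]
      rw [List.map_map]
      rfl
    · refine hB1.trans ?_
      rw [hLlen]
      have : (w.length : ℝ) ≤ p := by exact_mod_cast hw1
      calc (w.length : ℝ) * (1 / (p + 1) * r) ≤ p * (1 / (p + 1) * r) := by gcongr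
        _ = (p / (p + 1)) * r := by ring
        _ ≤ 1 * r := by
          gcongr
          rw [div_le_one (by positivity)]; linarith
        _ = r := one_mul r
    · change (L.map Prod.fst).prod * B = _
      rw [← hB2, hL, List.map_map]
      congr 1
      apply List.map_congr_left
      intro q _
      simp only [Function.comp_apply]
      rw [← zpow_add, mul_comm (q.2 / _), Int.mul_ediv_add_emod]
  have hcard : {g : G | wordNorm s K g ≤ a * r}.ncard ≤
      {w : List (Fin k × Finset.Icc (-Q) Q) | w.length ≤ p}.ncard *
        {g : G | wordNorm s K g ≤ r}.ncard := by
    refine (Set.ncard_le_ncard hsub ((hfin.image _).image2 _ (hK.finite_ball hs r))).trans ?_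
    rw [← Set.image_prod]
    refine (Set.ncard_image_le ((hfin.image _).prod (hK.finite_ball hs r))).trans ?_
    rw [Set.ncard_prod]
    gcongr
    exact Set.ncard_image_le hfin
  have hv : ∀ r, volumeFun (wordNorm s K) r = {g : G | wordNorm s K g ≤ r}.ncard := fun r => rfl
  rw [hv, hv]
  exact_mod_cast hcard

end IsScale

end Norm

/-! ### Uniform convergence and Potter bounds for slowly varying functions. -/

section SlowVariation

/-- The uniform convergence theorem for slowly varying functions, in additive form. -/
lemma exists_abs_sub_le_of_tendsto {h : ℝ → ℝ} (hm : Measurable h)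
    (ht : ∀ u, Tendsto (fun x => h (x + u) - h x) atTop (𝓝 0)) {ε : ℝ} (hε : 0 < ε) :
    ∃ X, ∀ x ≥ X, ∀ u ∈ Set.Icc (0 : ℝ) 1, |h (x + u) - h x| ≤ ε := by
  by_contra! hcon
  choose x hx u hu hlt using fun n : ℕ => hcon n
  have hxt : Tendsto x atTop atTop := tendsto_atTop_mono hx tendsto_natCast_atTop_atTop
  have hxut : Tendsto (fun n => x n + u n) atTop atTop :=
    tendsto_atTop_mono (fun n => by linarith [(hu n).1]) hxt
  have key : ∀ y : ℕ → ℝ, Tendsto y atTop atTop → Tendsto (fun n =>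
      volume.restrict (Set.Icc (0 : ℝ) 2) {v | ε / 2 ≤ |h (y n + v) - h (y n)|}) atTop (𝓝 0) := by
    intro y hy
    have h1 : TendstoInMeasure (volume.restrict (Set.Icc (0 : ℝ) 2))
        (fun n v => h (y n + v) - h (y n)) atTop (fun _ => 0) :=
      tendstoInMeasure_of_tendsto_ae (fun n => by
        apply Measurable.aestronglyMeasurable; fun_prop) (ae_of_all _ fun v => (ht v).comp hy)
    rw [tendstoInMeasure_iff_norm] at h1
    simpa using h1 (ε / 2) (by linarith)
  have e1 := (key x hxt).eventually_lt_const (show (0 : ℝ≥0∞) < 1 / 2 by simp)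
  have e2 := (key _ hxut).eventually_lt_const (show (0 : ℝ≥0∞) < 1 / 2 by simp)
  obtain ⟨n, h1, h2⟩ := (e1.and e2).exists
  rw [Measure.restrict_apply (by measurability)] at h1 h2
  set A := {v | ε / 2 ≤ |h (x n + v) - h (x n)|} ∩ Set.Icc 0 2
  set B := {v | ε / 2 ≤ |h (x n + u n + v) - h (x n + u n)|} ∩ Set.Icc 0 2
  have hB : volume ((fun v => v + -u n) ⁻¹' B) = volume B := measure_preimage_add_right _ _ _
  -- If `x n + v` were close in value both to `x n` and to `x n + u n`, these two would be within
  -- `ε` of each other. So every `v` in an interval of length `1` is bad for one of them, while each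
  -- bad set has measure below `1 / 2`.
  have hsub : Set.Icc (1 : ℝ) 2 ⊆ A ∪ (fun v => v + -u n) ⁻¹' B := by
    intro v hv
    by_contra hvn
    simp only [Set.mem_union, not_or, Set.mem_preimage] at hvn
    have hu1 := (hu n).1
    have hu2 := (hu n).2
    have a1 : |h (x n + v) - h (x n)| < ε / 2 := by
      by_contra hge
      exact hvn.1 ⟨not_lt.1 hge, by linarith [hv.1], hv.2⟩
    have a2 : |h (x n + u n + (v + -u n)) - h (x n + u n)| < ε / 2 := by
      by_contra hge
      exact hvn.2 ⟨not_lt.1 hge, by linarith [hv.1], by linarith [hv.2]⟩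
    have a3 : x n + u n + (v + -u n) = x n + v := by ring
    rw [a3] at a2
    have a4 := hlt n
    rw [abs_lt] at a1 a2
    rw [lt_abs] at a4
    rcases a4 with a4 | a4 <;> linarith
  have := calc volume (Set.Icc (1 : ℝ) 2) ≤ volume A + volume B :=
        (measure_mono hsub).trans ((measure_union_le _ _).trans (by rw [hB]))
    _ < 1 / 2 + 1 / 2 := ENNReal.add_lt_add h1 h2
    _ = 1 := ENNReal.add_halves 1
  rw [Real.volume_Icc] at this
  norm_num at this

/-- Potter bounds. -/
lemma IsSlowlyVarying.potter {l : ℝ → ℝ} (hl : IsSlowlyVarying l) {δ : ℝ} (hδ : 0 < δ) :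
    ∃ X, 1 ≤ X ∧ ∀ x y, X ≤ x → x ≤ y →
      l y ≤ Real.exp δ * (y / x) ^ δ * l x ∧ l x ≤ Real.exp δ * (y / x) ^ δ * l y := by
  set h : ℝ → ℝ := fun x => Real.log (l (Real.exp x)) with hh
  have hm : Measurable h := by
    have h1 : Measurable fun x : ℝ => (⟨Real.exp x, (Real.exp_pos x).le⟩ : Set.Ici (0 : ℝ)) :=
      Measurable.subtype_mk Real.measurable_exp
    exact Real.measurable_log.comp (hl.measurable.comp h1)
  have ht : ∀ u, Tendsto (fun x => h (x + u) - h x) atTop (𝓝 0) := by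
    intro u
    have h1 := (hl.tendsto (Real.exp u) (Real.exp_pos u)).comp Real.tendsto_exp_atTop
    have h2 := ((Real.continuousAt_log one_ne_zero).tendsto.comp h1)
    rw [Real.log_one] at h2
    refine h2.congr fun x => ?_
    simp only [Function.comp, hh]
    rw [Real.log_div (hl.pos _ (by positivity)).ne' (hl.pos _ (by positivity)).ne',
      ← Real.exp_add, add_comm]
  obtain ⟨X, hX⟩ := exists_abs_sub_le_of_tendsto hm ht hδ
  -- Chaining unit steps; the extra `1` pays for the last, incomplete one and becomes the factor
  -- `exp δ`.
  have hstep : ∀ n : ℕ, ∀ x ≥ X, ∀ u : ℝ, 0 ≤ u → u ≤ n → |h (x + u) - h x| ≤ δ * (u + 1) := by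
    intro n
    induction n with
    | zero =>
      intro x hx u h0 h1
      have : u = 0 := le_antisymm (by simpa using h1) h0
      subst this; simpa using hδ.le
    | succ n ih =>
      intro x hx u h0 h1
      rcases le_total u 1 with h2 | h2
      · refine (hX x hx u ⟨h0, h2⟩).trans ?_
        nlinarith
      · have h3 := ih (x + 1) (by linarith) (u - 1) (by linarith) (by push_cast at h1; linarith)
        have h4 := hX x hx 1 (by simp)
        have e : x + 1 + (u - 1) = x + u := by ring
        rw [e] at h3
        calc |h (x + u) - h x| ≤ |h (x + u) - h (x + 1)| + |h (x + 1) - h x| := abs_sub_le _ _ _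
          _ ≤ _ := by linarith
  refine ⟨max 1 (Real.exp X), le_max_left _ _, fun x y hx hxy => ?_⟩
  have hx0 : 0 < x := by linarith [(le_max_left _ _).trans hx]
  have hy0 : 0 < y := hx0.trans_le hxy
  have hlx := hl.pos x hx0.le
  have hly := hl.pos y hy0.le
  have h1 : X ≤ Real.log x := by
    rw [Real.le_log_iff_exp_le hx0]; exact (le_max_right _ _).trans hx
  have h2 : 0 ≤ Real.log y - Real.log x := sub_nonneg.2 (Real.log_le_log hx0 hxy)
  obtain ⟨n, hn⟩ := exists_nat_ge (Real.log y - Real.log x)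
  have h3 := hstep n _ h1 _ h2 hn
  rw [add_sub_cancel] at h3
  simp only [hh, Real.exp_log hx0, Real.exp_log hy0] at h3
  have h4 : Real.exp δ * (y / x) ^ δ = Real.exp (δ * (Real.log y - Real.log x + 1)) := by
    rw [Real.rpow_def_of_pos (by positivity), Real.log_div hy0.ne' hx0.ne', ← Real.exp_add]
    ring_nf
  rw [abs_le] at h3
  rw [h4]
  constructor
  · rw [← Real.exp_log hly, ← Real.exp_log hlx, ← Real.exp_add]
    exact Real.exp_le_exp.2 (by linarith)
  · rw [← Real.exp_log hly, ← Real.exp_log hlx, ← Real.exp_add]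
    exact Real.exp_le_exp.2 (by linarith)

/-- Growth of `t ^ α / l t` for slowly varying `l`. -/
lemma IsSlowlyVarying.rpow_div_growth {l : ℝ → ℝ} (hl : IsSlowlyVarying l) {α : ℝ} (hα : 0 < α) :
    ∃ X B : ℝ, 1 ≤ X ∧ 1 ≤ B ∧ ∀ x y, X ≤ x → x ≤ y →
      (y / x) ^ (α / 2) * (x ^ α / l x) ≤ B * (y ^ α / l y) ∧
      y ^ α / l y ≤ B * (y / x) ^ (2 * α) * (x ^ α / l x) := by
  obtain ⟨X, hX1, hX⟩ := hl.potter (show 0 < α / 2 by positivity)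
  refine ⟨X, Real.exp (α / 2), hX1, Real.one_le_exp (by positivity), fun x y hx hxy => ?_⟩
  have hx0 : 0 < x := by linarith
  have hy0 : 0 < y := by linarith
  have hlx := hl.pos x hx0.le
  have hly := hl.pos y hy0.le
  obtain ⟨h1, h2⟩ := hX x y hx hxy
  have hy : y ^ α = (y / x) ^ α * x ^ α := by
    rw [← Real.mul_rpow (by positivity) hx0.le, div_mul_cancel₀ _ hx0.ne']
  have hr : 1 ≤ y / x := by rw [le_div_iff₀ hx0]; linarith
  set q := y / x with hq
  have hq0 : 0 < q := by positivity
  have hxa : 0 < x ^ α := by positivity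
  have hqa : q ^ α = q ^ (α / 2) * q ^ (α / 2) := by rw [← Real.rpow_add hq0]; ring_nf
  have hq2 : q ^ (2 * α) = q ^ α * q ^ α := by rw [← Real.rpow_add hq0]; ring_nf
  have hq1 : 1 ≤ q ^ (α / 2) := Real.one_le_rpow hr (by positivity)
  rw [hy]
  constructor
  · rw [← mul_div_assoc, ← mul_div_assoc, div_le_div_iff₀ hlx hly, hqa]
    calc q ^ (α / 2) * x ^ α * l y
        ≤ q ^ (α / 2) * x ^ α * (Real.exp (α / 2) * q ^ (α / 2) * l x) := by gcongr
      _ = _ := by ring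
  · rw [← mul_div_assoc, div_le_div_iff₀ hly hlx, hq2]
    have h3 : q ^ (α / 2) ≤ q ^ α := Real.rpow_le_rpow_of_exponent_le hr (by linarith)
    calc q ^ α * x ^ α * l x ≤ q ^ α * x ^ α * (Real.exp (α / 2) * q ^ (α / 2) * l y) := by gcongr
      _ ≤ q ^ α * x ^ α * (Real.exp (α / 2) * q ^ α * l y) := by gcongr
      _ = _ := by ring

/-- Up to constants `t ^ α / l t` is increasing and of at most polynomial growth, so an upper
comparison of arguments passes to values. The threshold `X` does not depend on `A`. -/
lemma IsSlowlyVarying.rpow_div_compare {l : ℝ → ℝ} (hl : IsSlowlyVarying l) {α : ℝ} (hα : 0 < α) :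
    ∃ X : ℝ, 1 ≤ X ∧ ∀ A : ℝ, ∃ B : ℝ, 0 < B ∧ ∀ x y, X ≤ x → X ≤ y → x ≤ A * y →
      x ^ α / l x ≤ B * (y ^ α / l y) := by
  obtain ⟨X, B, hX1, hB, h⟩ := hl.rpow_div_growth hα
  refine ⟨X, hX1, fun A => ⟨B * max 1 A ^ (2 * α), by positivity, fun x y hx hy hxy => ?_⟩⟩
  have hx0 : 0 < x := by linarith
  have hy0 : 0 < y := by linarith
  have hfx : 0 < x ^ α / l x := div_pos (by positivity) (hl.pos x hx0.le)
  have hfy : 0 < y ^ α / l y := div_pos (by positivity) (hl.pos y hy0.le)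
  have hA1 : 1 ≤ max 1 A ^ (2 * α) := Real.one_le_rpow (le_max_left _ _) (by positivity)
  rcases le_total x y with hle | hle
  · have h1 := (h x y hx hle).1
    have h2 : 1 ≤ (y / x) ^ (α / 2) :=
      Real.one_le_rpow (by rw [le_div_iff₀ hx0]; linarith) (by positivity)
    calc x ^ α / l x ≤ (y / x) ^ (α / 2) * (x ^ α / l x) := le_mul_of_one_le_left hfx.le h2
      _ ≤ B * (y ^ α / l y) := h1
      _ ≤ _ := by gcongr; exact le_mul_of_one_le_right (by linarith) hA1
  · refine (h y x hy hle).2.trans ?_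
    gcongr
    rw [div_le_iff₀ hy0]
    exact hxy.trans (by gcongr; exact le_max_right _ _)

end SlowVariation

/-! ### The step distribution at scale `r`: masses, tails and growth of `K`. -/

section Tails

lemma mul_rpow_le_sub_rpow {β n : ℝ} (hβ : 0 < β) (hn : 1 < n) :
    β * n ^ (-1 - β) ≤ (n - 1) ^ (-β) - n ^ (-β) := by
  have hn0 : 0 < n := by linarith
  have h1 : (n - 1) ^ (-β) = n ^ (-β) * (1 - 1 / n) ^ (-β) := by
    rw [← Real.mul_rpow hn0.le (by rw [sub_nonneg, div_le_one hn0]; exact hn.le)]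
    congr 1; field_simp
  have hpos : 0 < 1 - 1 / n := by rw [sub_pos, div_lt_one hn0]; exact hn
  have h2 : 1 + β / n ≤ (1 - 1 / n) ^ (-β) := by
    rw [Real.rpow_def_of_pos hpos]
    have h3 := Real.log_le_sub_one_of_pos hpos
    have h4 := Real.add_one_le_exp (Real.log (1 - 1 / n) * -β)
    have h5 : β / n ≤ Real.log (1 - 1 / n) * -β := by
      have : Real.log (1 - 1 / n) ≤ -(1 / n) := by linarith
      calc β / n = β * (1 / n) := by ring
        _ ≤ β * (-Real.log (1 - 1 / n)) := by gcongr; linarith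
        _ = _ := by ring
    linarith
  have h6 : n ^ (-1 - β) = n ^ (-β) * (1 / n) := by
    rw [show -1 - β = -β + -1 by ring, Real.rpow_add hn0, Real.rpow_neg_one, one_div]
  have h7 : 0 < n ^ (-β) := by positivity
  rw [h1, h6]
  have : n ^ (-β) * (1 + β / n) ≤ n ^ (-β) * (1 - 1 / n) ^ (-β) := by gcongr
  calc β * (n ^ (-β) * (1 / n)) = n ^ (-β) * (1 + β / n) - n ^ (-β) := by ring
    _ ≤ _ := by linarith

/-- Telescoping comparison with the increments of `n ^ (-β)`. The point `x / 2` replaces `x - 1`,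
which could vanish: an integer `n > x ≥ 1` satisfies `n - 1 ≥ x / 2`. -/
lemma tsum_rpow_tail_le {β x : ℝ} (hβ : 0 < β) (hx : 1 ≤ x) :
    ∑' n : ℕ, (if x < n then ENNReal.ofReal ((n : ℝ) ^ (-1 - β)) else 0) ≤
      ENNReal.ofReal ((x / 2) ^ (-β) / β) := by
  have hpart : ∀ N : ℕ, ∑ n ∈ Finset.range (N + 1),
      (if x < n then (n : ℝ) ^ (-1 - β) else 0) ≤
        ((x / 2) ^ (-β) - (max (N : ℝ) (x / 2)) ^ (-β)) / β := by
    intro N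
    induction N with
    | zero =>
      have : ¬ x < 0 := by linarith
      have h2 : max (0 : ℝ) (x / 2) = x / 2 := max_eq_right (by linarith)
      simp [this, h2]
    | succ N ih =>
      rw [Finset.sum_range_succ]
      split_ifs with h
      · push_cast at h
        have hN1 : (1 : ℝ) ≤ N := by
          have : (0 : ℝ) < N := by linarith
          exact_mod_cast this
        have e1 : max (N : ℝ) (x / 2) = N := max_eq_left (by linarith)
        have e2 : max ((N + 1 : ℕ) : ℝ) (x / 2) = N + 1 := by
          push_cast; exact max_eq_left (by linarith)
        rw [e1] at ih
        rw [e2]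
        have h3 := mul_rpow_le_sub_rpow (n := N + 1) hβ (by linarith)
        rw [add_sub_cancel_right] at h3
        push_cast
        rw [le_div_iff₀ hβ] at ih ⊢
        linarith
      · rw [add_zero]
        refine ih.trans ?_
        have h4 : (max ((N + 1 : ℕ) : ℝ) (x / 2)) ^ (-β) ≤ (max (N : ℝ) (x / 2)) ^ (-β) := by
          apply Real.rpow_le_rpow_of_nonpos
          · exact lt_max_of_lt_right (by linarith)
          · gcongr; simp
          · linarith
        gcongr
  rw [ENNReal.tsum_eq_iSup_nat]
  refine iSup_le fun N => ?_
  refine (Finset.sum_le_sum_of_subset (Finset.range_mono (Nat.le_succ N))).trans ?_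
  have h1 : ∀ n : ℕ, (if x < n then ENNReal.ofReal ((n : ℝ) ^ (-1 - β)) else 0) =
      ENNReal.ofReal (if x < n then (n : ℝ) ^ (-1 - β) else 0) := by
    intro n; split_ifs <;> simp
  simp_rw [h1]
  rw [← ENNReal.ofReal_sum_of_nonneg (fun n _ => by split_ifs <;> positivity)]
  refine ENNReal.ofReal_le_ofReal ((hpart N).trans ?_)
  gcongr
  have : (0 : ℝ) ≤ (max (N : ℝ) (x / 2)) ^ (-β) := by positivity
  linarith

lemma tsum_int_natAbs_le (f : ℕ → ℝ≥0∞) : ∑' m : ℤ, f m.natAbs ≤ 2 * ∑' n, f n := by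
  have h : Function.Injective fun m : ℤ => (m.natAbs, decide (0 ≤ m)) := by
    intro a b hab
    simp only [Prod.mk.injEq, decide_eq_decide] at hab
    omega
  calc ∑' m : ℤ, f m.natAbs ≤ ∑' q : ℕ × Bool, f q.1 :=
        ENNReal.tsum_comp_le_tsum_of_injective h (fun q => f q.1)
    _ = ∑' n, ∑' _b : Bool, f n := ENNReal.tsum_prod (f := fun n _ => f n)
    _ = 2 * ∑' n, f n := by
      rw [← ENNReal.tsum_mul_left]
      simp [tsum_fintype]

variable {l F K : ℝ → ℝ} {α κ α₀ : ℝ}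

lemma tendsto_of_comparable (hα₀ : 0 < α₀) (hF : Tendsto F atTop atTop)
    (hKF : ∃ c C : ℝ, 0 < c ∧ 0 < C ∧ ∀ t : ℝ, 1 ≤ t →
      c * F (t ^ α₀) ≤ K t ∧ K t ≤ C * F (t ^ α₀)) : Tendsto K atTop atTop := by
  obtain ⟨c, C, hc, hC, h⟩ := hKF
  refine tendsto_atTop_mono' _ ?_
    ((hF.comp (tendsto_rpow_atTop hα₀)).const_mul_atTop hc)
  filter_upwards [eventually_ge_atTop 1] with t ht using (h t ht).1

/-- At scale `r` the function `K` inverts `t ^ α / l t` up to constants. -/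
lemma exists_rpow_div_comparable (hl : IsSlowlyVarying l) (hα : 0 < α) (hα₀ : 0 < α₀)
    (hF : IsAsymptoticInverse (fun t => t ^ α / l t) F)
    (hKF : ∃ c C : ℝ, 0 < c ∧ 0 < C ∧ ∀ t : ℝ, 1 ≤ t →
      c * F (t ^ α₀) ≤ K t ∧ K t ≤ C * F (t ^ α₀)) :
    ∃ a b : ℝ, 0 < a ∧ 0 < b ∧ ∀ᶠ r in atTop,
      a * r ^ α₀ ≤ K r ^ α / l (K r) ∧ K r ^ α / l (K r) ≤ b * r ^ α₀ := by
  have hKt := tendsto_of_comparable hα₀ hF.tendsto hKF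
  obtain ⟨c, C, hc, hC, h⟩ := hKF
  obtain ⟨X, hX1, hX⟩ := hl.rpow_div_compare hα
  obtain ⟨B₁, hB₁, h₁⟩ := hX C
  obtain ⟨B₂, hB₂, h₂⟩ := hX (1 / c)
  have hFr := hF.tendsto.comp (tendsto_rpow_atTop hα₀)
  have hratio : Tendsto (fun t => (F t ^ α / l (F t)) / t) atTop (𝓝 1) :=
    (isEquivalent_iff_tendsto_one ((eventually_ne_atTop 0).mono fun _ h => h)).1 hF.right
  have hratio' := hratio.comp (tendsto_rpow_atTop hα₀)
  refine ⟨1 / (2 * B₂), B₁ * 2, by positivity, by positivity, ?_⟩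
  filter_upwards [hFr.eventually_ge_atTop X, hKt.eventually_ge_atTop X, eventually_ge_atTop 1,
    hratio'.eventually_lt_const (show (1 : ℝ) < 2 by norm_num),
    hratio'.eventually_const_lt (show (1 / 2 : ℝ) < 1 by norm_num)] with r e1 e2 e3 e4 e5
  simp only [Function.comp] at e1 e4 e5
  have hr : 0 < r ^ α₀ := by positivity
  rw [div_lt_iff₀ hr] at e4
  rw [lt_div_iff₀ hr] at e5
  have g1 := h₁ (K r) (F (r ^ α₀)) e2 e1 (h r e3).2
  have g2 := h₂ (F (r ^ α₀)) (K r) e1 e2 (by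
    rw [one_div, ← div_eq_inv_mul, le_div_iff₀ hc]; linarith [(h r e3).1])
  constructor
  · rw [div_mul_eq_mul_div, one_mul, div_le_iff₀ (by positivity)]
    linarith
  · calc _ ≤ _ := g1
      _ ≤ B₁ * (2 * r ^ α₀) := by gcongr
      _ = _ := by ring

/-- Passing from `r` to `t * r` changes `t ^ α / l t` at `K r` by a bounded factor only, whereas
that function grows at least like the power `α / 2` of its argument. -/
lemma exists_scale_doubling (hl : IsSlowlyVarying l) (hα : 0 < α)
    (hKt : Tendsto K atTop atTop) (hmono : ∀ a b, 0 ≤ a → a ≤ b → K a ≤ K b)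
    (hf : ∃ a b : ℝ, 0 < a ∧ 0 < b ∧ ∀ᶠ r in atTop,
      a * r ^ α₀ ≤ K r ^ α / l (K r) ∧ K r ^ α / l (K r) ≤ b * r ^ α₀) {t : ℝ} (ht : 1 ≤ t) :
    ∃ C : ℝ, 0 < C ∧ ∀ᶠ r in atTop, K (t * r) ≤ C * K r := by
  obtain ⟨a, b, ha, hb, hab⟩ := hf
  obtain ⟨X, B, hX1, hB, hX⟩ := hl.rpow_div_growth hα
  have ht0 : 0 < t := by linarith
  have hlim : Tendsto (fun r : ℝ => t * r) atTop atTop := tendsto_id.const_mul_atTop ht0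
  refine ⟨(B * b * t ^ α₀ / a) ^ (2 / α), by positivity, ?_⟩
  filter_upwards [hab, hlim.eventually hab, hKt.eventually_ge_atTop X, eventually_gt_atTop 0]
    with r h1 h2 h3 h4
  have h5 : K r ≤ K (t * r) := hmono _ _ h4.le (le_mul_of_one_le_left h4.le ht)
  have hK0 : 0 < K r := by linarith
  have h6 := (hX _ _ h3 h5).1
  have hq : 0 ≤ K (t * r) / K r := div_nonneg (by linarith) hK0.le
  rw [← div_le_iff₀ hK0]
  have hr : 0 < r ^ α₀ := by positivity
  have h7 : (K (t * r) / K r) ^ (α / 2) ≤ B * b * t ^ α₀ / a := by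
    rw [le_div_iff₀ ha]
    have h8 : (K (t * r) / K r) ^ (α / 2) * (a * r ^ α₀) ≤ B * (b * (t * r) ^ α₀) :=
      calc _ ≤ (K (t * r) / K r) ^ (α / 2) * (K r ^ α / l (K r)) := by gcongr; exact h1.1
        _ ≤ _ := h6
        _ ≤ _ := by gcongr; exact h2.2
    rw [Real.mul_rpow ht0.le h4.le] at h8
    have h9 : (K (t * r) / K r) ^ (α / 2) * a * r ^ α₀ ≤ B * b * t ^ α₀ * r ^ α₀ := by
      linarith
    exact le_of_mul_le_mul_right h9 hr
  calc K (t * r) / K r = ((K (t * r) / K r) ^ (α / 2)) ^ (2 / α) := by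
        rw [← Real.rpow_mul hq]
        rw [show α / 2 * (2 / α) = 1 by field_simp, Real.rpow_one]
    _ ≤ _ := by gcongr

/-- Lower bound for the step distribution up to the scale `K r`. -/
lemma exists_le_step_mass (hl : IsSlowlyVarying l) (hα : 0 < α) (hκ : 0 < κ) (hα₀ : 0 < α₀)
    (hKt : Tendsto K atTop atTop)
    (hf : ∃ a b : ℝ, 0 < a ∧ 0 < b ∧ ∀ᶠ r in atTop,
      a * r ^ α₀ ≤ K r ^ α / l (K r) ∧ K r ^ α / l (K r) ≤ b * r ^ α₀) {A : ℝ} (hA : 1 ≤ A) :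
    ∃ c : ℝ, 0 < c ∧ ∀ᶠ r in atTop, ∀ m : ℤ, |(m : ℝ)| ≤ A * K r →
      c / (r ^ α₀ * K r) ≤ κ * l |(m : ℝ)| / (1 + |(m : ℝ)|) ^ (1 + α) := by
  obtain ⟨a, b, ha, hb, hab⟩ := hf
  obtain ⟨X₁, hX₁, hP⟩ := hl.potter one_pos
  obtain ⟨X₂, hX₂, hcomp⟩ := hl.rpow_div_compare hα
  obtain ⟨B, hB, hcomp⟩ := hcomp A
  set X := max X₁ X₂
  have hX0 : 1 ≤ X := hX₁.trans (le_max_left _ _)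
  set φ : ℕ → ℝ := fun n => κ * l n / (1 + n) ^ (1 + α) with hφ
  have hφpos : ∀ n, 0 < φ n := fun n =>
    div_pos (mul_pos hκ (hl.pos _ (by positivity))) (by positivity)
  obtain ⟨n₀, -, hn₀⟩ := Finset.exists_min_image (Finset.range (⌈X⌉₊ + 1)) φ ⟨0, by simp⟩
  set c₁ : ℝ := κ * Real.exp (-1) / (2 ^ (1 + α) * B * b * A) with hc₁
  have hc₁0 : 0 < c₁ := by positivity
  refine ⟨min (φ n₀) c₁, lt_min (hφpos _) hc₁0, ?_⟩
  filter_upwards [hab, hKt.eventually_ge_atTop X, eventually_ge_atTop 1] with r h1 h2 h3 m hm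
  have hr : 1 ≤ r ^ α₀ := Real.one_le_rpow h3 hα₀.le
  have hK0 : 1 ≤ K r := hX0.trans h2
  have hr0 : 0 < r ^ α₀ := by linarith
  have hK00 : 0 < K r := by linarith
  have habs : |(m : ℝ)| = (m.natAbs : ℝ) := by simp
  -- Potter bounds are unavailable for small `|m|`, but there only finitely many positive masses
  -- occur and their minimum exceeds the required bound, which is at most a constant since `r` and
  -- `K r` are at least `1`.
  rcases lt_or_ge |(m : ℝ)| X with hx | hx
  · have h4 : φ n₀ ≤ φ m.natAbs := hn₀ _ (by
      rw [Finset.mem_range]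
      rw [habs] at hx
      have := hx.le.trans (Nat.le_ceil X)
      have : m.natAbs ≤ ⌈X⌉₊ := by exact_mod_cast this
      omega)
    rw [habs]
    calc min (φ n₀) c₁ / (r ^ α₀ * K r) ≤ φ n₀ / 1 := by
          gcongr
          · exact (hφpos _).le
          · exact min_le_left _ _
          · nlinarith
      _ ≤ _ := by rw [div_one]; exact h4
  · set x := |(m : ℝ)|
    have hx0 : 0 < x := by linarith
    set y := A * K r with hy
    have hy0 : 0 < y := by positivity
    have hlx := hl.pos x hx0.le
    have hly := hl.pos y hy0.le
    have e1 := (hP x y ((le_max_left _ _).trans hx) hm).1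
    have e2 := hcomp y (K r) ((le_max_right _ _).trans (hx.trans hm))
      ((le_max_right _ _).trans h2) le_rfl
    have e3 : y ^ α / l y ≤ B * (b * r ^ α₀) := e2.trans (by gcongr; exact h1.2)
    rw [Real.rpow_one] at e1
    have e4 : y ^ α ≤ B * (b * r ^ α₀) * l y := by rwa [div_le_iff₀ hly] at e3
    have e5 : x ^ α ≤ y ^ α := by gcongr
    have e6 : (1 + x) ^ (1 + α) ≤ 2 ^ (1 + α) * (x * x ^ α) := by
      calc (1 + x) ^ (1 + α) ≤ (2 * x) ^ (1 + α) := by gcongr; linarith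
        _ = _ := by rw [Real.mul_rpow (by norm_num) hx0.le, Real.rpow_add hx0, Real.rpow_one]
    rw [div_le_div_iff₀ (by positivity) (by positivity)]
    have hexp : Real.exp 1 * Real.exp (-1) = 1 := by rw [← Real.exp_add]; simp
    have e7 : x * l y ≤ Real.exp 1 * y * l x := by
      have := mul_le_mul_of_nonneg_left e1 hx0.le
      calc x * l y ≤ x * (Real.exp 1 * (y / x) * l x) := this
        _ = _ := by field_simp
    calc min (φ n₀) c₁ * (1 + x) ^ (1 + α)
        ≤ c₁ * (2 ^ (1 + α) * (x * x ^ α)) := by gcongr; exact min_le_right _ _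
      _ ≤ c₁ * (2 ^ (1 + α) * (x * (B * (b * r ^ α₀) * l y))) := by gcongr; exact e5.trans e4
      _ = c₁ * (2 ^ (1 + α) * (B * (b * r ^ α₀))) * (x * l y) := by ring
      _ ≤ c₁ * (2 ^ (1 + α) * (B * (b * r ^ α₀))) * (Real.exp 1 * y * l x) := by gcongr
      _ = (Real.exp 1 * Real.exp (-1)) * κ * l x * (r ^ α₀ * K r) := by
        rw [hc₁, hy]; field_simp
      _ = _ := by rw [hexp]; ring

/-- Tail bound for the step distribution beyond the scale `K r`. -/
lemma exists_step_tail_le (hl : IsSlowlyVarying l) (hα : 0 < α) (hκ : 0 < κ)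
    (hKt : Tendsto K atTop atTop)
    (hf : ∃ a b : ℝ, 0 < a ∧ 0 < b ∧ ∀ᶠ r in atTop,
      a * r ^ α₀ ≤ K r ^ α / l (K r) ∧ K r ^ α / l (K r) ≤ b * r ^ α₀) :
    ∃ C : ℝ, 0 < C ∧ ∀ᶠ r in atTop, ∑' m : ℤ, (if K r < |(m : ℝ)| then
      ENNReal.ofReal (κ * l |(m : ℝ)| / (1 + |(m : ℝ)|) ^ (1 + α)) else 0) ≤
      ENNReal.ofReal (C / r ^ α₀) := by
  obtain ⟨a, b, ha, hb, hab⟩ := hf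
  -- Giving up half of the exponent leaves the summable power `n ^ (-1 - α / 2)`.
  obtain ⟨X, hX, hP⟩ := hl.potter (show 0 < α / 2 by positivity)
  set C : ℝ := 2 * κ * Real.exp (α / 2) * (2 ^ (α / 2) / (α / 2)) / a with hC
  refine ⟨C, by positivity, ?_⟩
  filter_upwards [hab, hKt.eventually_ge_atTop X, eventually_ge_atTop 1] with r h1 h2 h3
  set x := K r with hx
  have hx1 : 1 ≤ x := hX.trans h2
  have hx0 : 0 < x := by linarith
  have hlx := hl.pos x hx0.le
  have hr : 0 < r ^ α₀ := by positivity
  set E : ℝ := κ * Real.exp (α / 2) * l x * x ^ (-(α / 2)) with hE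
  have hE0 : 0 < E := by positivity
  have hterm : ∀ m : ℤ, (if x < |(m : ℝ)| then
      ENNReal.ofReal (κ * l |(m : ℝ)| / (1 + |(m : ℝ)|) ^ (1 + α)) else 0) ≤
      ENNReal.ofReal E * (fun n : ℕ => if x < n then
        ENNReal.ofReal ((n : ℝ) ^ (-1 - α / 2)) else 0) m.natAbs := by
    intro m
    have habs : |(m : ℝ)| = (m.natAbs : ℝ) := by simp
    rw [habs]
    set y := (m.natAbs : ℝ)
    dsimp only
    split_ifs with h
    · rw [← ENNReal.ofReal_mul hE0.le]
      refine ENNReal.ofReal_le_ofReal ?_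
      have hy0 : 0 < y := by linarith
      have e1 := (hP x y h2 h.le).1
      rw [div_le_iff₀ (by positivity)]
      have e2 : y ^ (1 + α) ≤ (1 + y) ^ (1 + α) := by gcongr; linarith
      calc κ * l y ≤ κ * (Real.exp (α / 2) * (y / x) ^ (α / 2) * l x) := by gcongr
        _ = E * (y ^ (-1 - α / 2) * y ^ (1 + α)) := by
          rw [hE, ← Real.rpow_add hy0, Real.div_rpow hy0.le hx0.le, Real.rpow_neg hx0.le,
            show -1 - α / 2 + (1 + α) = α / 2 by ring]
          ring
        _ ≤ E * (y ^ (-1 - α / 2) * (1 + y) ^ (1 + α)) := by gcongr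
        _ = _ := by ring
    · simp
  refine (ENNReal.tsum_le_tsum hterm).trans ?_
  rw [ENNReal.tsum_mul_left]
  refine (mul_le_mul_right (tsum_int_natAbs_le (fun n : ℕ => if x < n then
    ENNReal.ofReal ((n : ℝ) ^ (-1 - α / 2)) else 0)) _).trans ?_
  refine (mul_le_mul_right (mul_le_mul_right
    (tsum_rpow_tail_le (show 0 < α / 2 by positivity) hx1) _) _).trans ?_
  rw [show (2 : ℝ≥0∞) = ENNReal.ofReal 2 by simp, ← ENNReal.ofReal_mul (by norm_num),
    ← ENNReal.ofReal_mul hE0.le]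
  refine ENNReal.ofReal_le_ofReal ?_
  have e3 : l x * (x ^ (-(α / 2)) * x ^ (-(α / 2))) ≤ 1 / (a * r ^ α₀) := by
    rw [← Real.rpow_add hx0, show -(α / 2) + -(α / 2) = -α by ring, Real.rpow_neg hx0.le,
      ← div_eq_mul_inv, div_le_div_iff₀ (by positivity) (by positivity)]
    have := h1.1
    rw [le_div_iff₀ hlx] at this
    linarith
  rw [Real.div_rpow hx0.le (by norm_num), Real.rpow_neg (by norm_num : (0 : ℝ) ≤ 2), div_inv_eq_mul]
  calc E * (2 * (x ^ (-(α / 2)) * 2 ^ (α / 2) / (α / 2)))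
      = 2 * κ * Real.exp (α / 2) * (2 ^ (α / 2) / (α / 2)) *
          (l x * (x ^ (-(α / 2)) * x ^ (-(α / 2)))) := by rw [hE]; ring
    _ ≤ 2 * κ * Real.exp (α / 2) * (2 ^ (α / 2) / (α / 2)) * (1 / (a * r ^ α₀)) := by gcongr
    _ = _ := by rw [hC]; field_simp

end Tails

noncomputable section

/-! ### Convolution of probability measures. -/

section Convolution

variable {G : Type*}

section Mean

/-- The mean of `φ` under `ν`. -/
def mean (ν : PMF G) (φ : G → ℝ≥0∞) : ℝ≥0∞ := ∑' g, ν g * φ g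

lemma mean_mono {ν : PMF G} {φ ψ : G → ℝ≥0∞} (h : ∀ g, φ g ≤ ψ g) : mean ν φ ≤ mean ν ψ :=
  ENNReal.tsum_le_tsum fun g => by gcongr; exact h g

lemma mean_const (ν : PMF G) (c : ℝ≥0∞) : mean ν (fun _ => c) = c := by
  rw [mean, ENNReal.tsum_mul_right, ν.tsum_coe, one_mul]

lemma mean_add (ν : PMF G) (φ ψ : G → ℝ≥0∞) :
    mean ν (fun g => φ g + ψ g) = mean ν φ + mean ν ψ := by
  simp [mean, mul_add, ENNReal.tsum_add]

lemma mean_pure (x : G) (φ : G → ℝ≥0∞) : mean (PMF.pure x) φ = φ x := by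
  rw [mean, tsum_eq_single x]
  · simp
  · intro y hy; simp [PMF.pure_apply, hy]

lemma mean_const_mul (ν : PMF G) (c : ℝ≥0∞) (φ : G → ℝ≥0∞) :
    mean ν (fun g => c * φ g) = c * mean ν φ := by
  simp only [mean, ← ENNReal.tsum_mul_left]
  congr 1; ext g; ring

lemma mean_indicator_singleton (ν : PMF G) (y : G) : mean ν (Set.indicator {y} 1) = ν y := by
  rw [mean, tsum_eq_single y]
  · simp
  · intro g hg; simp [hg]

lemma pmf_ext_mean {ν μ : PMF G} (h : ∀ φ, mean ν φ = mean μ φ) : ν = μ := by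
  ext y
  rw [← mean_indicator_singleton, ← mean_indicator_singleton, h]

lemma PMF.hasSum_toReal (ν : PMF G) : HasSum (fun g => (ν g).toReal) 1 := by
  have h := ENNReal.hasSum_toReal (f := ν) (by rw [ν.tsum_coe]; simp)
  rwa [← ENNReal.tsum_toReal_eq ν.apply_ne_top, ν.tsum_coe, ENNReal.toReal_one] at h

end Mean

variable [Group G]

/-- Convolution of probability measures. -/
def conv (ν μ : PMF G) : PMF G := ν.bind fun x => μ.map fun y => x * y

lemma map_mul_left_apply (μ : PMF G) (x g : G) : (μ.map fun y => x * y) g = μ (x⁻¹ * g) := by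
  rw [PMF.map_apply, tsum_eq_single (x⁻¹ * g)]
  · simp
  · intro y hy
    rw [if_neg]
    rintro rfl
    simp at hy

lemma conv_apply (ν μ : PMF G) (g : G) : conv ν μ g = ∑' x, ν x * μ (x⁻¹ * g) := by
  rw [conv, PMF.bind_apply]
  simp_rw [map_mul_left_apply]

lemma mean_conv (ν μ : PMF G) (φ : G → ℝ≥0∞) :
    mean (conv ν μ) φ = mean ν fun x => mean μ fun y => φ (x * y) := by
  simp only [mean, conv_apply, ← ENNReal.tsum_mul_right, ← ENNReal.tsum_mul_left]
  rw [ENNReal.tsum_comm]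
  congr 1; ext x
  rw [← (Equiv.mulLeft x).tsum_eq]
  congr 1; ext y
  simp [mul_assoc]

lemma conv_assoc (ν μ σ : PMF G) : conv (conv ν μ) σ = conv ν (conv μ σ) :=
  pmf_ext_mean fun φ => by simp [mean_conv, mul_assoc]

lemma pure_conv (μ : PMF G) : conv (PMF.pure 1) μ = μ :=
  pmf_ext_mean fun φ => by simp [mean_conv, mean_pure]

lemma conv_pure (μ : PMF G) : conv μ (PMF.pure 1) = μ :=
  pmf_ext_mean fun φ => by simp [mean_conv, mean_pure]

lemma convPow_zero (μ : PMF G) : convPow μ 0 = PMF.pure 1 := rfl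

lemma convPow_succ (μ : PMF G) (n : ℕ) : convPow μ (n + 1) = conv (convPow μ n) μ := rfl

lemma convPow_one (μ : PMF G) : convPow μ 1 = μ := pure_conv μ

lemma convPow_add (μ : PMF G) (m n : ℕ) :
    convPow μ (m + n) = conv (convPow μ m) (convPow μ n) := by
  induction n with
  | zero => rw [convPow_zero, conv_pure, add_zero]
  | succ n ih => rw [← add_assoc, convPow_succ, ih, convPow_succ, conv_assoc]

lemma convPow_succ' (μ : PMF G) (n : ℕ) : convPow μ (n + 1) = conv μ (convPow μ n) := by
  rw [add_comm, convPow_add, convPow_one]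

lemma convPow_inv {μ : PMF G} (hμ : ∀ g, μ g⁻¹ = μ g) (n : ℕ) (g : G) :
    convPow μ n g⁻¹ = convPow μ n g := by
  induction n generalizing g with
  | zero => rw [convPow_zero, PMF.pure_apply, PMF.pure_apply]; congr 1; rw [inv_eq_one]
  | succ n ih =>
    rw [convPow_succ, conv_apply, ← convPow_succ, convPow_succ', conv_apply]
    rw [← (Equiv.mulLeft g⁻¹).tsum_eq]
    congr 1; ext x
    simp only [Equiv.coe_mulLeft]
    rw [mul_comm, ← hμ x, ← ih (x⁻¹ * g)]
    simp

lemma toReal_conv_apply (ν μ : PMF G) (g : G) :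
    (conv ν μ g).toReal = ∑' x, (ν x).toReal * (μ (x⁻¹ * g)).toReal := by
  rw [conv_apply, ENNReal.tsum_toReal_eq]
  · simp_rw [ENNReal.toReal_mul]
  · intro x; exact ENNReal.mul_ne_top (ν.apply_ne_top _) (μ.apply_ne_top _)

end Convolution

/-! ### Inequalities for self-adjoint contractions. -/

section Contraction

variable {H : Type*} [NormedAddCommGroup H] [InnerProductSpace ℝ H] {P : H →L[ℝ] H}

open scoped RealInnerProductSpace

lemma inner_le_norm_sq_of_contraction (hP : ∀ f, ‖P f‖ ≤ ‖f‖) (f : H) :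
    |⟪P f, f⟫| ≤ ‖f‖ ^ 2 := by
  refine (abs_real_inner_le_norm _ _).trans ?_
  rw [sq]; gcongr; exact hP f

/-- Spectrally this is `1 - λ ^ n ≤ n * (1 - λ)` for `λ` in `[-1, 1]`. Spectral theory is replaced
by the nonnegativity of the form of `1 - P` on the vectors `x - P x` and `P ^ j f - f`. -/
lemma norm_sq_sub_inner_pow_le (hs : ∀ f h, ⟪P f, h⟫ = ⟪f, P h⟫) (hP : ∀ f, ‖P f‖ ≤ ‖f‖) (f : H)
    (n : ℕ) : ‖f‖ ^ 2 - ⟪(P ^ n) f, f⟫ ≤ n * (‖f‖ ^ 2 - ⟪P f, f⟫) := by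
  have hB : ∀ x : H, 0 ≤ ‖x‖ ^ 2 - ⟪P x, x⟫ := fun x => by
    linarith [(abs_le.1 (inner_le_norm_sq_of_contraction hP x)).2]
  have hPB : ∀ x : H, ‖P x‖ ^ 2 - ⟪P (P x), P x⟫ ≤ ‖x‖ ^ 2 - ⟪P x, x⟫ := by
    intro x
    have h1 := (abs_le.1 (inner_le_norm_sq_of_contraction hP (x - P x))).1
    have h2 : ‖x - P x‖ ^ 2 = ‖x‖ ^ 2 - 2 * ⟪P x, x⟫ + ‖P x‖ ^ 2 := by
      rw [norm_sub_sq_real, real_inner_comm]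
    have h3 : ⟪P (x - P x), x - P x⟫ =
        ⟪P x, x⟫ - ‖P x‖ ^ 2 - ‖P x‖ ^ 2 + ⟪P (P x), P x⟫ := by
      rw [map_sub, inner_sub_left, inner_sub_right, inner_sub_right, hs (P x) x,
        real_inner_self_eq_norm_sq]
      ring
    linarith
  have hpow : ∀ j, ‖(P ^ j) f‖ ^ 2 - ⟪P ((P ^ j) f), (P ^ j) f⟫ ≤ ‖f‖ ^ 2 - ⟪P f, f⟫ := by
    intro j
    induction j with
    | zero => simp
    | succ j ih =>
      rw [pow_succ' P j]
      exact (hPB _).trans ih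
  have hdiff : ∀ j, ⟪(P ^ j) f, f⟫ - ⟪(P ^ (j + 1)) f, f⟫ ≤ ‖f‖ ^ 2 - ⟪P f, f⟫ := by
    intro j
    set x := (P ^ j) f with hx
    have h1 := hB (x - f)
    have h2 : ‖x - f‖ ^ 2 = ‖x‖ ^ 2 - 2 * ⟪x, f⟫ + ‖f‖ ^ 2 := norm_sub_sq_real _ _
    have h3 : ⟪P (x - f), x - f⟫ = ⟪P x, x⟫ - 2 * ⟪P x, f⟫ + ⟪P f, f⟫ := by
      rw [map_sub, inner_sub_left, inner_sub_right, inner_sub_right, hs f x, real_inner_comm f]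
      ring
    have h4 : (P ^ (j + 1)) f = P x := by rw [pow_succ' P j]; rfl
    rw [h4]
    linarith [hpow j]
  induction n with
  | zero => simp
  | succ n ih =>
    rw [Nat.cast_succ]
    linarith [hdiff n]

/-- Spectrally `1 - λ ^ 2 = (1 - λ) * (1 + λ)`, and laziness `c` keeps `1 + λ` above `2 * c`. This
is how the energy is controlled by the decrement of a squared norm. -/
lemma two_mul_energy_le {c : ℝ} {f : H} (h : ‖P f - c • f‖ ≤ (1 - c) * ‖f‖) :
    2 * c * (‖f‖ ^ 2 - ⟪P f, f⟫) ≤ ‖f‖ ^ 2 - ‖P f‖ ^ 2 := by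
  have h1 : ‖P f - c • f‖ ^ 2 ≤ ((1 - c) * ‖f‖) ^ 2 := by gcongr
  rw [norm_sub_sq_real, inner_smul_right, norm_smul, mul_pow, Real.norm_eq_abs, sq_abs] at h1
  nlinarith

/-- Expand the squared norm of `f - P (P f)`. -/
lemma norm_sq_sub_antitone (hs : ∀ f h, ⟪P f, h⟫ = ⟪f, P h⟫) (f : H) :
    ‖P f‖ ^ 2 - ‖P (P f)‖ ^ 2 ≤ ‖f‖ ^ 2 - ‖P f‖ ^ 2 := by
  have h1 : 0 ≤ ‖f - P (P f)‖ ^ 2 := by positivity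
  rw [norm_sub_sq_real, ← hs, real_inner_self_eq_norm_sq] at h1
  linarith

end Contraction

/-! ### Right translations and Markov operators on square summable functions. -/

section Translation

/-- Square summable functions on `G`. -/
abbrev EllTwo (G : Type*) : Type _ := lp (fun _ : G => ℝ) 2

variable {G : Type*}

lemma EllTwo.hasSum_norm_sq (f : EllTwo G) : HasSum (fun x => f x ^ 2) (‖f‖ ^ 2) := by
  have h := lp.hasSum_inner (𝕜 := ℝ) f f
  rw [real_inner_self_eq_norm_sq] at h
  simpa [sq] using h

/-- The density of a probability measure, as a square summable function. -/
def density (ν : PMF G) : EllTwo G :=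
  ⟨fun x => (ν x).toReal, memℓp_gen (by
    refine Summable.of_nonneg_of_le (fun x => by positivity) (fun x => ?_) ν.hasSum_toReal.summable
    have h1 : (ν x).toReal ≤ 1 := by
      have := ENNReal.toReal_mono ENNReal.one_ne_top (ν.coe_le_one x); simpa using this
    have h0 : 0 ≤ (ν x).toReal := ENNReal.toReal_nonneg
    rw [Real.norm_of_nonneg h0]
    simp only [ENNReal.toReal_ofNat, Real.rpow_ofNat]
    nlinarith)⟩

@[simp] lemma density_apply (ν : PMF G) (x : G) : density ν x = (ν x).toReal := rfl

variable [Group G]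

open scoped RealInnerProductSpace

lemma memℓp_rightTrans (g : G) (f : EllTwo G) : Memℓp (fun x => f (x * g)) 2 :=
  memℓp_gen ((Equiv.mulRight g).summable_iff.2 ((lp.memℓp f).summable (by simp)))

lemma norm_rightTrans_aux (g : G) (f h : EllTwo G) (hh : ∀ x, h x = f (x * g)) : ‖h‖ = ‖f‖ := by
  have h3 : HasSum (fun x => f (x * g) ^ 2) (‖f‖ ^ 2) :=
    (Equiv.mulRight g).hasSum_iff.2 (EllTwo.hasSum_norm_sq f)
  have h2 := EllTwo.hasSum_norm_sq h
  simp only [hh] at h2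
  exact (pow_left_inj₀ (norm_nonneg _) (norm_nonneg _) two_ne_zero).1 (h2.unique h3)

/-- Right translation, `T g f x = f (x * g)`. -/
def rightTrans (g : G) : EllTwo G →ₗᵢ[ℝ] EllTwo G where
  toFun f := ⟨fun x => f (x * g), memℓp_rightTrans g f⟩
  map_add' f h := by ext x; rfl
  map_smul' c f := by ext x; rfl
  norm_map' f := norm_rightTrans_aux g f _ fun _ => rfl

@[simp] lemma rightTrans_apply (g : G) (f : EllTwo G) (x : G) : rightTrans g f x = f (x * g) := rfl

lemma rightTrans_mul (g h : G) (f : EllTwo G) :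
    rightTrans (g * h) f = rightTrans g (rightTrans h f) := by
  ext x; simp [mul_assoc]

lemma rightTrans_one (f : EllTwo G) : rightTrans 1 f = f := by ext x; simp

lemma inner_rightTrans (g : G) (f h : EllTwo G) :
    ⟪rightTrans g f, h⟫ = ⟪f, rightTrans g⁻¹ h⟫ := by
  have := (rightTrans g).inner_map_map f (rightTrans g⁻¹ h)
  rwa [← rightTrans_mul, mul_inv_cancel, rightTrans_one] at this

lemma norm_sub_rightTrans_mul (f : EllTwo G) (g h : G) :
    ‖f - rightTrans (g * h) f‖ ≤ ‖f - rightTrans g f‖ + ‖f - rightTrans h f‖ := by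
  have h1 : f - rightTrans (g * h) f = (f - rightTrans g f) + rightTrans g (f - rightTrans h f) := by
    rw [rightTrans_mul, map_sub]; abel
  rw [h1]
  refine (norm_add_le _ _).trans ?_
  rw [LinearIsometry.norm_map]

lemma norm_sub_rightTrans_inv (f : EllTwo G) (g : G) :
    ‖f - rightTrans g⁻¹ f‖ = ‖f - rightTrans g f‖ := by
  rw [← LinearIsometry.norm_map (rightTrans g) (f - rightTrans g⁻¹ f), map_sub, ← rightTrans_mul,
    mul_inv_cancel, rightTrans_one, norm_sub_rev]

lemma norm_sub_rightTrans_prod (f : EllTwo G) {c : ℝ} (w : List G)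
    (hw : ∀ g ∈ w, ‖f - rightTrans g f‖ ≤ c) : ‖f - rightTrans w.prod f‖ ≤ w.length * c := by
  induction w with
  | nil => simp [rightTrans_one]
  | cons g w ih =>
    rw [List.prod_cons, List.length_cons]
    push_cast
    linarith [norm_sub_rightTrans_mul f g w.prod, hw g (by simp), ih fun x hx => hw x (by simp [hx])]

/-- The Markov operator of right convolution by `ν`. -/
def markovOp (ν : PMF G) : EllTwo G →L[ℝ] EllTwo G :=
  ∑' g, (ν g).toReal • (rightTrans g).toContinuousLinearMap

lemma norm_rightTrans_le (g : G) : ‖(rightTrans g).toContinuousLinearMap‖ ≤ 1 :=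
  LinearIsometry.norm_toContinuousLinearMap_le _

lemma summable_norm_markovOp (ν : PMF G) :
    Summable fun g => ‖(ν g).toReal • (rightTrans g).toContinuousLinearMap‖ := by
  refine Summable.of_nonneg_of_le (fun _ => norm_nonneg _) (fun g => ?_) ν.hasSum_toReal.summable
  rw [norm_smul, Real.norm_of_nonneg ENNReal.toReal_nonneg]
  exact mul_le_of_le_one_right ENNReal.toReal_nonneg (norm_rightTrans_le g)

lemma hasSum_markovOp (ν : PMF G) :
    HasSum (fun g => (ν g).toReal • (rightTrans g).toContinuousLinearMap) (markovOp ν) :=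
  (summable_norm_markovOp ν).of_norm.hasSum

lemma hasSum_markovOp_apply (ν : PMF G) (f : EllTwo G) :
    HasSum (fun g => (ν g).toReal • rightTrans g f) (markovOp ν f) := by
  simpa using (hasSum_markovOp ν).mapL (ContinuousLinearMap.apply ℝ (EllTwo G) f)

lemma hasSum_inner_markovOp (ν : PMF G) (f h : EllTwo G) :
    HasSum (fun g => (ν g).toReal * ⟪rightTrans g f, h⟫) ⟪markovOp ν f, h⟫ := by
  have := (hasSum_markovOp_apply ν f).mapL (innerSL ℝ h)
  simp only [innerSL_apply_apply, inner_smul_right] at this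
  simpa [real_inner_comm] using this

lemma inner_markovOp {ν : PMF G} (hν : ∀ g, ν g⁻¹ = ν g) (f h : EllTwo G) :
    ⟪markovOp ν f, h⟫ = ⟪f, markovOp ν h⟫ := by
  have h1 := hasSum_inner_markovOp ν f h
  have h2 := (Equiv.inv G).hasSum_iff.2 (hasSum_inner_markovOp ν h f)
  rw [real_inner_comm] at h2
  refine h1.unique (h2.congr_fun ?_)
  intro g
  simp only [Function.comp, Equiv.inv_apply, hν]
  rw [inner_rightTrans, real_inner_comm]

lemma norm_markovOp_apply_le (ν : PMF G) (f : EllTwo G) : ‖markovOp ν f‖ ≤ ‖f‖ := by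
  have h1 := hasSum_markovOp_apply ν f
  rw [← h1.tsum_eq]
  have h2 : ∀ g, ‖(ν g).toReal • rightTrans g f‖ = (ν g).toReal * ‖f‖ := fun g => by
    rw [norm_smul, Real.norm_of_nonneg ENNReal.toReal_nonneg, LinearIsometry.norm_map]
  have h3 := ν.hasSum_toReal.mul_right ‖f‖
  rw [one_mul] at h3
  refine tsum_of_norm_bounded h3 fun g => (h2 g).le

/-- The Dirichlet form. -/
lemma hasSum_energy (ν : PMF G) (f : EllTwo G) :
    HasSum (fun g => (ν g).toReal * ‖f - rightTrans g f‖ ^ 2)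
      (2 * (‖f‖ ^ 2 - ⟪markovOp ν f, f⟫)) := by
  have h1 := (ν.hasSum_toReal.mul_right (‖f‖ ^ 2)).sub (hasSum_inner_markovOp ν f f)
  rw [one_mul] at h1
  refine (h1.mul_left 2).congr_fun fun g => ?_
  rw [norm_sub_sq_real, LinearIsometry.norm_map, real_inner_comm]
  ring

/-- Removing the atom at the identity leaves an average of isometries of total mass `1 - μ 1`. This
supplies the hypothesis of `two_mul_energy_le`. -/
lemma norm_markovOp_sub_le (μ : PMF G) (f : EllTwo G) :
    ‖markovOp μ f - (μ 1).toReal • f‖ ≤ (1 - (μ 1).toReal) * ‖f‖ := by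
  classical
  have h1 := (hasSum_markovOp_apply μ f).update 1 0
  have h2 := (μ.hasSum_toReal.update 1 0).mul_right ‖f‖
  rw [rightTrans_one] at h1
  have e1 : (0 - (μ 1).toReal • f + markovOp μ f) = markovOp μ f - (μ 1).toReal • f := by abel
  have e2 : (0 - (μ 1).toReal + 1) = 1 - (μ 1).toReal := by ring
  rw [e1] at h1
  rw [e2] at h2
  rw [← h1.tsum_eq]
  refine tsum_of_norm_bounded h2 fun g => ?_
  by_cases hg : g = 1
  · subst hg; simp
  · simp only [Function.update_of_ne hg]
    rw [norm_smul, Real.norm_of_nonneg ENNReal.toReal_nonneg, LinearIsometry.norm_map]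

lemma markovOp_conv (ν μ : PMF G) : markovOp (conv ν μ) = markovOp ν * markovOp μ := by
  have h1 := tsum_mul_tsum_of_summable_norm (summable_norm_markovOp ν) (summable_norm_markovOp μ)
  have hs := summable_mul_of_summable_norm (summable_norm_markovOp ν) (summable_norm_markovOp μ)
  have hT : ∀ x y : G, (rightTrans x).toContinuousLinearMap * (rightTrans y).toContinuousLinearMap =
      (rightTrans (x * y)).toContinuousLinearMap := by
    intro x y; ext f : 1; exact (rightTrans_mul x y f).symm
  set e : G × G ≃ G × G :=
    { toFun := fun p => (p.2, p.2⁻¹ * p.1)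
      invFun := fun p => (p.1 * p.2, p.1)
      left_inv := fun p => by simp
      right_inv := fun p => by simp } with he
  have hs' := e.summable_iff.2 hs
  have h2 : markovOp ν * markovOp μ = _ := h1
  rw [h2, ← e.tsum_eq]
  refine Eq.trans ?_ hs'.tsum_prod.symm
  rw [markovOp]
  congr 1; ext g : 1
  have hsum : Summable fun x => (ν x).toReal * (μ (x⁻¹ * g)).toReal := by
    have h3 : ∑' x, ν x * μ (x⁻¹ * g) ≠ ∞ := by
      rw [← conv_apply]; exact PMF.apply_ne_top _ _
    simpa [ENNReal.toReal_mul] using ENNReal.summable_toReal h3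
  rw [toReal_conv_apply]
  refine (hsum.hasSum.smul_const (rightTrans g).toContinuousLinearMap).tsum_eq.symm.trans ?_
  congr 1; ext x : 1
  simp only [he, Function.comp, Equiv.coe_fn_mk, smul_mul_smul_comm, hT, mul_inv_cancel_left]

lemma markovOp_pure : markovOp (PMF.pure (1 : G)) = 1 := by
  ext f : 1
  have h := hasSum_markovOp_apply (PMF.pure (1 : G)) f
  refine h.unique ?_
  convert hasSum_single (1 : G) ?_ using 1
  · simp [rightTrans_one]
  · intro g hg; simp [PMF.pure_apply, hg]

lemma markovOp_convPow (μ : PMF G) (n : ℕ) : markovOp (convPow μ n) = markovOp μ ^ n := by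
  induction n with
  | zero => rw [convPow_zero, markovOp_pure, pow_zero]
  | succ n ih => rw [convPow_succ, markovOp_conv, ih, pow_succ]

lemma inner_density_rightTrans {ν : PMF G} (hν : ∀ g, ν g⁻¹ = ν g) (y : G) :
    ⟪density ν, rightTrans y (density ν)⟫ = (conv ν ν y).toReal := by
  rw [lp.inner_eq_tsum, toReal_conv_apply, ← (Equiv.inv G).tsum_eq]
  congr 1; ext x
  simp [hν, mul_comm]

lemma norm_density_sq {ν : PMF G} (hν : ∀ g, ν g⁻¹ = ν g) :
    ‖density ν‖ ^ 2 = (conv ν ν 1).toReal := by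
  rw [← inner_density_rightTrans hν, rightTrans_one, real_inner_self_eq_norm_sq]

lemma markovOp_density {μ : PMF G} (hμ : ∀ g, μ g⁻¹ = μ g) (n : ℕ) :
    markovOp μ (density (convPow μ n)) = density (convPow μ (n + 1)) := by
  classical
  ext x
  have h1 := hasSum_inner_markovOp μ (density (convPow μ n)) (lp.single 2 x (1 : ℝ))
  simp only [lp.inner_single_right, rightTrans_apply, density_apply] at h1
  simp only [RCLike.inner_apply, conj_trivial, one_mul] at h1
  rw [← h1.tsum_eq, density_apply, convPow_succ, toReal_conv_apply,
    ← (Equiv.mulLeft x).tsum_eq fun y => (convPow μ n y).toReal * (μ (y⁻¹ * x)).toReal]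
  congr 1; ext g
  simp [hμ, mul_comm]

end Translation

end

noncomputable section

/-! ### Return probabilities: Nash inequality and upper bound. -/

section HeatKernel

variable {G : Type*} {N : G → ℝ} {μ : PMF G} {β : ℝ}

lemma volumeFun_eq_card {R : ℝ} (h : {g : G | N g ≤ R}.Finite) :
    volumeFun N R = h.toFinset.card := Nat.card_eq_card_finite_toFinset h

lemma sum_toReal_le_one (ν : PMF G) (s : Finset G) : ∑ g ∈ s, (ν g).toReal ≤ 1 :=
  sum_le_hasSum s (fun _ _ => ENNReal.toReal_nonneg) ν.hasSum_toReal

lemma toReal_le_one (ν : PMF G) (g : G) : (ν g).toReal ≤ 1 := by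
  simpa using sum_toReal_le_one ν {g}

variable [Group G]

open scoped RealInnerProductSpace

/-- A symmetric lazy probability measure on a group with a doubling norm, satisfying a
pseudo-Poincaré inequality and a tail bound of order `β`. -/
structure IsStableLike (N : G → ℝ) (μ : PMF G) (β : ℝ) : Prop where
  pos : 0 < β
  lt_two : β < 2
  symm : ∀ g, μ g⁻¹ = μ g
  lazy : 0 < (μ 1).toReal
  norm : IsNorm N
  inv : ∀ g, N g⁻¹ = N g
  finite_ball : ∀ R, {g : G | N g ≤ R}.Finite
  doubling : ∀ a : ℝ, ∃ D : ℝ, 0 < D ∧ ∀ r, 0 < r → (volumeFun N (a * r) : ℝ) ≤ D * volumeFun N r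
  poincare : ∃ C : ℝ, 0 < C ∧ ∀ᶠ r in atTop, ∀ y, N y ≤ r → ∀ f : EllTwo G,
    ‖f - rightTrans y f‖ ^ 2 ≤ C * r ^ β * (‖f‖ ^ 2 - ⟪markovOp μ f, f⟫)
  tail : ∃ C : ℝ, 0 < C ∧ ∀ᶠ r in atTop,
    mean μ (Set.indicator {g | r < N g} 1) ≤ ENNReal.ofReal (C / r ^ β)

/-- The return probability `μ^(2n)(1)`. -/
def returnProb (μ : PMF G) (n : ℕ) : ℝ := (convPow μ (2 * n) 1).toReal

lemma inner_density_convPow (hμ : ∀ g, μ g⁻¹ = μ g) (n : ℕ) (y : G) :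
    ⟪density (convPow μ n), rightTrans y (density (convPow μ n))⟫ =
      (convPow μ (2 * n) y).toReal := by
  rw [inner_density_rightTrans (convPow_inv hμ n), two_mul, convPow_add]

lemma norm_density_convPow (hμ : ∀ g, μ g⁻¹ = μ g) (n : ℕ) :
    ‖density (convPow μ n)‖ ^ 2 = returnProb μ n := by
  rw [norm_density_sq (convPow_inv hμ n), returnProb, two_mul, convPow_add]

lemma norm_density_sub (hμ : ∀ g, μ g⁻¹ = μ g) (n : ℕ) (y : G) :
    ‖density (convPow μ n) - rightTrans y (density (convPow μ n))‖ ^ 2 =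
      2 * (returnProb μ n - (convPow μ (2 * n) y).toReal) := by
  rw [norm_sub_sq_real, LinearIsometry.norm_map, inner_density_convPow hμ,
    norm_density_convPow hμ]
  ring

lemma convPow_le_returnProb (hμ : ∀ g, μ g⁻¹ = μ g) (n : ℕ) (y : G) :
    (convPow μ (2 * n) y).toReal ≤ returnProb μ n := by
  have := norm_density_sub hμ n y
  have h2 : 0 ≤ ‖density (convPow μ n) - rightTrans y (density (convPow μ n))‖ ^ 2 := by positivity
  linarith

lemma returnProb_nonneg (μ : PMF G) (n : ℕ) : 0 ≤ returnProb μ n := ENNReal.toReal_nonneg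

lemma returnProb_succ_le (hμ : ∀ g, μ g⁻¹ = μ g) (n : ℕ) :
    returnProb μ (n + 1) ≤ returnProb μ n := by
  rw [← norm_density_convPow hμ, ← norm_density_convPow hμ, ← markovOp_density hμ]
  gcongr
  exact norm_markovOp_apply_le _ _

lemma returnProb_sub_antitone (hμ : ∀ g, μ g⁻¹ = μ g) :
    Antitone fun n => returnProb μ n - returnProb μ (n + 1) := by
  refine antitone_nat_of_succ_le fun n => ?_
  simp only [← norm_density_convPow hμ]
  rw [← markovOp_density hμ (n + 1), ← markovOp_density hμ n]
  exact norm_sq_sub_antitone (inner_markovOp hμ) _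

/-- The decrements do not increase, so each of the `M` decrements between times `M` and `2 * M` is
at least the one at `n`; their sum telescopes. -/
lemma mul_returnProb_sub_le (hμ : ∀ g, μ g⁻¹ = μ g) {M n : ℕ} (h : 2 * M ≤ n) :
    M * (returnProb μ n - returnProb μ (n + 1)) ≤ returnProb μ M := by
  have h1 : ∑ j ∈ Finset.range M, (returnProb μ (M + j) - returnProb μ (M + j + 1)) =
      returnProb μ M - returnProb μ (M + M) := by
    simp only [add_assoc]
    rw [Finset.sum_range_sub' fun j => returnProb μ (M + j)]; simp
  have h2 : ∑ j ∈ Finset.range M, (returnProb μ n - returnProb μ (n + 1)) ≤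
      ∑ j ∈ Finset.range M, (returnProb μ (M + j) - returnProb μ (M + j + 1)) := by
    refine Finset.sum_le_sum fun j hj => returnProb_sub_antitone hμ ?_
    have := Finset.mem_range.1 hj
    omega
  rw [Finset.sum_const, Finset.card_range, nsmul_eq_mul] at h2
  linarith [returnProb_nonneg μ (M + M)]

namespace IsStableLike

lemma volumeFun_mono (h : IsStableLike N μ β) {a b : ℝ} (hab : a ≤ b) :
    (volumeFun N a : ℝ) ≤ volumeFun N b := by
  rw [volumeFun_eq_card (h.finite_ball a), volumeFun_eq_card (h.finite_ball b)]
  gcongr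

lemma volumeFun_pos (h : IsStableLike N μ β) {a : ℝ} (ha : 0 ≤ a) : 0 < (volumeFun N a : ℝ) := by
  rw [volumeFun_eq_card (h.finite_ball a)]
  simp only [Nat.cast_pos, Finset.card_pos]
  exact ⟨1, by simpa [(h.norm.eq_zero_iff 1).2 rfl] using ha⟩

/-- The Poincaré inequality is applied to the density of `μ^(n)`: its left side is twice the
difference of heat kernel values, and by laziness its energy is at most a multiple of the decrement
of the return probability. -/
lemma exists_near_diag (h : IsStableLike N μ β) : ∃ C : ℝ, 0 < C ∧ ∀ᶠ r in atTop, ∀ y, N y ≤ r →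
    ∀ n, returnProb μ n - (convPow μ (2 * n) y).toReal ≤
      C * r ^ β * (returnProb μ n - returnProb μ (n + 1)) := by
  obtain ⟨C, hC, H⟩ := h.poincare
  refine ⟨C / (4 * (μ 1).toReal), by have := h.lazy; positivity, ?_⟩
  filter_upwards [H, eventually_ge_atTop 0] with r hr hr0 y hy n
  have h1 := hr y hy (density (convPow μ n))
  rw [norm_density_sub h.symm] at h1
  have h2 := two_mul_energy_le (norm_markovOp_sub_le μ (density (convPow μ n)))
  have h3 : ‖markovOp μ (density (convPow μ n))‖ ^ 2 = returnProb μ (n + 1) := by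
    rw [markovOp_density h.symm, norm_density_convPow h.symm]
  rw [h3, norm_density_convPow h.symm] at h2
  rw [norm_density_convPow h.symm] at h1
  have hc := h.lazy
  have hrβ : 0 ≤ r ^ β := Real.rpow_nonneg hr0 β
  set c := (μ 1).toReal
  set E := returnProb μ n - ⟪markovOp μ (density (convPow μ n)), density (convPow μ n)⟫
  have h4 : E ≤ (returnProb μ n - returnProb μ (n + 1)) / (2 * c) := by
    rw [le_div_iff₀ (by positivity)]; linarith
  have h5 : C * r ^ β * E ≤ C * r ^ β * ((returnProb μ n - returnProb μ (n + 1)) / (2 * c)) := by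
    gcongr
  have h6 : C / (4 * c) * r ^ β * (returnProb μ n - returnProb μ (n + 1)) =
      C * r ^ β * ((returnProb μ n - returnProb μ (n + 1)) / (2 * c)) / 2 := by
    field_simp; ring
  rw [h6]
  linarith

/-- Average the near-diagonal estimate over the ball of radius `r`, whose total mass under `μ^(2n)`
is at most `1`. -/
lemma exists_nash (h : IsStableLike N μ β) : ∃ C : ℝ, 0 < C ∧ ∀ᶠ r in atTop, ∀ n,
    returnProb μ n ≤ C * r ^ β * (returnProb μ n - returnProb μ (n + 1)) +
      (volumeFun N r : ℝ)⁻¹ := by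
  obtain ⟨C, hC, H⟩ := h.exists_near_diag
  refine ⟨C, hC, ?_⟩
  filter_upwards [H, eventually_ge_atTop 0] with r hr hr0 n
  have hV := h.volumeFun_pos hr0
  have h1 : ∑ y ∈ (h.finite_ball r).toFinset, (returnProb μ n - (convPow μ (2 * n) y).toReal) ≤
      ∑ y ∈ (h.finite_ball r).toFinset, C * r ^ β * (returnProb μ n - returnProb μ (n + 1)) :=
    Finset.sum_le_sum fun y hy => hr y (by simpa using hy) n
  rw [Finset.sum_sub_distrib, Finset.sum_const, Finset.sum_const, ← volumeFun_eq_card,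
    nsmul_eq_mul, nsmul_eq_mul] at h1
  have h2 := sum_toReal_le_one (convPow μ (2 * n)) (h.finite_ball r).toFinset
  have h3 : (volumeFun N r : ℝ) * returnProb μ n ≤ volumeFun N r *
      (C * r ^ β * (returnProb μ n - returnProb μ (n + 1)) + (volumeFun N r : ℝ)⁻¹) := by
    rw [mul_add, mul_inv_cancel₀ hV.ne']; linarith
  exact le_of_mul_le_mul_left h3 hV

lemma tendsto_scale (h : IsStableLike N μ β) {ε : ℝ} (hε : 0 < ε) :
    Tendsto (fun n : ℕ => (ε * n) ^ (1 / β)) atTop atTop :=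
  (tendsto_rpow_atTop (by have := h.pos; positivity)).comp
    (tendsto_natCast_atTop_atTop.const_mul_atTop hε)

lemma scale_rpow (h : IsStableLike N μ β) {t : ℝ} (ht : 0 ≤ t) : (t ^ (1 / β)) ^ β = t := by
  rw [← Real.rpow_mul ht, one_div_mul_cancel h.pos.ne', Real.rpow_one]

lemma exists_volumeFun_scale_le (h : IsStableLike N μ β) {ε : ℝ} (hε : 0 < ε) : ∃ D : ℝ, 0 < D ∧
    ∀ t : ℝ, 0 < t → (volumeFun N ((ε * t) ^ (1 / β)) : ℝ) ≤ D * volumeFun N (t ^ (1 / β)) := by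
  obtain ⟨D, hD, H⟩ := h.doubling (ε ^ (1 / β))
  refine ⟨D, hD, fun t ht => ?_⟩
  rw [Real.mul_rpow hε.le ht.le]
  exact H _ (by positivity)

theorem exists_returnProb_le (h : IsStableLike N μ β) : ∃ A : ℝ, 0 < A ∧ ∀ n : ℕ, 1 ≤ n →
    returnProb μ n ≤ A * (volumeFun N ((n : ℝ) ^ (1 / β)) : ℝ)⁻¹ := by
  obtain ⟨C, hC, H⟩ := h.exists_nash
  obtain ⟨D, hD, HD⟩ := h.exists_volumeFun_scale_le (ε := 3) (by norm_num)
  -- With `M = n / 2` and `r ^ β = ε * M`, this `ε` makes the contribution of the induction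
  -- hypothesis half of the target. The other half absorbs the volume term because `A ≥ 2 * D * D'`;
  -- the second entry of `A` covers small `n`.
  set ε : ℝ := 1 / (2 * C * D) with hεdef
  have hε : 0 < ε := by positivity
  obtain ⟨D', hD', HD'⟩ := h.exists_volumeFun_scale_le (ε := ε⁻¹) (by positivity)
  obtain ⟨N₀, hN₀⟩ := eventually_atTop.1 ((h.tendsto_scale hε).eventually H)
  set v : ℕ → ℝ := fun n => volumeFun N ((n : ℝ) ^ (1 / β)) with hv
  have hvpos : ∀ n, 0 < v n := fun n => h.volumeFun_pos (by positivity)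
  set A : ℝ := max (2 * D * D') (v (2 * N₀ + 2)) with hA
  have hA0 : 0 < A := lt_of_lt_of_le (hvpos _) (le_max_right _ _)
  have hvmono : ∀ m n, m ≤ n → v m ≤ v n := fun m n hmn => h.volumeFun_mono (by
    have := h.pos
    gcongr)
  refine ⟨A, hA0, fun n => ?_⟩
  induction n using Nat.strong_induction_on with
  | _ n ih =>
    intro hn
    change returnProb μ n ≤ A * (v n)⁻¹
    rcases lt_or_ge n (2 * N₀ + 2) with hlt | hge
    · have h1 : returnProb μ n ≤ 1 := toReal_le_one _ _
      refine h1.trans ?_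
      rw [← div_eq_mul_inv, one_le_div (hvpos n)]
      exact (hvmono _ _ hlt.le).trans (le_max_right _ _)
    · set M := n / 2 with hM
      have hM1 : 1 ≤ M := by omega
      have hM0 : (0 : ℝ) < M := by exact_mod_cast hM1
      have h1 := hN₀ M (by omega) n
      have h2 := mul_returnProb_sub_le h.symm (M := M) (n := n) (by omega)
      have h3 := ih M (by omega) hM1
      change returnProb μ M ≤ A * (v M)⁻¹ at h3
      rw [h.scale_rpow (by positivity)] at h1
      have h4 : v M ≤ D' * volumeFun N ((ε * M) ^ (1 / β)) := by
        have := HD' (ε * M) (by positivity)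
        rwa [inv_mul_cancel_left₀ hε.ne'] at this
      have h5 : v n ≤ D * v M := by
        refine le_trans ?_ (HD M hM0)
        refine h.volumeFun_mono ?_
        have : (n : ℝ) ≤ 3 * M := by exact_mod_cast (by omega : n ≤ 3 * M)
        have := h.pos
        gcongr
      have hW : 0 < (volumeFun N ((ε * M) ^ (1 / β)) : ℝ) := h.volumeFun_pos (by positivity)
      have h6 : (volumeFun N ((ε * M) ^ (1 / β)) : ℝ)⁻¹ ≤ D' * (v M)⁻¹ := by
        rw [inv_le_comm₀ hW (by have := hvpos M; positivity), mul_inv, inv_inv]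
        rw [inv_mul_le_iff₀ hD']
        exact h4
      have h7 : (v M)⁻¹ ≤ D * (v n)⁻¹ := by
        rw [inv_le_comm₀ (hvpos M) (by have := hvpos n; positivity), mul_inv, inv_inv]
        rw [inv_mul_le_iff₀ hD]
        exact h5
      have h8 : C * (ε * M) * (returnProb μ n - returnProb μ (n + 1)) ≤ C * ε * (A * (v M)⁻¹) := by
        rw [← mul_assoc C ε, mul_assoc (C * ε)]
        exact mul_le_mul_of_nonneg_left (h2.trans h3) (by positivity)
      have hA1 : 2 * D * D' ≤ A := le_max_left _ _
      have hCε : C * ε * D = 1 / 2 := by rw [hεdef]; field_simp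
      calc returnProb μ n ≤ C * ε * (A * (v M)⁻¹) + D' * (v M)⁻¹ := by linarith
        _ = (C * ε * A + D') * (v M)⁻¹ := by ring
        _ ≤ (C * ε * A + D') * (D * (v n)⁻¹) := by gcongr
        _ = (C * ε * D * A + D * D') * (v n)⁻¹ := by ring
        _ ≤ A * (v n)⁻¹ := by
          have := hvpos n
          gcongr
          rw [hCε]; linarith

/-- The tail bound holds at all scales. -/
lemma exists_tail_le (h : IsStableLike N μ β) : ∃ C : ℝ, 0 < C ∧ ∀ r, 0 < r →
    mean μ (Set.indicator {g | r < N g} 1) ≤ ENNReal.ofReal (C / r ^ β) := by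
  obtain ⟨C, hC, H⟩ := h.tail
  obtain ⟨r₀, hr₀⟩ := eventually_atTop.1 H
  refine ⟨max C (max r₀ 0 ^ β), lt_max_of_lt_left hC, fun r hr => ?_⟩
  have hp := h.pos
  have hrβ : 0 < r ^ β := by positivity
  rcases le_or_gt r₀ r with h1 | h1
  · refine (hr₀ r h1).trans (ENNReal.ofReal_le_ofReal ?_)
    gcongr
    exact le_max_left _ _
  · have h2 : mean μ (Set.indicator {g | r < N g} 1) ≤ 1 := by
      rw [← mean_const μ 1]
      refine mean_mono fun g => ?_
      exact Set.indicator_le_self' (by simp) g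
    refine h2.trans ?_
    rw [ENNReal.one_le_ofReal, one_le_div hrβ]
    refine le_trans ?_ (le_max_right _ _)
    gcongr
    exact h1.le.trans (le_max_left _ _)

/-- Dyadic decomposition of the range of `N` below `r`. The shell at scale `ρ` contributes of order
`ρ ^ (2 - β)`, a convergent geometric series because `β < 2`. -/
lemma exists_truncated_moment_le (h : IsStableLike N μ β) : ∃ C : ℝ, 0 < C ∧ ∀ r, 0 < r →
    mean μ (fun g => ENNReal.ofReal (min (N g) r ^ 2)) ≤ ENNReal.ofReal (C * r ^ (2 - β)) := by
  obtain ⟨C, hC, H⟩ := h.exists_tail_le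
  have hp := h.pos
  have hp2 := h.lt_two
  set q : ℝ := (1 / 2) ^ (2 - β) with hq
  have hq0 : 0 < q := by positivity
  have hq1 : q < 1 := Real.rpow_lt_one (by norm_num) (by norm_num) (by linarith)
  refine ⟨C * 2 ^ β * (1 - q)⁻¹, by have : 0 < 1 - q := by linarith
                                    positivity, fun r hr => ?_⟩
  set ρ : ℕ → ℝ := fun j => r * (1 / 2) ^ j with hρ
  have hρ0 : ∀ j, 0 < ρ j := fun j => by positivity
  have h1 : ∀ g, ENNReal.ofReal (min (N g) r ^ 2) ≤
      ∑' j, ENNReal.ofReal (ρ j ^ 2) * Set.indicator {g | ρ (j + 1) < N g} 1 g := by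
    intro g
    rcases (h.norm.nonneg g).eq_or_lt with h0 | h0
    · rw [← h0, min_eq_left hr.le]; simp
    · have hmin : 0 < min (N g) r / r := by positivity
      obtain ⟨j, hj1, hj2⟩ := exists_nat_pow_near_of_lt_one hmin
        ((div_le_one hr).2 (min_le_right _ _)) (by norm_num : (0 : ℝ) < 1 / 2) (by norm_num)
      rw [lt_div_iff₀ hr] at hj1
      rw [div_le_iff₀ hr] at hj2
      refine le_trans ?_ (ENNReal.le_tsum j)
      have hm : g ∈ {g | ρ (j + 1) < N g} := by
        change r * (1 / 2) ^ (j + 1) < N g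
        have := min_le_left (N g) r
        linarith
      rw [Set.indicator_of_mem hm, Pi.one_apply, mul_one]
      refine ENNReal.ofReal_le_ofReal ?_
      have hnn : 0 ≤ min (N g) r := le_min h0.le hr.le
      gcongr
      change _ ≤ r * (1 / 2) ^ j
      linarith
  have h2 : ∀ j, ρ j ^ 2 * (C / ρ (j + 1) ^ β) = C * 2 ^ β * r ^ (2 - β) * q ^ j := by
    intro j
    have e1 : ρ (j + 1) = ρ j / 2 := by simp only [hρ]; ring
    have e2 : q ^ j = ((1 / 2 : ℝ) ^ j) ^ (2 - β) := by
      rw [hq, ← Real.rpow_natCast, ← Real.rpow_natCast, ← Real.rpow_mul (by norm_num),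
        ← Real.rpow_mul (by norm_num), mul_comm]
    have e3 : r ^ (2 - β) * q ^ j = ρ j ^ (2 - β) := by
      rw [e2, ← Real.mul_rpow hr.le (by positivity)]
    rw [e1, Real.div_rpow (hρ0 j).le (by norm_num), mul_assoc (C * 2 ^ β), e3,
      Real.rpow_sub (hρ0 j)]
    have : 0 < ρ j ^ β := Real.rpow_pos_of_pos (hρ0 j) _
    norm_cast
    field_simp
  calc mean μ (fun g => ENNReal.ofReal (min (N g) r ^ 2))
      ≤ mean μ (fun g => ∑' j, ENNReal.ofReal (ρ j ^ 2) *
          Set.indicator {g | ρ (j + 1) < N g} 1 g) := mean_mono h1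
    _ = ∑' j, ENNReal.ofReal (ρ j ^ 2) * mean μ (Set.indicator {g | ρ (j + 1) < N g} 1) := by
        simp only [mean, ← ENNReal.tsum_mul_left]
        rw [ENNReal.tsum_comm]
        congr 1; ext j; congr 1; ext g
        ring
    _ ≤ ∑' j, ENNReal.ofReal (C * 2 ^ β * r ^ (2 - β) * q ^ j) := by
        refine ENNReal.tsum_le_tsum fun j => ?_
        rw [← h2 j, ENNReal.ofReal_mul (by positivity)]
        gcongr
        exact H _ (hρ0 _)
    _ = ENNReal.ofReal (C * 2 ^ β * (1 - q)⁻¹ * r ^ (2 - β)) := by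
        rw [← ENNReal.ofReal_tsum_of_nonneg (fun j => by positivity)
          ((summable_geometric_of_lt_one hq0.le hq1).mul_left _), tsum_mul_left,
          tsum_geometric_of_lt_one hq0.le hq1]
        congr 1; ring

end IsStableLike

end HeatKernel

end

noncomputable section

/-! ### Escape estimates and lower bounds near the diagonal. -/

section Escape

variable {G : Type*}

lemma mean_ofReal_eq {ν : PMF G} {φ : G → ℝ} {S : ℝ} (h0 : ∀ g, 0 ≤ φ g)
    (h : HasSum (fun g => (ν g).toReal * φ g) S) :
    mean ν (fun g => ENNReal.ofReal (φ g)) = ENNReal.ofReal S := by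
  rw [← h.tsum_eq, ENNReal.ofReal_tsum_of_nonneg
    (fun g => mul_nonneg ENNReal.toReal_nonneg (h0 g)) h.summable, mean]
  congr 1; ext g
  rw [ENNReal.ofReal_mul ENNReal.toReal_nonneg, ENNReal.ofReal_toReal (ν.apply_ne_top g)]

lemma mean_indicator_add_compl (ν : PMF G) (A : Set G) :
    mean ν (A.indicator 1) + mean ν (Aᶜ.indicator 1) = 1 := by
  rw [← mean_add, ← mean_const ν 1]
  congr 1; ext g
  by_cases hg : g ∈ A <;> simp [hg]

lemma mean_indicator_finset (ν : PMF G) (s : Finset G) :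
    mean ν ((s : Set G).indicator 1) = ENNReal.ofReal (∑ g ∈ s, (ν g).toReal) := by
  rw [mean, tsum_eq_sum (s := s) (fun g hg => by simp [hg]),
    ENNReal.ofReal_sum_of_nonneg fun _ _ => ENNReal.toReal_nonneg]
  refine Finset.sum_congr rfl fun g hg => ?_
  rw [ENNReal.ofReal_toReal (ν.apply_ne_top g), Set.indicator_of_mem (by simpa using hg)]
  simp

variable [Group G] {N : G → ℝ} {μ : PMF G} {β : ℝ}

open scoped RealInnerProductSpace

namespace IsStableLike

/-- The function `x ↦ (r - N x)₊`. -/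
def tent (h : IsStableLike N μ β) (r : ℝ) : EllTwo G :=
  ⟨fun x => max (r - N x) 0, memℓp_gen (summable_of_hasFiniteSupport ((h.finite_ball r).subset (by
    intro x hx
    by_contra hr
    have : r - N x ≤ 0 := by
      have : ¬ N x ≤ r := hr
      linarith
    simp [max_eq_right this] at hx)))⟩

@[simp] lemma tent_apply (h : IsStableLike N μ β) (r : ℝ) (x : G) :
    h.tent r x = max (r - N x) 0 := rfl

lemma hasSum_indicator_ball (h : IsStableLike N μ β) (r : ℝ) :
    HasSum (fun x => Set.indicator {g | N g ≤ r} (1 : G → ℝ) x) (volumeFun N r) := by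
  have h1 : HasSum (fun x => Set.indicator {g | N g ≤ r} (1 : G → ℝ) x)
      (∑ x ∈ (h.finite_ball r).toFinset, Set.indicator {g | N g ≤ r} (1 : G → ℝ) x) :=
    hasSum_sum_of_ne_finset_zero (fun x hx => by
      have : ¬ N x ≤ r := by simpa using hx
      simp [this])
  rw [Finset.sum_congr rfl (g := fun _ => (1 : ℝ))] at h1
  · simpa [volumeFun_eq_card (h.finite_ball r)] using h1
  · intro x hx
    have : N x ≤ r := by simpa using hx
    simp [this]

lemma abs_tent_sub_le (h : IsStableLike N μ β) {r : ℝ} (hr : 0 ≤ r) (x g : G) :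
    |h.tent r x - h.tent r (x * g)| ≤ min (N g) r := by
  have h1 := h.norm.mul_le x g
  have h2 := h.norm.mul_le (x * g) g⁻¹
  rw [mul_inv_cancel_right, h.inv] at h2
  have h3 := h.norm.nonneg x
  have h4 := h.norm.nonneg (x * g)
  have h5 := h.norm.nonneg g
  simp only [tent_apply]
  rw [abs_le]
  rcases max_cases (r - N x) 0 with ⟨e1, _⟩ | ⟨e1, _⟩ <;>
  rcases max_cases (r - N (x * g)) 0 with ⟨e2, _⟩ | ⟨e2, _⟩ <;>
  rcases min_cases (N g) r with ⟨e3, _⟩ | ⟨e3, _⟩ <;> rw [e1, e2, e3] <;> constructor <;> linarith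

lemma norm_tent_sub_le (h : IsStableLike N μ β) {r : ℝ} (hr : 0 ≤ r) (g : G) :
    ‖h.tent r - rightTrans g (h.tent r)‖ ^ 2 ≤ 2 * volumeFun N r * min (N g) r ^ 2 := by
  have h1 := EllTwo.hasSum_norm_sq (h.tent r - rightTrans g (h.tent r))
  have h2 := h.hasSum_indicator_ball r
  have h3 := ((h2.add ((Equiv.mulRight g).hasSum_iff.2 h2)).mul_left (min (N g) r ^ 2))
  have h4 := hasSum_le (fun x => ?_) h1 h3
  · linarith
  · change (h.tent r x - h.tent r (x * g)) ^ 2 ≤ min (N g) r ^ 2 *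
      (Set.indicator {g | N g ≤ r} (1 : G → ℝ) x + Set.indicator {g | N g ≤ r} (1 : G → ℝ) (x * g))
    have hs : (h.tent r x - h.tent r (x * g)) ^ 2 ≤ min (N g) r ^ 2 :=
      sq_le_sq' (by linarith [(abs_le.1 (h.abs_tent_sub_le hr x g)).1])
        (abs_le.1 (h.abs_tent_sub_le hr x g)).2
    by_cases hx : N x ≤ r
    · have : (0 : ℝ) ≤ Set.indicator {g | N g ≤ r} (1 : G → ℝ) (x * g) :=
        Set.indicator_nonneg (by simp) _
      rw [Set.indicator_of_mem (show x ∈ {g | N g ≤ r} from hx), Pi.one_apply]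
      nlinarith [sq_nonneg (min (N g) r)]
    by_cases hy : N (x * g) ≤ r
    · have : (0 : ℝ) ≤ Set.indicator {g | N g ≤ r} (1 : G → ℝ) x :=
        Set.indicator_nonneg (by simp) _
      rw [Set.indicator_of_mem (show x * g ∈ {g | N g ≤ r} from hy), Pi.one_apply]
      nlinarith [sq_nonneg (min (N g) r)]
    rw [tent_apply, tent_apply, max_eq_right (by linarith), max_eq_right (by linarith)]
    simp [hx, hy]

/-- On the ball of radius `r / 2` the tent is at least `r / 2`, while translation by such a `g`
moves that ball outside the support. -/
lemma le_norm_tent_sub (h : IsStableLike N μ β) {r : ℝ} (hr : 0 ≤ r) {g : G} (hg : 2 * r ≤ N g) :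
    volumeFun N (r / 2) * (r / 2) ^ 2 ≤ ‖h.tent r - rightTrans g (h.tent r)‖ ^ 2 := by
  have h1 := EllTwo.hasSum_norm_sq (h.tent r - rightTrans g (h.tent r))
  have h2 := sum_le_hasSum (h.finite_ball (r / 2)).toFinset (fun x _ => sq_nonneg _) h1
  refine le_trans ?_ h2
  rw [volumeFun_eq_card (h.finite_ball (r / 2)), ← nsmul_eq_mul]
  refine Finset.card_nsmul_le_sum _ _ _ fun x hx => ?_
  have hx : N x ≤ r / 2 := by simpa using hx
  change _ ≤ (h.tent r x - h.tent r (x * g)) ^ 2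
  have h3 := h.norm.mul_le x⁻¹ (x * g)
  rw [inv_mul_cancel_left, h.inv] at h3
  rw [tent_apply, tent_apply, max_eq_right (show r - N (x * g) ≤ 0 by linarith),
    max_eq_left (by linarith)]
  gcongr
  linarith

/-- A Markov inequality for the energy of a tent. Its energy under `μ^(n)` is at most `n` times that
under `μ`, which the truncated second moment bounds, and every `g` with `N g ≥ r` contributes at
least `a` to it. Doubling compares the two volumes involved. -/
theorem exists_escape_le (h : IsStableLike N μ β) : ∃ C : ℝ, 0 < C ∧ ∀ (n : ℕ) (r : ℝ), 0 < r →
    mean (convPow μ n) (Set.indicator {g | r ≤ N g} 1) ≤ ENNReal.ofReal (C * n / r ^ β) := by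
  obtain ⟨C, hC, H⟩ := h.exists_truncated_moment_le
  obtain ⟨D, hD, HD⟩ := h.doubling 2
  refine ⟨32 * D * C, by positivity, fun n r hr => ?_⟩
  set f := h.tent (r / 2) with hf
  set a : ℝ := volumeFun N (r / 4) * (r / 4) ^ 2 with ha
  set b : ℝ := 2 * volumeFun N (r / 2) * (C * (r / 2) ^ (2 - β)) with hb
  have ha0 : 0 < a := by have := h.volumeFun_pos (a := r / 4) (by positivity); positivity
  have h1 : ENNReal.ofReal (2 * (‖f‖ ^ 2 - ⟪markovOp μ f, f⟫)) ≤ ENNReal.ofReal b := by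
    rw [← mean_ofReal_eq (fun g => by positivity) (hasSum_energy μ f)]
    calc _ ≤ mean μ (fun g => ENNReal.ofReal (2 * volumeFun N (r / 2)) *
            ENNReal.ofReal (min (N g) (r / 2) ^ 2)) := by
          refine mean_mono fun g => ?_
          rw [← ENNReal.ofReal_mul (by positivity)]
          exact ENNReal.ofReal_le_ofReal (h.norm_tent_sub_le (by positivity) g)
      _ ≤ _ := by
          rw [mean_const_mul, hb, ENNReal.ofReal_mul (p := 2 * (volumeFun N (r / 2) : ℝ)) (by positivity)]
          gcongr
          exact H _ (by positivity)
  have hb0 : 0 ≤ b := by positivity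
  have h1' := (ENNReal.ofReal_le_ofReal_iff hb0).1 h1
  have h2 : 2 * (‖f‖ ^ 2 - ⟪markovOp (convPow μ n) f, f⟫) ≤ n * b := by
    have := norm_sq_sub_inner_pow_le (inner_markovOp h.symm) (norm_markovOp_apply_le μ) f n
    rw [markovOp_convPow]
    have h3 : (n : ℝ) * (2 * (‖f‖ ^ 2 - ⟪markovOp μ f, f⟫)) ≤ n * b := by gcongr
    linarith
  have h3 : ENNReal.ofReal a * mean (convPow μ n) (Set.indicator {g | r ≤ N g} 1) ≤
      ENNReal.ofReal (n * b) := by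
    rw [← mean_const_mul]
    refine le_trans (mean_mono fun g => ?_) ((mean_ofReal_eq (fun g => by positivity)
      (hasSum_energy (convPow μ n) f)).le.trans (ENNReal.ofReal_le_ofReal h2))
    by_cases hg : r ≤ N g
    · rw [Set.indicator_of_mem (show g ∈ {g | r ≤ N g} from hg), Pi.one_apply, mul_one]
      refine ENNReal.ofReal_le_ofReal ?_
      have := h.le_norm_tent_sub (r := r / 2) (g := g) (by positivity) (by linarith)
      rwa [div_div, show (2 : ℝ) * 2 = 4 by norm_num] at this
    · simp [hg]
  have h4 : n * b ≤ a * (32 * D * C * n / r ^ β) := by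
    have e1 := HD (r / 4) (by positivity)
    rw [show 2 * (r / 4) = r / 2 by ring] at e1
    have e2 : (r / 2) ^ (2 - β) ≤ r ^ 2 / r ^ β := by
      have : r ^ 2 / r ^ β = r ^ (2 - β) := by rw [Real.rpow_sub hr]; norm_cast
      rw [this]
      have := h.lt_two
      gcongr
      linarith
    calc n * b ≤ n * (2 * (D * volumeFun N (r / 4)) * (C * (r ^ 2 / r ^ β))) := by
          rw [hb]; gcongr
      _ = _ := by rw [ha]; ring
  have h5 := h3.trans (ENNReal.ofReal_le_ofReal h4)
  rw [ENNReal.ofReal_mul ha0.le] at h5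
  exact (ENNReal.mul_le_mul_iff_right (ENNReal.ofReal_pos.2 ha0).ne' ENNReal.ofReal_ne_top).1 h5

/-- At least half of the mass of `μ^(n)` lies in a ball of radius comparable to `n ^ (1 / β)`;
Cauchy–Schwarz bounds its squared mass by the volume times the squared norm of the density, which is
the return probability. -/
lemma exists_le_returnProb (h : IsStableLike N μ β) : ∃ c : ℝ, 0 < c ∧ ∀ n : ℕ, 1 ≤ n →
    c * (volumeFun N ((n : ℝ) ^ (1 / β)) : ℝ)⁻¹ ≤ returnProb μ n := by
  obtain ⟨C, hC, H⟩ := h.exists_escape_le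
  obtain ⟨D, hD, HD⟩ := h.exists_volumeFun_scale_le (ε := 2 * C) (by positivity)
  refine ⟨1 / (4 * D), by positivity, fun n hn => ?_⟩
  have hn0 : (0 : ℝ) < n := by exact_mod_cast hn
  set r : ℝ := (2 * C * n) ^ (1 / β) with hr
  have hr0 : 0 < r := by positivity
  have h1 := H n r hr0
  rw [hr, h.scale_rpow (by positivity), ← hr] at h1
  have h2 : C * n / (2 * C * n) = 1 / 2 := by field_simp
  rw [h2] at h1
  set s := (h.finite_ball r).toFinset
  have h3 : 1 / 2 ≤ ∑ g ∈ s, (convPow μ n g).toReal := by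
    have h4 := mean_indicator_add_compl (convPow μ n) (s : Set G)
    have h5 : mean (convPow μ n) ((s : Set G)ᶜ.indicator 1) ≤ ENNReal.ofReal (1 / 2) := by
      refine le_trans (mean_mono fun g => ?_) h1
      refine Set.indicator_le_indicator_of_subset ?_ (by simp) g
      intro x hx
      have : ¬ N x ≤ r := by simpa [s] using hx
      exact (not_le.1 this).le
    rw [mean_indicator_finset] at h4
    have h6 : (1 : ℝ≥0∞) ≤ ENNReal.ofReal (∑ g ∈ s, (convPow μ n g).toReal + 1 / 2) := by
      rw [ENNReal.ofReal_add (Finset.sum_nonneg fun _ _ => ENNReal.toReal_nonneg) (by norm_num),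
        ← h4]
      gcongr
    rw [ENNReal.one_le_ofReal] at h6
    linarith
  have h4 : (∑ g ∈ s, (convPow μ n g).toReal) ^ 2 ≤ volumeFun N r * returnProb μ n := by
    rw [volumeFun_eq_card (h.finite_ball r), ← norm_density_convPow h.symm]
    refine sq_sum_le_card_mul_sum_sq.trans ?_
    gcongr
    exact sum_le_hasSum s (fun _ _ => sq_nonneg _) (EllTwo.hasSum_norm_sq (density (convPow μ n)))
  have h5 := HD n hn0
  have hv : 0 < (volumeFun N ((n : ℝ) ^ (1 / β)) : ℝ) := h.volumeFun_pos (by positivity)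
  have h6 : (volumeFun N r : ℝ) * returnProb μ n ≤
      D * volumeFun N ((n : ℝ) ^ (1 / β)) * returnProb μ n := by
    gcongr
    exact returnProb_nonneg _ _
  have h7 : (1 / 2 : ℝ) ^ 2 ≤ (∑ g ∈ s, (convPow μ n g).toReal) ^ 2 := by gcongr
  rw [← div_eq_mul_inv, div_le_iff₀ hv, div_le_iff₀ (by positivity)]
  linarith

/-- Near-diagonal lower bound. -/
theorem exists_le_convPow_near (h : IsStableLike N μ β) : ∃ c η : ℝ, 0 < c ∧ 0 < η ∧ ∃ n₀ : ℕ,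
    ∀ n : ℕ, n₀ ≤ n → ∀ y, N y ≤ η * (n : ℝ) ^ (1 / β) →
      c * (volumeFun N ((n : ℝ) ^ (1 / β)) : ℝ)⁻¹ ≤ (convPow μ (2 * n) y).toReal := by
  obtain ⟨C, hC, H⟩ := h.exists_near_diag
  obtain ⟨c, hc, Hc⟩ := h.exists_le_returnProb
  obtain ⟨A, hA, HA⟩ := h.exists_returnProb_le
  obtain ⟨D, hD, HD⟩ := h.exists_volumeFun_scale_le (ε := 3) (by norm_num)
  have hp := h.pos
  -- Chosen so that the drop from the diagonal is at most half of the diagonal lower bound; the `6`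
  -- is `2 * 3`, the `3` coming from `n ≤ 3 * (n / 2)` with integer division.
  set ε : ℝ := c / (6 * C * A * D) with hεdef
  have hε : 0 < ε := by positivity
  obtain ⟨N₀, hN₀⟩ := eventually_atTop.1 ((h.tendsto_scale hε).eventually H)
  refine ⟨c / 2, ε ^ (1 / β), by positivity, by positivity, N₀ + 2, fun n hn y hy => ?_⟩
  have hn0 : (0 : ℝ) < n := by exact_mod_cast (by omega : 0 < n)
  rw [← Real.mul_rpow hε.le hn0.le] at hy
  have h1 := hN₀ n (by omega) y hy n
  rw [h.scale_rpow (by positivity)] at h1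
  set M := n / 2 with hM
  have hM0 : (0 : ℝ) < M := by exact_mod_cast (by omega : 0 < M)
  have h3M : (n : ℝ) ≤ 3 * M := by exact_mod_cast (by omega : n ≤ 3 * M)
  have h2 := mul_returnProb_sub_le h.symm (M := M) (n := n) (by omega)
  have h3 := HA M (by omega)
  have hv : 0 < (volumeFun N ((n : ℝ) ^ (1 / β)) : ℝ) := h.volumeFun_pos (by positivity)
  have hv' : 0 < (volumeFun N ((M : ℝ) ^ (1 / β)) : ℝ) := h.volumeFun_pos (by positivity)
  have h5 : (volumeFun N ((n : ℝ) ^ (1 / β)) : ℝ) ≤ D * volumeFun N ((M : ℝ) ^ (1 / β)) := by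
    refine le_trans (h.volumeFun_mono ?_) (HD M hM0)
    gcongr
  have h6 : (volumeFun N ((M : ℝ) ^ (1 / β)) : ℝ)⁻¹ ≤
      D * (volumeFun N ((n : ℝ) ^ (1 / β)) : ℝ)⁻¹ := by
    rw [inv_le_comm₀ hv' (by positivity), mul_inv, inv_inv, inv_mul_le_iff₀ hD]
    exact h5
  have hd : 0 ≤ returnProb μ n - returnProb μ (n + 1) := by
    linarith [returnProb_succ_le h.symm n]
  have h7 : n * (returnProb μ n - returnProb μ (n + 1)) ≤
      3 * (A * (D * (volumeFun N ((n : ℝ) ^ (1 / β)) : ℝ)⁻¹)) := by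
    calc n * (returnProb μ n - returnProb μ (n + 1))
        ≤ 3 * M * (returnProb μ n - returnProb μ (n + 1)) := by gcongr
      _ = 3 * (M * (returnProb μ n - returnProb μ (n + 1))) := by ring
      _ ≤ _ := by
        exact mul_le_mul_of_nonneg_left ((h2.trans h3).trans (by gcongr)) (by norm_num)
  have h8 : C * (ε * n) * (returnProb μ n - returnProb μ (n + 1)) ≤
      c / 2 * (volumeFun N ((n : ℝ) ^ (1 / β)) : ℝ)⁻¹ := by
    calc _ = C * ε * (n * (returnProb μ n - returnProb μ (n + 1))) := by ring
      _ ≤ C * ε * (3 * (A * (D * (volumeFun N ((n : ℝ) ^ (1 / β)) : ℝ)⁻¹))) := by gcongr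
      _ = _ := by rw [hεdef]; field_simp; norm_num
  have h9 := Hc n (by omega)
  linarith

end IsStableLike

end Escape

end

noncomputable section

/-! ### Killed walks, one distinguished jump, and the law of the path. -/

section Killed

variable {G : Type*}

/-- Prepending an increment. -/
def consIncr (p : G × (ℕ → G)) : ℕ → G
  | 0 => p.1
  | i + 1 => p.2 i

lemma measurable_consIncr [MeasurableSpace G] : Measurable (consIncr (G := G)) := by
  refine measurable_pi_lambda _ fun i => ?_
  cases i with
  | zero => exact measurable_fst
  | succ i => exact (measurable_pi_apply i).comp measurable_snd

variable [Group G] {μ : PMF G} {ω lam : G → ℝ≥0∞} {A B : Set G}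

/-- The probability that the walk started at `z` is in `A` at time `n`. -/
def hitProb (μ : PMF G) (A : Set G) (n : ℕ) (z : G) : ℝ≥0∞ :=
  mean (convPow μ n) fun g => A.indicator 1 (z * g)

/-- The weight of the paths `z, zg₁, zg₁g₂, …` of length `n` within `B` which end in `A`, with steps
weighted by `ω`. -/
def killed (ω : G → ℝ≥0∞) (B A : Set G) : ℕ → G → ℝ≥0∞
  | 0 => (A ∩ B).indicator 1
  | n + 1 => B.indicator fun z => ∑' g, ω g * killed ω B A n (z * g)

lemma hitProb_zero (z : G) : hitProb μ A 0 z = A.indicator 1 z := by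
  rw [hitProb, convPow_zero, mean_pure, mul_one]

lemma hitProb_add (m n : ℕ) (z : G) :
    hitProb μ A (m + n) z = mean (convPow μ m) fun g => hitProb μ A n (z * g) := by
  simp only [hitProb, convPow_add, mean_conv, mul_assoc]

lemma hitProb_succ (n : ℕ) (z : G) :
    hitProb μ A (n + 1) z = ∑' g, μ g * hitProb μ A n (z * g) := by
  rw [add_comm, hitProb_add, convPow_one, mean]

lemma hitProb_le_one (n : ℕ) (z : G) : hitProb μ A n z ≤ 1 := by
  rw [← mean_const (convPow μ n) 1]
  exact mean_mono fun g => Set.indicator_le_self' (by simp) _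

lemma hitProb_singleton (n : ℕ) (z y : G) : hitProb μ {y} n z = convPow μ n (z⁻¹ * y) := by
  rw [hitProb, ← mean_indicator_singleton]
  congr 1; ext g
  by_cases hg : g = z⁻¹ * y
  · subst hg; simp
  · have : z * g ≠ y := fun h => hg (by rw [← h]; group)
    simp [hg, this]

lemma mul_le_hitProb_add {q : ℝ≥0∞} {m n : ℕ} (h : ∀ y ∈ B, q ≤ hitProb μ A n y) (z : G) :
    q * hitProb μ B m z ≤ hitProb μ A (m + n) z := by
  rw [hitProb_add, hitProb, ← mean_const_mul]
  refine mean_mono fun g => ?_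
  by_cases hg : z * g ∈ B
  · simpa [hg] using h _ hg
  · simp [hg]

lemma hitProb_eq_finset (s : Finset G) (n : ℕ) (z : G) :
    hitProb μ s n z = ∑ y ∈ s, convPow μ n (z⁻¹ * y) := by
  classical
  simp only [← hitProb_singleton]
  simp only [hitProb, mean]
  rw [← Summable.tsum_finsetSum fun _ _ => ENNReal.summable]
  congr 1; ext g
  rw [← Finset.mul_sum]
  congr 1
  simp [Set.indicator_apply]

/-- A step distribution split as `ω + λ`: up to exits from `B` and `λ`-steps, the walk follows the
killed kernel. -/
lemma hitProb_le_killed_add (hμ : ∀ g, μ g = ω g + lam g) {ε : ℝ≥0∞} {n : ℕ}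
    (hε : ∀ z ∉ B, ∀ i ≤ n, hitProb μ A i z ≤ ε) {j : ℕ} (hj : j ≤ n) (z : G) :
    hitProb μ A j z ≤ killed ω B A j z + ε + j * ∑' g, lam g := by
  have hω : ∑' g, ω g ≤ 1 := by
    rw [← μ.tsum_coe]
    exact ENNReal.tsum_le_tsum fun g => by rw [hμ g]; exact le_self_add
  induction j generalizing z with
  | zero =>
    by_cases hz : z ∈ B
    · refine le_add_right (le_add_right ?_)
      rw [hitProb_zero]
      by_cases hA : z ∈ A <;> simp [killed, hz, hA]
    · exact le_add_right (le_add_left (hε z hz 0 hj))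
  | succ j ih =>
    by_cases hz : z ∈ B
    · rw [hitProb_succ]
      calc ∑' g, μ g * hitProb μ A j (z * g)
          ≤ ∑' g, (ω g * (killed ω B A j (z * g) + ε + j * ∑' g, lam g) + lam g) := by
            refine ENNReal.tsum_le_tsum fun g => ?_
            rw [hμ g, add_mul]
            gcongr
            · exact ih (by omega) _
            · exact mul_le_of_le_one_right' (hitProb_le_one _ _)
        _ = ∑' g, ω g * killed ω B A j (z * g) + (∑' g, ω g) * (ε + j * ∑' g, lam g) +
              ∑' g, lam g := by
            rw [← ENNReal.tsum_mul_right, ← ENNReal.tsum_add, ← ENNReal.tsum_add]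
            exact tsum_congr fun g => by rw [add_assoc, mul_add]
        _ ≤ ∑' g, ω g * killed ω B A j (z * g) + 1 * (ε + j * ∑' g, lam g) + ∑' g, lam g := by
            gcongr
        _ = killed ω B A (j + 1) z + ε + ((j + 1 : ℕ) : ℝ≥0∞) * ∑' g, lam g := by
            simp only [killed, Set.indicator_of_mem hz]
            push_cast
            ring
    · exact le_add_right (le_add_left (hε z hz _ hj))

/-- If `λ`-steps from `B` lead to points from where `A'` is reached with probability `q`, then `A'`
is reached with at least the probability of a single `λ`-step. -/
lemma mul_sum_killed_le_hitProb {A' : Set G} (hμ : ∀ g, μ g = ω g + lam g) {q : ℝ≥0∞} {t : ℕ}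
    (hjump : ∀ j < t, ∀ y ∈ B, ∀ g, lam g ≠ 0 → q ≤ hitProb μ A' j (y * g)) (z : G) :
    q * (∑' g, lam g) * ∑ j ∈ Finset.range t, killed ω B A j z ≤ hitProb μ A' t z := by
  induction t generalizing z with
  | zero => simp
  | succ t ih =>
    by_cases hz : z ∈ B
    · rw [Finset.sum_range_succ', hitProb_succ, mul_add]
      have h1 : q * (∑' g, lam g) * ∑ j ∈ Finset.range t, killed ω B A (j + 1) z ≤
          ∑' g, ω g * hitProb μ A' t (z * g) := by
        simp only [killed, Set.indicator_of_mem hz]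
        rw [← Summable.tsum_finsetSum fun _ _ => ENNReal.summable, ← ENNReal.tsum_mul_left]
        refine ENNReal.tsum_le_tsum fun g => ?_
        rw [← Finset.mul_sum, mul_left_comm]
        gcongr
        exact ih (fun j hj => hjump j (by omega)) _
      have h2 : q * (∑' g, lam g) * killed ω B A 0 z ≤ ∑' g, lam g * hitProb μ A' t (z * g) := by
        have h3 : killed ω B A 0 z ≤ 1 := Set.indicator_le_self' (by simp) _
        calc q * (∑' g, lam g) * killed ω B A 0 z ≤ q * (∑' g, lam g) * 1 := by gcongr
          _ = ∑' g, lam g * q := by rw [mul_one, ENNReal.tsum_mul_right, mul_comm]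
          _ ≤ _ := by
            refine ENNReal.tsum_le_tsum fun g => ?_
            by_cases hg : lam g = 0
            · simp [hg]
            · gcongr
              exact hjump t (by omega) z hz g hg
      calc _ ≤ ∑' g, ω g * hitProb μ A' t (z * g) + ∑' g, lam g * hitProb μ A' t (z * g) :=
            add_le_add h1 h2
        _ = _ := by
            rw [← ENNReal.tsum_add]
            congr 1; ext g
            rw [hμ g, add_mul]
    · have : ∀ j, killed ω B A j z = 0 := by
        rintro (_ | j) <;> simp [killed, hz]
      simp [this]

/-- The weight of the constant path; it takes care of the bounded range of times where the
asymptotic estimates do not apply. -/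
lemma pow_le_killed {x : G} (hA : x ∈ A) (hB : x ∈ B) (n : ℕ) : ω 1 ^ n ≤ killed ω B A n x := by
  induction n with
  | zero => simp [killed, hA, hB]
  | succ n ih =>
    simp only [killed, Set.indicator_of_mem hB]
    refine le_trans ?_ (ENNReal.le_tsum 1)
    rw [mul_one, pow_succ, mul_comm]
    gcongr

lemma walk_succ (x : G) (ξ : ℕ → G) (j : ℕ) :
    walk x ξ (j + 1) = walk (x * ξ 0) (fun i => ξ (i + 1)) j := by
  induction j with
  | zero => rfl
  | succ j ih => rw [walk, ih]; rfl

/-- The event that the walk stays in `B` up to time `n` and ends in `A`. -/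
def stayEvent (B A : Set G) (n : ℕ) (x : G) : Set (ℕ → G) :=
  {ξ | (∀ j ≤ n, walk x ξ j ∈ B) ∧ walk x ξ n ∈ A}

lemma mem_stayEvent_succ {n : ℕ} {x : G} {ξ : ℕ → G} : ξ ∈ stayEvent B A (n + 1) x ↔
    x ∈ B ∧ (fun i => ξ (i + 1)) ∈ stayEvent B A n (x * ξ 0) := by
  simp only [stayEvent, Set.mem_ofPred_eq, ← walk_succ, ← and_assoc]
  refine and_congr_left fun _ => ⟨fun h => ⟨h 0 (by omega), fun j hj => h _ (by omega)⟩, ?_⟩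
  rintro ⟨h0, h1⟩ (_ | j) hj
  · exact h0
  · exact h1 j (by omega)

section Measure

variable [MeasurableSpace G]

/-- The first increment is independent of the later ones. -/
lemma infinitePi_eq_map_consIncr (ν : Measure G) [IsProbabilityMeasure ν] :
    (ν.prod (Measure.infinitePi fun _ : ℕ => ν)).map consIncr =
      Measure.infinitePi fun _ : ℕ => ν := by
  have key : ∀ (n : ℕ) (t : ℕ → Set G), (∀ i, MeasurableSet (t i)) →
      (ν.prod (Measure.infinitePi fun _ : ℕ => ν)).map consIncr
        (Set.pi (Finset.range (n + 1)) t) = ∏ i ∈ Finset.range (n + 1), ν (t i) := by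
    intro n t ht
    rw [Measure.map_apply measurable_consIncr
      (MeasurableSet.pi (Finset.countable_toSet _) fun i _ => ht i)]
    have : consIncr ⁻¹' (Set.pi (Finset.range (n + 1)) t) =
        t 0 ×ˢ Set.pi (Finset.range n) (fun i => t (i + 1)) := by
      ext ⟨g, ξ⟩
      simp only [Set.mem_preimage, Set.mem_pi, Finset.coe_range, Set.mem_Iio, Set.mem_prod]
      refine ⟨fun h => ⟨h 0 (by omega), fun i hi => h (i + 1) (by omega)⟩, ?_⟩
      rintro ⟨h0, h1⟩ (_ | i) hi
      · exact h0
      · exact h1 i (by omega)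
    rw [this, Measure.prod_prod, Measure.infinitePi_pi _ (fun i _ => ht _), Finset.prod_range_succ',
      mul_comm]
  refine Measure.eq_infinitePi _ fun s t ht => ?_
  classical
  obtain ⟨n, hn⟩ := s.exists_nat_subset_range
  have hn' : s ⊆ Finset.range (n + 1) := hn.trans (Finset.range_mono (by omega))
  have h1 := key n (fun i => if i ∈ s then t i else Set.univ) (fun i => by
    by_cases hi : i ∈ s <;> simp [hi, ht])
  have h2 : Set.pi (Finset.range (n + 1)) (fun i => if i ∈ s then t i else Set.univ) =
      Set.pi s t := by
    ext ξ
    simp only [Set.mem_pi]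
    refine ⟨fun h i hi => ?_, fun h i _ => ?_⟩
    · have := h i (hn' hi)
      rwa [if_pos (by simpa using hi)] at this
    · by_cases hi : i ∈ s
      · rw [if_pos hi]; exact h i hi
      · rw [if_neg hi]; trivial
  rw [h2] at h1
  rw [h1, ← Finset.prod_subset hn' (fun i _ hi => by simp [hi])]
  exact Finset.prod_congr rfl fun i hi => by rw [if_pos hi]

variable [Countable G] [DiscreteMeasurableSpace G]

lemma measurable_walk (x : G) (n : ℕ) : Measurable fun ξ : ℕ → G => walk x ξ n := by
  induction n with
  | zero => exact measurable_const
  | succ n ih =>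
    exact (Measurable.of_discrete (f := fun p : G × G => p.1 * p.2)).comp
      (ih.prodMk (measurable_pi_apply n))

lemma measurableSet_stayEvent (n : ℕ) (x : G) : MeasurableSet (stayEvent B A n x) := by
  have : stayEvent B A n x = (⋂ j ∈ Set.Iic n, (fun ξ : ℕ → G => walk x ξ j) ⁻¹' B) ∩
      (fun ξ : ℕ → G => walk x ξ n) ⁻¹' A := by
    ext ξ; simp [stayEvent]
  rw [this]
  exact (MeasurableSet.biInter (Set.to_countable _) fun j _ =>
    measurable_walk x j (.of_discrete)).inter (measurable_walk x n (.of_discrete))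

lemma measure_stayEvent (n : ℕ) (x : G) :
    (Measure.infinitePi fun _ : ℕ => μ.toMeasure) (stayEvent B A n x) = killed μ B A n x := by
  induction n generalizing x with
  | zero =>
    have : stayEvent B A 0 x = {_ξ | x ∈ A ∩ B} := by
      ext ξ; simp [stayEvent, walk, and_comm]
    rw [this]
    by_cases hx : x ∈ A ∩ B <;> simp [killed, hx]
  | succ n ih =>
    rw [← infinitePi_eq_map_consIncr,
      Measure.map_apply measurable_consIncr (measurableSet_stayEvent _ _),
      Measure.prod_apply (measurable_consIncr (measurableSet_stayEvent _ _)), lintegral_countable']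
    by_cases hx : x ∈ B
    · simp only [killed, Set.indicator_of_mem hx]
      congr 1; ext g
      rw [μ.toMeasure_apply_singleton _ (.of_discrete), mul_comm, ← ih]
      congr 2; ext ξ
      simp [mem_stayEvent_succ, consIncr, hx]
    · have : ∀ g, Prod.mk g ⁻¹' (consIncr ⁻¹' (stayEvent B A (n + 1) x)) = ∅ := by
        intro g; ext ξ
        simp [mem_stayEvent_succ, hx]
      simp [this, killed, hx]

end Measure

lemma incrProb_stayEvent [Countable G] (n : ℕ) (x : G) :
    incrProb μ (stayEvent B A n x) = (killed μ B A n x).toReal := by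
  let _ : MeasurableSpace G := ⊤
  rw [← measure_stayEvent]
  rfl

end Killed

end

noncomputable section

/-! ### From heat kernel lower bounds to the path estimate. -/

section Path

variable {G : Type*} [Group G] {N : G → ℝ} {μ : PMF G} {β : ℝ}

lemma hitProb_one_le_hitProb {A A' : Set G} {z : G} (h : ∀ g ∈ A, z * g ∈ A') (n : ℕ) :
    hitProb μ A n 1 ≤ hitProb μ A' n z := by
  refine mean_mono fun g => ?_
  rw [one_mul]
  by_cases hg : g ∈ A
  · simp [hg, h g hg]
  · simp [hg]

/-- Lower bounds for the even convolution powers at every multiple of the scale `n ^ (1 / β)`. -/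
def HasLowerBound (N : G → ℝ) (μ : PMF G) (β : ℝ) : Prop :=
  ∀ κ : ℝ, 0 < κ → ∃ c : ℝ, 0 < c ∧ ∃ n₀ : ℕ, ∀ n : ℕ, n₀ ≤ n → ∀ g, N g ≤ κ * (n : ℝ) ^ (1 / β) →
    c * (volumeFun N ((n : ℝ) ^ (1 / β)) : ℝ)⁻¹ ≤ (convPow μ (2 * n) g).toReal

namespace IsStableLike

lemma countable (h : IsStableLike N μ β) : Countable G := by
  have : (Set.univ : Set G) = ⋃ n : ℕ, {g | N g ≤ n} := by
    ext g
    simpa using exists_nat_ge (N g)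
  rw [← Set.countable_univ_iff, this]
  exact Set.countable_iUnion fun n => (h.finite_ball n).countable

/-- Far away points do not reach a ball in a short time. -/
lemma exists_hitProb_ball_le (h : IsStableLike N μ β) : ∃ C : ℝ, 0 < C ∧ ∀ (a R : ℝ), 0 < R →
    ∀ (n : ℕ) (z : G), a + R ≤ N z →
      hitProb μ {g | N g ≤ a} n z ≤ ENNReal.ofReal (C * n / R ^ β) := by
  obtain ⟨C, hC, H⟩ := h.exists_escape_le
  refine ⟨C, hC, fun a R hR n z hz => le_trans (mean_mono fun g => ?_) (H n R hR)⟩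
  by_cases hg : N (z * g) ≤ a
  · have h1 := h.norm.mul_le (z * g) g⁻¹
    rw [mul_inv_cancel_right, h.inv] at h1
    have h2 : R ≤ N g := by linarith
    simp [hg, h2]
  · simp [hg]

lemma exists_le_hitProb_ball (h : IsStableLike N μ β) (hlow : HasLowerBound N μ β) :
    ∃ p : ℝ, 0 < p ∧ ∃ n₁ : ℕ, ∀ n : ℕ, n₁ ≤ n → ∀ T : ℝ, T / 2 ≤ n → (n : ℝ) ≤ T → ∀ x,
      N x ≤ T ^ (1 / β) → ENNReal.ofReal p ≤ hitProb μ {g | N g ≤ T ^ (1 / β)} n x := by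
  have hp := h.pos
  -- Two points of the ball differ by an element of norm at most `2 * T ^ (1 / β)`, and `T ≤ 2 * n ≤
  -- 6 * m` for `m = n / 2`.
  obtain ⟨c, hc, n₀, H⟩ := hlow (2 * 6 ^ (1 / β)) (by positivity)
  refine ⟨c * (μ 1).toReal, mul_pos hc h.lazy, 2 * n₀ + 2, fun n hn T hT1 hT2 x hx => ?_⟩
  have hn0 : (0 : ℝ) < n := by exact_mod_cast (by omega : 0 < n)
  have hT : 0 < T := by linarith
  set τ := T ^ (1 / β) with hτ
  set m := n / 2 with hm
  have hm0 : (0 : ℝ) < m := by exact_mod_cast (by omega : 0 < m)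
  have h3m : (n : ℝ) ≤ 3 * m := by exact_mod_cast (by omega : n ≤ 3 * m)
  have hmn : (m : ℝ) ≤ n := by exact_mod_cast (by omega : m ≤ n)
  have hset : {g | N g ≤ τ} = ((h.finite_ball τ).toFinset : Set G) := by simp
  have hV := h.volumeFun_pos (a := τ) (by positivity)
  have hVm : 0 < (volumeFun N ((m : ℝ) ^ (1 / β)) : ℝ) := h.volumeFun_pos (by positivity)
  have hVV : (volumeFun N ((m : ℝ) ^ (1 / β)) : ℝ) ≤ volumeFun N τ := h.volumeFun_mono (by
    rw [hτ]; gcongr; linarith)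
  have key : ∀ y, N y ≤ τ → ENNReal.ofReal (c * (μ 1).toReal * (volumeFun N τ : ℝ)⁻¹) ≤
      convPow μ n (x⁻¹ * y) := by
    intro y hy
    have h1 : N (x⁻¹ * y) ≤ 2 * 6 ^ (1 / β) * (m : ℝ) ^ (1 / β) := by
      have h2 := h.norm.mul_le x⁻¹ y
      rw [h.inv] at h2
      have h3 : τ ≤ 6 ^ (1 / β) * (m : ℝ) ^ (1 / β) := by
        rw [← Real.mul_rpow (by norm_num) hm0.le, hτ]
        gcongr; linarith
      linarith
    have h2 := H m (by omega) _ h1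
    have h3 : c * (volumeFun N τ : ℝ)⁻¹ ≤ (convPow μ (2 * m) (x⁻¹ * y)).toReal :=
      le_trans (by gcongr) h2
    have h4 : ENNReal.ofReal (c * (volumeFun N τ : ℝ)⁻¹) ≤ convPow μ (2 * m) (x⁻¹ * y) :=
      ENNReal.ofReal_le_of_le_toReal h3
    have h5 : ENNReal.ofReal (c * (μ 1).toReal * (volumeFun N τ : ℝ)⁻¹) ≤
        convPow μ (2 * m) (x⁻¹ * y) * μ 1 := by
      rw [mul_right_comm, ENNReal.ofReal_mul (by positivity),
        ENNReal.ofReal_toReal (μ.apply_ne_top _)]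
      gcongr
    refine h5.trans ?_
    -- The lower bound concerns even times; for odd `n` one lazy step is added, which explains the
    -- factor `μ 1`.
    rcases Nat.even_or_odd' n with ⟨j, hj | hj⟩
    · rw [show 2 * m = n by omega]
      exact mul_le_of_le_one_right' (μ.coe_le_one _)
    · rw [show n = 2 * m + 1 by omega, convPow_succ, conv_apply]
      refine le_trans ?_ (ENNReal.le_tsum (x⁻¹ * y))
      simp
  rw [hset, hitProb_eq_finset]
  calc ENNReal.ofReal (c * (μ 1).toReal) =
        ∑ _y ∈ (h.finite_ball τ).toFinset,
          ENNReal.ofReal (c * (μ 1).toReal * (volumeFun N τ : ℝ)⁻¹) := by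
        rw [Finset.sum_const, ← volumeFun_eq_card, ← ENNReal.ofReal_nsmul, nsmul_eq_mul]
        congr 1
        field_simp
    _ ≤ _ := Finset.sum_le_sum fun y hy => key y (by simpa using hy)

/-- The walk ends in the ball with probability at least `p`. A path that does so after leaving the
larger ball must come back from far away, which costs at most `p / 2`. -/
theorem exists_path (h : IsStableLike N μ β) (hlow : HasLowerBound N μ β) :
    ∃ ε γ₁ γ₂ : ℝ, 0 < ε ∧ 0 < γ₁ ∧ 1 ≤ γ₂ ∧
    ∀ (n : ℕ) (τ T : ℝ), 0 < τ → 0 < T → T ^ (1 / β) = τ / γ₁ → T / 2 ≤ n → n ≤ T →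
      ∀ x : G, N x ≤ τ →
        ε ≤ incrProb μ {ξ | (∀ j ≤ n, N (walk x ξ j) ≤ γ₂ * τ) ∧ N (walk x ξ n) ≤ τ} := by
  have hp := h.pos
  have := h.countable
  obtain ⟨p, hp0, n₁, H⟩ := h.exists_le_hitProb_ball hlow
  obtain ⟨C, hC, HC⟩ := h.exists_hitProb_ball_le
  have hlazy := h.lazy
  -- Then `(γ * τ) ^ β = 2 * C / p * T`, and a return across the distance `γ * τ` within time `T`
  -- has probability at most `p / 2`.
  set γ : ℝ := (2 * C / p) ^ (1 / β) with hγ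
  have hγ0 : 0 < γ := by positivity
  refine ⟨min (p / 2) ((μ 1).toReal ^ n₁), 1, 1 + γ, by positivity, one_pos, by linarith,
    fun n τ T hτ hT hTτ hn1 hn2 x hx => ?_⟩
  rw [div_one] at hTτ
  have e : {ξ | (∀ j ≤ n, N (walk x ξ j) ≤ (1 + γ) * τ) ∧ N (walk x ξ n) ≤ τ} =
      stayEvent {g | N g ≤ (1 + γ) * τ} {g | N g ≤ τ} n x := rfl
  rw [e, incrProb_stayEvent]
  have hle : killed μ {g | N g ≤ (1 + γ) * τ} {g | N g ≤ τ} n x ≠ ∞ := by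
    let _ : MeasurableSpace G := ⊤
    rw [← measure_stayEvent]
    exact measure_ne_top _ _
  rcases lt_or_ge n n₁ with hlt | hge
  · refine (min_le_right _ _).trans ?_
    have h1 := pow_le_killed (ω := μ) (A := {g | N g ≤ τ}) (B := {g | N g ≤ (1 + γ) * τ})
      (x := x) hx (hx.trans (by nlinarith)) n
    have h2 := ENNReal.toReal_mono hle h1
    rw [ENNReal.toReal_pow] at h2
    refine le_trans (pow_le_pow_of_le_one hlazy.le (toReal_le_one μ 1) hlt.le) h2
  · refine (min_le_left _ _).trans ?_
    have h1 := H n hge T hn1 hn2 x (by rwa [hTτ])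
    rw [hTτ] at h1
    have h2 := hitProb_le_killed_add (μ := μ) (ω := μ) (lam := fun _ => 0) (A := {g | N g ≤ τ})
      (B := {g | N g ≤ (1 + γ) * τ}) (ε := ENNReal.ofReal (p / 2)) (n := n) (fun g => by simp)
      (fun z hz i hi => ?_) le_rfl x
    · simp only [tsum_zero, mul_zero, add_zero] at h2
      have h3 := h1.trans h2
      rw [← ENNReal.ofReal_toReal hle, ← ENNReal.ofReal_add ENNReal.toReal_nonneg (by positivity)]
        at h3
      rw [ENNReal.ofReal_le_ofReal_iff (by positivity)] at h3
      linarith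
    · have hz' : ¬ N z ≤ (1 + γ) * τ := hz
      refine (HC τ (γ * τ) (by positivity) i z (by linarith)).trans (ENNReal.ofReal_le_ofReal ?_)
      have h3 : (γ * τ) ^ β = 2 * C / p * T := by
        rw [Real.mul_rpow hγ0.le hτ.le, hγ, h.scale_rpow (by positivity), ← hTτ,
          h.scale_rpow hT.le]
      rw [h3, div_le_iff₀ (by positivity)]
      have h4 : (i : ℝ) ≤ T := le_trans (by exact_mod_cast hi) hn2
      calc C * i ≤ C * T := by gcongr
        _ = _ := by field_simp

theorem stronglyControlled (h : IsStableLike N μ β) (hlow : HasLowerBound N μ β) :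
    StronglyControlled μ N (fun t => t ^ (1 / β)) where
  symm := h.symm
  norm := h.norm
  finite_ball := h.finite_ball
  pos t ht := Real.rpow_pos_of_pos ht _
  strictMono := fun x hx y _ hxy => Real.rpow_lt_rpow (le_of_lt hx) hxy (by have := h.pos; positivity)
  continuous := continuousOn_id.rpow_const fun x hx => Or.inl (ne_of_gt hx)
  pointwise := by
    obtain ⟨A, hA, HA⟩ := h.exists_returnProb_le
    refine ⟨A, hA, fun κ hκ => ?_⟩
    obtain ⟨c, hc, n₀, H⟩ := hlow κ hκ
    exact ⟨c, hc, n₀, fun n hn g hg => ⟨fun hn' => H n hn' g hg,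
      (convPow_le_returnProb h.symm n g).trans (HA n hn)⟩⟩
  path := h.exists_path hlow

end IsStableLike

end Path

end

noncomputable section

/-! ### Pseudo-Poincaré inequality from the long jumps. -/

section Jumps

variable {G : Type*} [Group G] {k : ℕ} {s : Fin k → G} {K : Fin k → ℝ → ℝ} {μ : PMF G} {β : ℝ}

open scoped RealInnerProductSpace

/-- At scale `r`, the measure `μ` charges the powers `s_i ^ j` with `|j| ≲ K_i r` at least like the
uniform measure of total mass `r ^ (-β)`. -/
def HasJumps (s : Fin k → G) (K : Fin k → ℝ → ℝ) (μ : PMF G) (β : ℝ) : Prop :=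
  ∀ A : ℝ, 1 ≤ A → ∃ c : ℝ, 0 < c ∧ ∀ᶠ r in atTop, ∀ i, ∀ I : Finset ℤ,
    (∀ j ∈ I, |(j : ℝ)| ≤ A * K i r) → ∀ g,
      ∑ j ∈ I, ENNReal.ofReal (c / (r ^ β * K i r)) * Set.indicator {s i ^ j} 1 g ≤ μ g

lemma mul_sum_le_mean {x : G} {b : ℝ≥0∞} {I : Finset ℤ}
    (h : ∀ g, ∑ j ∈ I, b * Set.indicator {x ^ j} 1 g ≤ μ g) (φ : G → ℝ≥0∞) :
    b * ∑ j ∈ I, φ (x ^ j) ≤ mean μ φ := by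
  calc b * ∑ j ∈ I, φ (x ^ j) = ∑' g, (∑ j ∈ I, b * Set.indicator {x ^ j} 1 g) * φ g := by
        simp only [Finset.sum_mul]
        rw [Summable.tsum_finsetSum fun _ _ => ENNReal.summable, Finset.mul_sum]
        refine Finset.sum_congr rfl fun j _ => ?_
        rw [tsum_eq_single (x ^ j)]
        · simp
        · intro g hg; simp [hg]
    _ ≤ mean μ φ := ENNReal.tsum_le_tsum fun g => by gcongr; exact h g

lemma IsScale.abs_floor_le {i : Fin k} (hK : IsScale K) {r : ℝ} (hr : 0 ≤ r) {j : ℤ} (h1 : 1 ≤ j)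
    (h2 : j ≤ ⌊K i r⌋₊) : |(j : ℝ)| ≤ K i r := by
  rw [abs_of_nonneg (by exact_mod_cast (by omega : 0 ≤ j))]
  refine le_trans ?_ (Nat.floor_le (hK.nonneg i r hr))
  exact_mod_cast h2

/-- The pseudo-Poincaré inequality for powers of the generators. -/
lemma HasJumps.exists_norm_sub_zpow_le (hJ : HasJumps s K μ β) (hK : IsScale K) {M : ℝ}
    (hM : 0 ≤ M) : ∃ C : ℝ, 0 < C ∧ ∀ᶠ r in atTop, ∀ i, ∀ m : ℤ, |(m : ℝ)| ≤ M * K i r →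
      ∀ f : EllTwo G, ‖f - rightTrans (s i ^ m) f‖ ^ 2 ≤
        C * r ^ β * (‖f‖ ^ 2 - ⟪markovOp μ f, f⟫) := by
  obtain ⟨c, hc, H⟩ := hJ (M + 1) (by linarith)
  refine ⟨16 / c, by positivity, ?_⟩
  filter_upwards [H, hK.eventually_le_floor 1, eventually_gt_atTop 0] with r hr hw hr0 i m hm f
  set w := ⌊K i r⌋₊ with hwdef
  have hw1 : (1 : ℝ) ≤ w := by exact_mod_cast hw i
  have hwK : (w : ℝ) ≤ K i r := Nat.floor_le (hK.nonneg i r hr0.le)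
  have hKw : K i r ≤ 2 * w := le_two_mul_floor (hw i)
  have hK0 : 0 < K i r := by linarith
  set b : ℝ := c / (r ^ β * K i r) with hb
  have hb0 : 0 < b := by positivity
  set E := 2 * (‖f‖ ^ 2 - ⟪markovOp μ f, f⟫) with hE
  set φ : ℤ → ℝ := fun j => ‖f - rightTrans (s i ^ j) f‖ ^ 2 with hφ
  have hE0 : 0 ≤ E := (hasSum_energy μ f).nonneg fun g => by positivity
  have hsum : ∀ I : Finset ℤ, (∀ j ∈ I, |(j : ℝ)| ≤ (M + 1) * K i r) → b * ∑ j ∈ I, φ j ≤ E := by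
    intro I hI
    have h1 := mul_sum_le_mean (hr i I hI) fun g => ENNReal.ofReal (‖f - rightTrans g f‖ ^ 2)
    rw [mean_ofReal_eq (fun g => by positivity) (hasSum_energy μ f),
      ← ENNReal.ofReal_sum_of_nonneg (fun _ _ => by positivity), ← ENNReal.ofReal_mul hb0.le,
      ENNReal.ofReal_le_ofReal_iff hE0] at h1
    exact h1
  have h1 := hsum (Finset.Icc 1 (w : ℤ)) (fun j hj => by
    rw [Finset.mem_Icc] at hj
    refine (hK.abs_floor_le hr0.le hj.1 hj.2).trans ?_
    nlinarith)
  have h2 := hsum ((Finset.Icc 1 (w : ℤ)).map (addLeftEmbedding m)) (fun j hj => by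
    simp only [Finset.mem_map, addLeftEmbedding_apply, Finset.mem_Icc] at hj
    obtain ⟨j, hj, rfl⟩ := hj
    push_cast
    refine (abs_add_le _ _).trans ?_
    have := hK.abs_floor_le hr0.le hj.1 hj.2
    linarith)
  rw [Finset.sum_map] at h2
  simp only [addLeftEmbedding_apply] at h2
  -- Write `s i ^ m` as `s i ^ (m + j)` times `s i ^ (-j)`. Averaged over `1 ≤ j ≤ w`, both terms
  -- are part of the energy, since `μ` charges each of these powers at least by `b`; the shift by
  -- `m` is why the jumps are taken up to `(M + 1) * K i r`.
  have h3 : ∀ j, φ m ≤ 2 * (φ (m + j) + φ j) := by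
    intro j
    have h4 := norm_sub_rightTrans_mul f (s i ^ (m + j)) (s i ^ j)⁻¹
    rw [norm_sub_rightTrans_inv, ← zpow_neg, ← zpow_add, add_neg_cancel_right] at h4
    have h5 : φ m ≤ (‖f - rightTrans (s i ^ (m + j)) f‖ + ‖f - rightTrans (s i ^ j) f‖) ^ 2 := by
      simp only [hφ]; gcongr
    refine h5.trans ?_
    exact add_sq_le
  have h4 : w * φ m ≤ 2 * (∑ j ∈ Finset.Icc 1 (w : ℤ), φ (m + j) +
      ∑ j ∈ Finset.Icc 1 (w : ℤ), φ j) := by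
    have := Finset.card_nsmul_le_sum (Finset.Icc 1 (w : ℤ)) (fun j => 2 * (φ (m + j) + φ j)) (φ m)
      fun j _ => h3 j
    rw [← Finset.mul_sum, Finset.sum_add_distrib, nsmul_eq_mul] at this
    simpa using this
  have h5 : b * w * φ m ≤ 4 * E := by nlinarith
  have h6 : c / (2 * r ^ β) ≤ b * w := by
    rw [hb, div_mul_eq_mul_div, div_le_div_iff₀ (by positivity) (by positivity)]
    have : 0 < r ^ β := by positivity
    calc c * (r ^ β * K i r) ≤ c * (r ^ β * (2 * w)) := by gcongr
      _ = _ := by ring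
  have h7 : c / (2 * r ^ β) * φ m ≤ 4 * E := le_trans (by gcongr) h5
  rw [div_mul_eq_mul_div, div_le_iff₀ (by positivity)] at h7
  change φ m ≤ _
  rw [div_mul_eq_mul_div, div_mul_eq_mul_div, le_div_iff₀ hc]
  linarith

/-- The pseudo-Poincaré inequality. -/
theorem HasJumps.exists_poincare [Group.IsNilpotent G] (hJ : HasJumps s K μ β) (hK : IsScale K)
    (hs : Subgroup.closure (Set.range s) = ⊤) : ∃ C : ℝ, 0 < C ∧ ∀ᶠ r in atTop, ∀ y,
      wordNorm s K y ≤ r → ∀ f : EllTwo G,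
        ‖f - rightTrans y f‖ ^ 2 ≤ C * r ^ β * (‖f‖ ^ 2 - ⟪markovOp μ f, f⟫) := by
  obtain ⟨p, M, hM, hp⟩ := hK.exists_mem_powProd hs 1
  obtain ⟨C, hC, H⟩ := hJ.exists_norm_sub_zpow_le hK hM
  refine ⟨(p ^ 2 + 1) * C, by positivity, ?_⟩
  filter_upwards [hp, H, eventually_gt_atTop 0] with r h1 h2 hr0 y hy f
  obtain ⟨w, hw1, hw2, rfl⟩ := h1 y (by rwa [one_mul])
  set E := ‖f‖ ^ 2 - ⟪markovOp μ f, f⟫ with hE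
  have hE0 : 0 ≤ E := by
    have := (hasSum_energy μ f).nonneg fun g => by positivity
    linarith
  have hr : 0 < r ^ β := by positivity
  have h3 : ∀ g ∈ w.map fun q => s q.1 ^ q.2, ‖f - rightTrans g f‖ ≤ √(C * r ^ β * E) := by
    intro g hg
    obtain ⟨q, hq, rfl⟩ := List.mem_map.1 hg
    refine Real.le_sqrt_of_sq_le (h2 q.1 q.2 ((hw2 q hq).trans ?_) f)
    gcongr
    exact Nat.floor_le (hK.nonneg _ r hr0.le)
  have h4 := norm_sub_rightTrans_prod f _ h3
  rw [List.length_map] at h4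
  have h5 : ‖f - rightTrans (w.map fun q => s q.1 ^ q.2).prod f‖ ≤ p * √(C * r ^ β * E) :=
    h4.trans (by gcongr)
  calc _ ≤ (p * √(C * r ^ β * E)) ^ 2 := by gcongr
    _ = p ^ 2 * (C * r ^ β * E) := by rw [mul_pow, Real.sq_sqrt (by positivity)]
    _ ≤ (p ^ 2 + 1) * (C * r ^ β * E) := by gcongr; linarith
    _ = _ := by ring

end Jumps

end

noncomputable section

/-! ### Following large jumps: lower bounds far from the diagonal. -/

section Blocks

variable {G : Type*} [Group G] {k : ℕ} {s : Fin k → G} {K : Fin k → ℝ → ℝ} {μ : PMF G} {β : ℝ}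

/-- The walk stays near the identity for a short time. -/
lemma IsStableLike.exists_le_hitProb_ball_one {N : G → ℝ} (h : IsStableLike N μ β) :
    ∃ C : ℝ, 0 < C ∧ ∀ (R : ℝ), 0 < R → ∀ n : ℕ,
      1 ≤ hitProb μ {g | N g ≤ R} n 1 + ENNReal.ofReal (C * n / R ^ β) := by
  obtain ⟨C, hC, H⟩ := h.exists_escape_le
  refine ⟨C, hC, fun R hR n => ?_⟩
  rw [← mean_indicator_add_compl (convPow μ n) {g | N g ≤ R}]
  simp only [hitProb, one_mul]
  gcongr
  refine le_trans (mean_mono fun g => ?_) (H n R hR)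
  refine Set.indicator_le_indicator_of_subset ?_ (by simp) g
  intro x hx
  have : ¬ N x ≤ R := hx
  exact (not_le.1 this).le

/-- A large step along a generator, followed and preceded by short excursions. -/
theorem HasJumps.exists_le_hitProb_zpow [Group.IsNilpotent G] (hJ : HasJumps s K μ β)
    (hK : IsScale K) (hs : Subgroup.closure (Set.range s) = ⊤)
    (h : IsStableLike (wordNorm s K) μ β) {M η : ℝ} (hM : 1 ≤ M) (hη : 0 < η) :
    ∃ ε₁ : ℝ, 0 < ε₁ ∧ ∀ ε : ℝ, 0 < ε → ε ≤ ε₁ → ∃ c : ℝ, 0 < c ∧ ∀ᶠ n : ℕ in atTop,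
      ∀ i, ∀ m : ℤ, |(m : ℝ)| ≤ M * K i ((n : ℝ) ^ (1 / β)) →
        ENNReal.ofReal c ≤ hitProb μ
          {y | wordNorm s K ((s i ^ m)⁻¹ * y) ≤ η * (n : ℝ) ^ (1 / β)} (2 * ⌊ε * n⌋₊) 1 := by
  have hp := h.pos
  obtain ⟨δ₀, hδ₀, hconj⟩ := hK.exists_conj_le hs M (show 0 < η / 4 by positivity)
  set δ := min (min δ₀ (η / 4)) 1 with hδdef
  have hδ : 0 < δ := by positivity
  have hδ1 : δ ≤ 1 := min_le_right _ _
  have hδη : δ ≤ η / 4 := (min_le_left _ _).trans (min_le_right _ _)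
  have hδδ : δ ≤ δ₀ := (min_le_left _ _).trans (min_le_left _ _)
  obtain ⟨D, hD, hdoub⟩ := hK.doubling (1 / δ) (by rw [le_div_iff₀ hδ]; linarith)
  obtain ⟨C₁, hC₁, hball⟩ := h.exists_le_hitProb_ball_one
  obtain ⟨C₂, hC₂, hfar⟩ := h.exists_hitProb_ball_le
  obtain ⟨c₀, hc₀, hjump⟩ := hJ (M + 1) (by linarith)
  set a := min c₀ 1 with ha
  have ha0 : 0 < a := by positivity
  -- The first bound makes a distinguished jump before time `t` have probability at most `1 / 4`.
  -- The second makes each of the two bad events, being outside `A` at a given time and coming back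
  -- to `A` from outside `B`, have probability at most `1 / 4`.
  refine ⟨min (1 / 8) ((δ / 2) ^ β / (8 * max C₁ C₂)), by positivity, fun ε hε hε1 => ?_⟩
  have hε8 : ε ≤ 1 / 8 := hε1.trans (min_le_left _ _)
  have hεC : ε * (8 * max C₁ C₂) ≤ (δ / 2) ^ β := by
    rw [← le_div_iff₀ (by positivity)]; exact hε1.trans (min_le_right _ _)
  -- The three factors bound from below the probability of staying close after the jump, the
  -- expected number of distinguished jumps in time `t`, and the probability of staying close before
  -- the jump.
  refine ⟨1 / 2 * (a * ε / (2 * D)) * (1 / 4), by positivity, ?_⟩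
  have hscale : Tendsto (fun n : ℕ => (n : ℝ) ^ (1 / β)) atTop atTop := by
    simpa using h.tendsto_scale one_pos
  have hδr : Tendsto (fun n : ℕ => δ * (n : ℝ) ^ (1 / β)) atTop atTop :=
    hscale.const_mul_atTop hδ
  filter_upwards [hscale.eventually hconj, hδr.eventually hdoub, hscale.eventually hjump,
    hδr.eventually (hK.eventually_le_floor 1), eventually_gt_atTop 0,
    (tendsto_natCast_atTop_atTop.const_mul_atTop hε).eventually_ge_atTop (1 : ℝ)]
    with n hconj hdoub hjump hfloor hn hεn i m hm
  have hn0 : (0 : ℝ) < n := by exact_mod_cast hn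
  set r := (n : ℝ) ^ (1 / β) with hr
  have hr0 : 0 < r := by positivity
  have hrβ : r ^ β = n := h.scale_rpow hn0.le
  set t := 2 * ⌊ε * n⌋₊ with ht
  have ht1 : (t : ℝ) ≤ 2 * (ε * n) := by
    rw [ht]; push_cast; gcongr; exact Nat.floor_le (by positivity)
  have ht2 : ε * n ≤ t := by
    rw [ht]; push_cast; exact le_two_mul_floor (Nat.le_floor (by exact_mod_cast hεn))
  set w := ⌊K i (δ * r)⌋₊ with hw
  have hwK : (w : ℝ) ≤ K i (δ * r) := Nat.floor_le (hK.nonneg i _ (by positivity))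
  have hKw : K i (δ * r) ≤ 2 * w := le_two_mul_floor (hfloor i)
  have hKD : K i r ≤ D * K i (δ * r) := by
    have := hdoub i
    rwa [← mul_assoc, one_div_mul_cancel hδ.ne', one_mul] at this
  have hKδ : K i (δ * r) ≤ K i r := hK.mono (by positivity) (by nlinarith)
  have hw1 : (1 : ℝ) ≤ w := by exact_mod_cast hfloor i
  have hK0 : 0 < K i r := by linarith
  have hw0 : (0 : ℝ) < w := by linarith
  set b : ℝ := a / (r ^ β * K i r) with hb
  have hb0 : 0 < b := by positivity
  set I : Finset ℤ := (Finset.Icc 1 (w : ℤ)).map (addLeftEmbedding m) with hI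
  -- The distinguished jumps: powers `s i ^ (m + j)` with `1 ≤ j ≤ w`, all within norm `δ * r` of `s
  -- i ^ m`. There are enough of them for the total mass to be of order `1 / n`.
  set lam : G → ℝ≥0∞ := fun g => ∑ j ∈ I, ENNReal.ofReal b * Set.indicator {s i ^ j} 1 g with hlam
  have hlamμ : ∀ g, lam g ≤ μ g := by
    intro g
    refine le_trans ?_ (hjump i I (fun j hj => ?_) g)
    · have hac : a ≤ c₀ := min_le_left _ _
      simp only [hlam, hb]
      gcongr
    · simp only [hI, Finset.mem_map, addLeftEmbedding_apply, Finset.mem_Icc] at hj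
      obtain ⟨j, hj, rfl⟩ := hj
      push_cast
      refine (abs_add_le _ _).trans ?_
      have := hK.abs_floor_le (i := i) (r := δ * r) (by positivity) hj.1 hj.2
      linarith
  set θ : ℝ := w * b with hθ
  have hθ0 : 0 < θ := by positivity
  have hlamsum : ∑' g, lam g = ENNReal.ofReal θ := by
    simp only [hlam]
    rw [Summable.tsum_finsetSum fun _ _ => ENNReal.summable]
    have : ∀ j ∈ I, ∑' g, ENNReal.ofReal b * Set.indicator {s i ^ j} 1 g = ENNReal.ofReal b := by
      intro j _
      rw [tsum_eq_single (s i ^ j)]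
      · simp
      · intro g hg; simp [hg]
    rw [Finset.sum_congr rfl this, Finset.sum_const, hI, Finset.card_map, ← ENNReal.ofReal_nsmul]
    simp [hθ]
  have hθt : t * θ ≤ 1 / 4 := by
    have h1 : θ ≤ a / n := by
      rw [hθ, hb, hrβ, mul_div_assoc', div_le_div_iff₀ (by positivity) hn0]
      calc w * a * n ≤ K i r * a * n := by gcongr; linarith
        _ = _ := by ring
    calc t * θ ≤ 2 * (ε * n) * (a / n) := by gcongr
      _ = 2 * ε * a := by field_simp
      _ ≤ 2 * (1 / 8) * 1 := by gcongr; exact min_le_right _ _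
      _ = _ := by norm_num
  have hθt' : a * ε / (2 * D) ≤ θ * t := by
    have h1 : a / (2 * D * n) ≤ θ := by
      rw [hθ, hb, hrβ, mul_div_assoc', div_le_div_iff₀ (by positivity) (by positivity)]
      calc a * (n * K i r) ≤ a * (n * (D * (2 * w))) := by
            gcongr
            exact hKD.trans (by gcongr)
        _ = _ := by ring
    calc a * ε / (2 * D) = a / (2 * D * n) * (ε * n) := by field_simp
      _ ≤ θ * t := by gcongr
  have hshort : ∀ C, C ≤ max C₁ C₂ → 0 < C → ∀ j ≤ t,
      ENNReal.ofReal (C * j / (δ / 2 * r) ^ β) ≤ ENNReal.ofReal (1 / 4) := by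
    intro C hC hC0 j hj
    refine ENNReal.ofReal_le_ofReal ?_
    rw [Real.mul_rpow (by positivity) hr0.le, hrβ, div_le_iff₀ (by positivity)]
    have hj' : (j : ℝ) ≤ 2 * (ε * n) := le_trans (by exact_mod_cast hj) ht1
    calc C * j ≤ max C₁ C₂ * (2 * (ε * n)) := by gcongr
      _ = 1 / 4 * (ε * (8 * max C₁ C₂) * n) := by ring
      _ ≤ _ := by gcongr
  set A : Set G := {g | wordNorm s K g ≤ δ / 2 * r} with hA
  set B : Set G := {g | wordNorm s K g ≤ δ * r} with hB
  have hstay : ∀ j ≤ t, ENNReal.ofReal (3 / 4) ≤ hitProb μ A j 1 := by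
    intro j hj
    have h1 := (hball (δ / 2 * r) (by positivity) j).trans
      (add_le_add_right (hshort C₁ (le_max_left _ _) hC₁ j hj) _)
    have h2 : ENNReal.ofReal (3 / 4) + ENNReal.ofReal (1 / 4) = 1 := by
      rw [← ENNReal.ofReal_add (by norm_num) (by norm_num)]; norm_num
    rw [← h2] at h1
    exact (ENNReal.add_le_add_iff_right ENNReal.ofReal_ne_top).1 h1
  have hsplit : ∀ g, μ g = (μ g - lam g) + lam g := fun g => (tsub_add_cancel_of_le (hlamμ g)).symm
  have hkill : ∀ j ∈ Finset.range t,
      ENNReal.ofReal (1 / 4) ≤ killed (fun g => μ g - lam g) B A j 1 := by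
    intro j hj
    have hj := (Finset.mem_range.1 hj).le
    have h1 := hitProb_le_killed_add (A := A) (B := B) (n := t) (ε := ENNReal.ofReal (1 / 4)) hsplit
      (fun z hz i hi => ?_) hj 1
    · rw [hlamsum] at h1
      have h2 : (j : ℝ≥0∞) * ENNReal.ofReal θ ≤ ENNReal.ofReal (1 / 4) := by
        rw [← ENNReal.ofReal_natCast, ← ENNReal.ofReal_mul (by positivity)]
        refine ENNReal.ofReal_le_ofReal (le_trans ?_ hθt)
        gcongr
      have h3 := (hstay j hj).trans (h1.trans (add_le_add_right h2 _))
      have h4 : ENNReal.ofReal (3 / 4) =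
          ENNReal.ofReal (1 / 4) + (ENNReal.ofReal (1 / 4) + ENNReal.ofReal (1 / 4)) := by
        rw [← ENNReal.ofReal_add (by norm_num) (by norm_num),
          ← ENNReal.ofReal_add (by norm_num) (by norm_num)]
        norm_num
      rw [h4, add_assoc] at h3
      exact (ENNReal.add_le_add_iff_right (by finiteness)).1 h3
    · have hz' : ¬ wordNorm s K z ≤ δ * r := hz
      refine (hfar (δ / 2 * r) (δ / 2 * r) (by positivity) i z (by linarith)).trans ?_
      exact hshort C₂ (le_max_right _ _) hC₂ i hi
  have hmain := mul_sum_killed_le_hitProb (B := B) (A := A) (q := ENNReal.ofReal (1 / 2)) (t := t)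
    (A' := {y | wordNorm s K ((s i ^ m)⁻¹ * y) ≤ η * r}) hsplit (fun j hj y hy g hg => ?_) 1
  · refine le_trans ?_ hmain
    have h1 := Finset.card_nsmul_le_sum _ _ _ hkill
    rw [Finset.card_range, nsmul_eq_mul, ← ENNReal.ofReal_natCast,
      ← ENNReal.ofReal_mul (by positivity)] at h1
    refine le_trans ?_ (mul_le_mul_right h1 _)
    rw [hlamsum, ← ENNReal.ofReal_mul (by positivity), ← ENNReal.ofReal_mul (by positivity)]
    refine ENNReal.ofReal_le_ofReal ?_
    linarith
  · refine le_trans ?_ ((hstay j hj.le).trans (hitProb_one_le_hitProb (fun x hx => ?_) j))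
    · exact ENNReal.ofReal_le_ofReal (by norm_num)
    · have hN := hK.isNorm hs
      obtain ⟨q, hq, hq'⟩ : ∃ q ∈ I, g = s i ^ q := by
        by_contra! hne
        refine hg (Finset.sum_eq_zero fun q hq => ?_)
        simp [hne q hq]
      simp only [hI, Finset.mem_map, addLeftEmbedding_apply, Finset.mem_Icc] at hq
      obtain ⟨q, hq, rfl⟩ := hq
      -- Here `y` is the position before the jump `g` and `x` the displacement after it. The early
      -- error `y` enters conjugated by `s i ^ m`, hence the smallness of `δ` relative to
      -- `exists_conj_le`.
      have e : (s i ^ m)⁻¹ * (y * g * x) = (s i ^ m)⁻¹ * y * s i ^ m * (s i ^ q * x) := by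
        rw [hq', zpow_add]; group
      change wordNorm s K ((s i ^ m)⁻¹ * (y * g * x)) ≤ η * r
      rw [e]
      have h1 := hN.mul_le ((s i ^ m)⁻¹ * y * s i ^ m) (s i ^ q * x)
      have h2 := hN.mul_le (s i ^ q) x
      have h3 : wordNorm s K (s i ^ m) ≤ M * r :=
        hK.wordNorm_zpow_le hs (by positivity) (hm.trans (hK.le_mul hM hr0.le))
      have hy' : wordNorm s K y ≤ δ * r := hy
      have h4 := hconj _ y h3 (hy'.trans (by gcongr))
      have h5 : wordNorm s K (s i ^ q) ≤ δ * r :=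
        hK.wordNorm_zpow_le hs (by positivity) (hK.abs_floor_le (by positivity) hq.1 hq.2)
      have h6 : wordNorm s K x ≤ δ / 2 * r := hx
      have h7 : δ * r ≤ η / 4 * r := by gcongr
      have h8 : 0 ≤ η * r := by positivity
      linarith

/-- The walk follows a bounded number of large steps along generators. -/
theorem HasJumps.exists_le_hitProb_prod [Group.IsNilpotent G] (hJ : HasJumps s K μ β)
    (hK : IsScale K) (hs : Subgroup.closure (Set.range s) = ⊤)
    (h : IsStableLike (wordNorm s K) μ β) {M : ℝ} (hM : 1 ≤ M) (p : ℕ) {η : ℝ} (hη : 0 < η) :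
    ∃ ε₁ : ℝ, 0 < ε₁ ∧ ∀ ε : ℝ, 0 < ε → ε ≤ ε₁ → ∃ c : ℝ, 0 < c ∧ ∀ᶠ n : ℕ in atTop,
      ∀ w : List (Fin k × ℤ), w.length ≤ p →
        (∀ q ∈ w, |(q.2 : ℝ)| ≤ M * ⌊K q.1 ((n : ℝ) ^ (1 / β))⌋₊) →
        ENNReal.ofReal c ≤ hitProb μ
          {y | wordNorm s K ((w.map fun q => s q.1 ^ q.2).prod⁻¹ * y) ≤ η * (n : ℝ) ^ (1 / β)}
          (w.length * (2 * ⌊ε * n⌋₊)) 1 := by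
  have hscale : Tendsto (fun n : ℕ => (n : ℝ) ^ (1 / β)) atTop atTop := by
    simpa using h.tendsto_scale one_pos
  have hN := hK.isNorm hs
  have hnil : ∀ (ρ : ℝ) (t : ℕ), 0 ≤ ρ → (1 : ℝ≥0∞) ≤ hitProb μ
      {y | wordNorm s K ((([] : List (Fin k × ℤ)).map fun q => s q.1 ^ q.2).prod⁻¹ * y) ≤ ρ}
      (([] : List (Fin k × ℤ)).length * t) 1 := by
    intro ρ t hρ
    rw [List.length_nil, zero_mul, hitProb_zero, Set.indicator_of_mem]
    · simp
    · have : wordNorm s K 1 = 0 := (hN.eq_zero_iff 1).2 rfl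
      simpa [this] using hρ
  induction p generalizing η with
  | zero =>
    refine ⟨1, one_pos, fun ε _ _ => ⟨1, one_pos, Eventually.of_forall fun n w hw _ => ?_⟩⟩
    obtain rfl := List.length_eq_zero_iff.1 (Nat.le_zero.1 hw)
    rw [ENNReal.ofReal_one]
    exact hnil _ _ (by positivity)
  | succ p ih =>
    -- The error of the first block gets conjugated by the product `x` of the remaining powers, of
    -- norm at most `max (p * M) 1 * r`. It is therefore made so small that its conjugate uses up
    -- only half of `η`; the remaining blocks receive the other half.
    obtain ⟨δ, hδ, hconj⟩ := hK.exists_conj_le hs (max (p * M) 1) (show 0 < η / 2 by positivity)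
    obtain ⟨ε₁, hε₁, H₁⟩ := hJ.exists_le_hitProb_zpow hK hs h hM hδ
    obtain ⟨ε₂, hε₂, H₂⟩ := ih (η := η / 2) (by positivity)
    refine ⟨min ε₁ ε₂, by positivity, fun ε hε hε' => ?_⟩
    obtain ⟨c₁, hc₁, H₁⟩ := H₁ ε hε (hε'.trans (min_le_left _ _))
    obtain ⟨c₂, hc₂, H₂⟩ := H₂ ε hε (hε'.trans (min_le_right _ _))
    refine ⟨min (c₂ * c₁) 1, by positivity, ?_⟩
    filter_upwards [H₁, H₂, hscale.eventually hconj, hscale.eventually_gt_atTop 0]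
      with n H₁ H₂ hconj hr0 w hw hwM
    set r := (n : ℝ) ^ (1 / β) with hr
    have hfl : ∀ i, (⌊K i r⌋₊ : ℝ) ≤ K i r := fun i => Nat.floor_le (hK.nonneg i r hr0.le)
    rcases w with _ | ⟨q, w⟩
    · refine le_trans ?_ (hnil _ _ (by positivity))
      exact ENNReal.ofReal_le_of_le_toReal (by simp)
    · have hw' : w.length ≤ p := by simpa using hw
      have hwM' : ∀ q ∈ w, |(q.2 : ℝ)| ≤ M * ⌊K q.1 r⌋₊ := fun q hq => hwM q (by simp [hq])
      have h1 := H₁ q.1 q.2 ((hwM q (by simp)).trans (by gcongr; exact hfl _))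
      have h2 := H₂ w hw' hwM'
      set x := (w.map fun q => s q.1 ^ q.2).prod with hx
      have hxr : wordNorm s K x ≤ max (p * M) 1 * r := by
        rw [hK.wordNorm_le_iff hs (by positivity)]
        have hmem : x ∈ PowProd s (fun i => ⌊K i r⌋₊) p M := ⟨w, hw', hwM', rfl⟩
        refine WordBall.mono (PowProd.mem_wordBall (by linarith) hmem) fun i => ?_
        refine le_trans ?_ (hK.le_mul (le_max_right _ _) hr0.le)
        rw [← mul_assoc]
        gcongr
        · exact le_max_left _ _
        · exact hfl i
      have h3 := mul_le_hitProb_add (μ := μ) (q := ENNReal.ofReal c₂) (n := w.length * (2 * ⌊ε * n⌋₊))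
        (m := 2 * ⌊ε * n⌋₊)
        (B := {y | wordNorm s K ((s q.1 ^ q.2)⁻¹ * y) ≤ δ * r})
        (A := {y | wordNorm s K (((q :: w).map fun q => s q.1 ^ q.2).prod⁻¹ * y) ≤ η * r})
        (fun y hy => h2.trans (hitProb_one_le_hitProb (fun g hg => ?_) _)) 1
      · rw [List.length_cons, add_mul, one_mul, add_comm]
        refine le_trans ?_ h3
        refine le_trans (ENNReal.ofReal_le_ofReal (min_le_left _ _)) ?_
        rw [ENNReal.ofReal_mul hc₂.le]
        gcongr
      · have hg' : wordNorm s K (x⁻¹ * g) ≤ η / 2 * r := hg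
        have hy' : wordNorm s K ((s q.1 ^ q.2)⁻¹ * y) ≤ δ * r := hy
        have h4 := hconj x _ hxr hy'
        have h5 := hN.mul_le (x⁻¹ * ((s q.1 ^ q.2)⁻¹ * y) * x) (x⁻¹ * g)
        have e : ((q :: w).map fun q => s q.1 ^ q.2).prod⁻¹ * (y * g) =
            x⁻¹ * ((s q.1 ^ q.2)⁻¹ * y) * x * (x⁻¹ * g) := by
          rw [List.map_cons, List.prod_cons, ← hx]; group
        change wordNorm s K (((q :: w).map fun q => s q.1 ^ q.2).prod⁻¹ * (y * g)) ≤ η * r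
        rw [e]
        linarith

/-- A small fraction of the time is spent on jumping into the neighbourhood of `g`, with probability
bounded below; the rest hits `g` exactly by the near-diagonal bound. Blocks have even length, so the
remaining time is even as well. -/
theorem HasJumps.hasLowerBound [Group.IsNilpotent G] (hJ : HasJumps s K μ β)
    (hK : IsScale K) (hs : Subgroup.closure (Set.range s) = ⊤)
    (h : IsStableLike (wordNorm s K) μ β) : HasLowerBound (wordNorm s K) μ β := by
  intro κ hκ
  have hp := h.pos
  have hN := hK.isNorm hs
  have hscale : Tendsto (fun n : ℕ => (n : ℝ) ^ (1 / β)) atTop atTop := by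
    simpa using h.tendsto_scale one_pos
  obtain ⟨p, M, hM, hprod⟩ := hK.exists_mem_powProd hs κ
  obtain ⟨c, η, hc, hη, n₀, hnear⟩ := h.exists_le_convPow_near
  obtain ⟨ε₁, hε₁, H⟩ := hJ.exists_le_hitProb_prod hK hs h (le_max_right M 1) p
    -- The remaining time is `2 * n'` with `n' ≥ n / 2`, so this radius lies within the
    -- near-diagonal range at time `n'`.
    (show 0 < η * (1 / 2) ^ (1 / β) by positivity)
  set ε := min ε₁ (1 / (2 * (p + 1))) with hεdef
  have hε : 0 < ε := by positivity
  have hεp : ε * (2 * (p + 1)) ≤ 1 := by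
    rw [← le_div_iff₀ (by positivity)]; exact min_le_right _ _
  obtain ⟨c₁, hc₁, H⟩ := H ε hε (min_le_left _ _)
  refine ⟨c * c₁, by positivity, ?_⟩
  rw [← eventually_atTop]
  filter_upwards [H, hscale.eventually hprod, eventually_ge_atTop (2 * n₀ + 1)] with n H hprod hn g hg
  obtain ⟨w, hw, hwM, rfl⟩ := hprod g hg
  have hn0 : (0 : ℝ) < n := by exact_mod_cast (by omega : 0 < n)
  set r := (n : ℝ) ^ (1 / β) with hr
  have h1 := H w hw fun q hq => (hwM q hq).trans (by gcongr; exact le_max_left _ _)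
  set g := (w.map fun q => s q.1 ^ q.2).prod with hgdef
  set L := w.length * ⌊ε * n⌋₊ with hL
  have hLn : 2 * L ≤ n := by
    have h2 : (2 * L : ℝ) ≤ n := by
      rw [hL]; push_cast
      have h3 : (⌊ε * n⌋₊ : ℝ) ≤ ε * n := Nat.floor_le (by positivity)
      have h4 : (w.length : ℝ) ≤ p := by exact_mod_cast hw
      calc 2 * ((w.length : ℝ) * ⌊ε * n⌋₊) ≤ 2 * ((p + 1) * (ε * n)) := by gcongr; linarith
        _ = ε * (2 * (p + 1)) * n := by ring
        _ ≤ 1 * n := by gcongr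
        _ = n := one_mul _
    exact_mod_cast h2
  set n' := n - L with hn'
  have hn'2 : (n : ℝ) / 2 ≤ n' := by
    have : n ≤ 2 * n' := by omega
    have : (n : ℝ) ≤ 2 * n' := by exact_mod_cast this
    linarith
  have hn'n : (n' : ℝ) ≤ n := by exact_mod_cast Nat.sub_le _ _
  have hV := h.volumeFun_pos (a := r) (by positivity)
  have hV' : 0 < (volumeFun (wordNorm s K) ((n' : ℝ) ^ (1 / β)) : ℝ) :=
    h.volumeFun_pos (by positivity)
  have hVV : (volumeFun (wordNorm s K) ((n' : ℝ) ^ (1 / β)) : ℝ) ≤ volumeFun (wordNorm s K) r :=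
    h.volumeFun_mono (by rw [hr]; gcongr)
  have h2 := mul_le_hitProb_add (μ := μ) (A := {g}) (n := 2 * n') (m := w.length * (2 * ⌊ε * n⌋₊))
    (B := {y | wordNorm s K (g⁻¹ * y) ≤ η * (1 / 2) ^ (1 / β) * r})
    (q := ENNReal.ofReal (c * (volumeFun (wordNorm s K) r : ℝ)⁻¹)) (fun y hy => ?_) 1
  · rw [hitProb_singleton, inv_one, one_mul,
      show w.length * (2 * ⌊ε * n⌋₊) + 2 * n' = 2 * n by
        have : w.length * (2 * ⌊ε * n⌋₊) = 2 * L := by rw [hL]; ring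
        omega] at h2
    have h3 := (mul_le_mul_right h1 _).trans h2
    rw [← ENNReal.ofReal_mul (by positivity)] at h3
    have h4 := (ENNReal.ofReal_le_iff_le_toReal (PMF.apply_ne_top _ _)).1 h3
    refine le_trans (le_of_eq ?_) h4
    ring
  · rw [hitProb_singleton]
    refine ENNReal.ofReal_le_of_le_toReal (le_trans ?_ (hnear n' (by omega) _ ?_))
    · gcongr
    · have hy' : wordNorm s K (g⁻¹ * y) ≤ η * (1 / 2) ^ (1 / β) * r := hy
      have e : y⁻¹ * g = (g⁻¹ * y)⁻¹ := by group
      rw [e, h.inv]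
      refine hy'.trans ?_
      rw [hr, mul_assoc, ← Real.mul_rpow (by norm_num) hn0.le]
      gcongr
      linarith

end Blocks

end

noncomputable section

/-! ### Verification of the hypotheses for the given measure. -/

section PowerMass

variable {G : Type*} [Group G] {k : ℕ} {s : Fin k → G} {α κ : Fin k → ℝ} {l K : Fin k → ℝ → ℝ}
  {μ : PMF G} {β : ℝ}

lemma powerMass_inv (g : G) : powerMass s κ α l g⁻¹ = powerMass s κ α l g := by
  unfold powerMass
  congr 1
  refine Finset.sum_congr rfl fun i _ => ?_
  rw [← (Equiv.neg ℤ).tsum_eq]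
  refine tsum_congr fun n => ?_
  have : Set.indicator {s i ^ (-n)} (1 : G → ℝ≥0∞) g⁻¹ = Set.indicator {s i ^ n} 1 g := by
    by_cases h : g = s i ^ n
    · subst h; simp
    · have h' : g⁻¹ ≠ s i ^ (-n) := by rwa [zpow_neg, Ne, inv_inj]
      rw [Set.indicator_of_notMem (by simpa using h'), Set.indicator_of_notMem (by simpa using h)]
  rw [Equiv.neg_apply, this]
  simp

lemma mean_eq_of_powerMass (hμ : ∀ g, μ g = powerMass s κ α l g) (φ : G → ℝ≥0∞) :
    mean μ φ = (k : ℝ≥0∞)⁻¹ * ∑ i, ∑' n : ℤ,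
      ENNReal.ofReal (κ i * l i |(n : ℝ)| / (1 + |(n : ℝ)|) ^ (1 + α i)) * φ (s i ^ n) := by
  simp only [mean, hμ, powerMass, mul_assoc, ENNReal.tsum_mul_left, Finset.sum_mul,
    ← ENNReal.tsum_mul_right]
  congr 1
  rw [Summable.tsum_finsetSum fun _ _ => ENNReal.summable]
  refine Finset.sum_congr rfl fun i _ => ?_
  rw [ENNReal.tsum_comm]
  refine tsum_congr fun n => ?_
  rw [ENNReal.tsum_mul_left, tsum_eq_single (s i ^ n)]
  · simp
  · intro g hg; simp [hg]

lemma nonempty_of_powerMass (hμ : ∀ g, μ g = powerMass s κ α l g) : 0 < k := by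
  rcases Nat.eq_zero_or_pos k with rfl | h
  · have h1 := mean_const μ 1
    rw [mean_eq_of_powerMass hμ] at h1
    simp at h1
  · exact h

lemma hasJumps_of_powerMass (hμ : ∀ g, μ g = powerMass s κ α l g)
    (hmass : ∀ i, ∀ A : ℝ, 1 ≤ A → ∃ c : ℝ, 0 < c ∧ ∀ᶠ r in atTop, ∀ m : ℤ,
      |(m : ℝ)| ≤ A * K i r →
        c / (r ^ β * K i r) ≤ κ i * l i |(m : ℝ)| / (1 + |(m : ℝ)|) ^ (1 + α i))
    (hK : IsScale K) : HasJumps s K μ β := by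
  intro A hA
  choose c hc H using fun i => hmass i A hA
  have hk := nonempty_of_powerMass hμ
  have hk0 : (0 : ℝ) < k := by exact_mod_cast hk
  -- A positive lower bound for all the constants `c i` at once.
  set c' : ℝ := (1 + ∑ i, (c i)⁻¹)⁻¹ with hc'
  have hsum : 0 ≤ ∑ i, (c i)⁻¹ := Finset.sum_nonneg fun i _ => (inv_pos.2 (hc i)).le
  have hc'0 : 0 < c' := by positivity
  have hle : ∀ i, c' ≤ c i := by
    intro i
    rw [hc', inv_le_comm₀ (by positivity) (hc i)]
    have := Finset.single_le_sum (f := fun i => (c i)⁻¹) (fun i _ => (inv_pos.2 (hc i)).le)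
      (Finset.mem_univ i)
    linarith
  refine ⟨(k : ℝ)⁻¹ * c', by positivity, ?_⟩
  filter_upwards [eventually_all.2 H, eventually_gt_atTop 0] with r hr hr0 i I hI g
  have hKi := hK.nonneg i r hr0.le
  rw [hμ, powerMass]
  calc ∑ j ∈ I, ENNReal.ofReal ((k : ℝ)⁻¹ * c' / (r ^ β * K i r)) * Set.indicator {s i ^ j} 1 g
      ≤ ∑ j ∈ I, (k : ℝ≥0∞)⁻¹ * (ENNReal.ofReal
          (κ i * l i |(j : ℝ)| / (1 + |(j : ℝ)|) ^ (1 + α i)) * Set.indicator {s i ^ j} 1 g) := by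
        refine Finset.sum_le_sum fun j hj => ?_
        rw [← mul_assoc]
        gcongr
        rw [mul_div_assoc, ENNReal.ofReal_mul (by positivity), ENNReal.ofReal_inv_of_pos hk0,
          ENNReal.ofReal_natCast]
        refine mul_le_mul_right (ENNReal.ofReal_le_ofReal (le_trans ?_ (hr i j (hI j hj)))) _
        gcongr
        exact hle i
    _ ≤ _ := by
        rw [← Finset.mul_sum]
        gcongr
        refine (ENNReal.sum_le_tsum I).trans ?_
        exact Finset.single_le_sum (f := fun i => ∑' n : ℤ,
          ENNReal.ofReal (κ i * l i |(n : ℝ)| / (1 + |(n : ℝ)|) ^ (1 + α i)) *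
            Set.indicator {s i ^ n} 1 g) (fun _ _ => zero_le) (Finset.mem_univ i)

lemma exists_tail_of_powerMass (hμ : ∀ g, μ g = powerMass s κ α l g)
    (htail : ∀ i, ∃ C : ℝ, 0 < C ∧ ∀ᶠ r in atTop, ∑' m : ℤ, (if K i r < |(m : ℝ)| then
      ENNReal.ofReal (κ i * l i |(m : ℝ)| / (1 + |(m : ℝ)|) ^ (1 + α i)) else 0) ≤
      ENNReal.ofReal (C / r ^ β))
    (hK : IsScale K) (hs : Subgroup.closure (Set.range s) = ⊤) :
    ∃ C : ℝ, 0 < C ∧ ∀ᶠ r in atTop,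
      mean μ (Set.indicator {g | r < wordNorm s K g} 1) ≤ ENNReal.ofReal (C / r ^ β) := by
  choose C hC H using htail
  have hk := nonempty_of_powerMass hμ
  refine ⟨∑ i, C i, Finset.sum_pos (fun i _ => hC i) ⟨⟨0, hk⟩, Finset.mem_univ _⟩, ?_⟩
  filter_upwards [eventually_all.2 H, eventually_gt_atTop 0] with r hr hr0
  rw [mean_eq_of_powerMass hμ, Finset.sum_div, ENNReal.ofReal_sum_of_nonneg
    fun i _ => by have := hC i; positivity]
  have hk1 : (k : ℝ≥0∞)⁻¹ ≤ 1 := ENNReal.inv_le_one.2 (by exact_mod_cast hk)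
  refine (mul_le_of_le_one_left' hk1).trans (Finset.sum_le_sum fun i _ => le_trans ?_ (hr i))
  refine ENNReal.tsum_le_tsum fun n => ?_
  by_cases hn : K i r < |(n : ℝ)|
  · rw [if_pos hn]
    exact mul_le_of_le_one_right' (Set.indicator_le_self' (by simp) _)
  · have : ¬ r < wordNorm s K (s i ^ n) := not_lt.2 (hK.wordNorm_zpow_le hs hr0.le (not_lt.1 hn))
    simp [this]

end PowerMass

end

theorem mainTheorem4 {G : Type*} [Group G] [Group.IsNilpotent G]
    {k : ℕ} (s : Fin k → G) (hs : Subgroup.closure (Set.range s) = ⊤)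
    (α κ : Fin k → ℝ) (l F K : Fin k → ℝ → ℝ) (α₀ : ℝ)
    (hα : ∀ i, α i ∈ Set.Ioo (0 : ℝ) 2) (hκ : ∀ i, 0 < κ i)
    (hl : ∀ i, IsSlowlyVarying (l i))
    (hlpow : ∀ i, ∀ b : ℝ, 0 < b → (fun t => l i (t ^ b)) =Θ[atTop] l i)
    (hF : ∀ i, IsAsymptoticInverse (fun t => t ^ α i / l i t) (F i))
    (hFcomp : ∀ i j, F i =O[atTop] F j ∨ F j =O[atTop] F i)
    (hα₀ : α₀ ∈ Set.Ioo (0 : ℝ) 2) (hα₀_gt : ∀ i, α i < α₀)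
    (hα₀_div : ∀ i, ∀ m : ℕ, α₀ / α i ≠ m)
    (hK_convex : ∀ i, ConvexOn ℝ (Set.Ici 0) (K i))
    (hK_nonneg : ∀ i, ∀ t, 0 ≤ t → 0 ≤ K i t) (hK_zero : ∀ i, K i 0 = 0)
    (hKF : ∀ i, ∃ c C : ℝ, 0 < c ∧ 0 < C ∧ ∀ t : ℝ, 1 ≤ t →
      c * F i (t ^ α₀) ≤ K i t ∧ K i t ≤ C * F i (t ^ α₀))
    (μ : PMF G) (hμ : ∀ g, μ g = powerMass s κ α l g) :
    StronglyControlled μ (wordNorm s K) (fun t => t ^ (1 / α₀)) := by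
  have hβ := hα₀.1
  have hKt : ∀ i, Tendsto (K i) atTop atTop := fun i =>
    tendsto_of_comparable hβ (hF i).tendsto (hKF i)
  have hf := fun i => exists_rpow_div_comparable (hl i) (hα i).1 hβ (hF i) (hKF i)
  have hmono : ∀ i a b, 0 ≤ a → a ≤ b → K i a ≤ K i b := by
    intro i a b ha hab
    rcases ha.eq_or_lt with rfl | ha0
    · rw [hK_zero]; exact hK_nonneg i b hab
    have hb0 : 0 < b := by linarith
    have h1 := (hK_convex i).2 (show (0 : ℝ) ∈ Set.Ici 0 by simp) (show b ∈ Set.Ici 0 from hb0.le)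
      (show 0 ≤ 1 - a / b by rw [sub_nonneg, div_le_one hb0]; exact hab)
      (show 0 ≤ a / b by positivity) (by ring)
    simp only [smul_eq_mul, mul_zero, zero_add, hK_zero, div_mul_cancel₀ a hb0.ne'] at h1
    refine h1.trans (mul_le_of_le_one_left (hK_nonneg i b hb0.le) ?_)
    rwa [div_le_one hb0]
  have hK : IsScale K :=
    { convex := hK_convex
      nonneg := hK_nonneg
      zero := hK_zero
      tendsto := hKt
      doubling := by
        intro a ha
        choose C hC H using fun i =>
          exists_scale_doubling (hl i) (hα i).1 (hKt i) (hmono i) (hf i) ha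
        refine ⟨1 + ∑ i, C i, ?_, ?_⟩
        · have : 0 ≤ ∑ i, C i := Finset.sum_nonneg fun i _ => (hC i).le
          linarith
        · filter_upwards [eventually_all.2 H, eventually_ge_atTop 0] with r hr hr0 i
          refine (hr i).trans ?_
          gcongr
          · exact hK_nonneg i r hr0
          · have := Finset.single_le_sum (f := C) (fun i _ => (hC i).le) (Finset.mem_univ i)
            linarith }
  have hJ : HasJumps s K μ α₀ := hasJumps_of_powerMass hμ
    (fun i A hA => exists_le_step_mass (hl i) (hα i).1 (hκ i) hβ (hKt i) (hf i) hA) hK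
  have h : IsStableLike (wordNorm s K) μ α₀ :=
    { pos := hβ
      lt_two := hα₀.2
      symm := fun g => by rw [hμ, hμ, powerMass_inv]
      -- The atom at the identity comes from the zeroth power of a generator, that is, from the jump
      -- bound with `I = {0}`.
      lazy := by
        obtain ⟨c, hc, H⟩ := hJ 1 le_rfl
        let i : Fin k := ⟨0, nonempty_of_powerMass hμ⟩
        obtain ⟨r, hr, hr0, hKr⟩ := (H.and ((eventually_gt_atTop 0).and
          ((hKt i).eventually_gt_atTop 0))).exists
        have h1 := hr i {0} (fun j hj => by
          rw [Finset.mem_singleton.1 hj]; simpa using hKr.le) 1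
        simp only [Finset.sum_singleton, zpow_zero, Set.indicator_of_mem (Set.mem_singleton _),
          Pi.one_apply, mul_one] at h1
        exact ENNReal.toReal_pos
          ((ENNReal.ofReal_pos.2 (by positivity)).trans_le h1).ne' (μ.apply_ne_top _)
      norm := hK.isNorm hs
      inv := hK.wordNorm_inv hs
      finite_ball := hK.finite_ball hs
      doubling := hK.exists_volumeFun_le hs
      poincare := hJ.exists_poincare hK hs
      tail := exists_tail_of_powerMass hμ
        (fun i => exists_step_tail_le (hl i) (hα i).1 (hκ i) (hKt i) (hf i)) hK hs }
  exact h.stronglyControlled (hJ.hasLowerBound hK hs h)
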